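/- \textbf{Conventions.} All functions on $[0,\infty)$ are complex valued. For $t\ge 0$ put $$(f*g)(t)=\int_0^t f(t-s)g(s)\,ds,\qquad (f\circ g)(t)=\int_t^\infty f(s-t)g(s)\,ds,\qquad f*_c g=\tfrac12\,(f*g+f\circ g+g\circ f),$$ and $k^{*1}=k$, $k^{*(n+1)}=k*k^{*n}$. Let $\mathcal D_+$ be the space of restrictions to $[0,\infty)$ of $C^\infty$ functions on $\mathbb R$ with compact support. For $k\in L^1_{loc}([0,\infty))$, the condition $0\in\operatorname{supp}(k)$ means that $k$ does not vanish a.e. on any interval $(0,\varepsilon)$, $\varepsilon>0$. In this case $g\mapsto k\circ g$ is injective on $\mathcal D_+$; let $\mathcal D_k=\{k\circ g: g\in\mathcal D_+\}$ and let $W_k:\mathcal D_k\to\mathcal D_+$ be the inverse map, so $k\circ W_kf=f$. Put $\mathcal D_{k^{*\infty}}=\bigcap_{n\ge1}\mathcal D_{k^{*n}}$. This space carries the locally convex inductive limit topology of its subspaces $\{f:\operatorname{supp} f\subset[0,a]\}$, $a>0$, where on each such subspace convergence means uniform convergence of all derivatives of $W_{k^{*n}}f$ for every $n\ge1$. Let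 $X$ be a complex Banach space, $A$ a closed linear operator in $X$ with domain $D(A)$, and $0<\tau<\infty$. A strongly continuous family $(C_k(t))_{t\in[0,\tau]}$ of bounded operators on $X$ is a \emph{local $k$-convoluted cosine function generated by $A$} if, for all $t\in[0,\tau]$, $C_k(t)A\subset AC_k(t)$ and, for all $x\in X$, $\int_0^t(t-s)C_k(s)x\,ds\in D(A)$ and $$A\int_0^t(t-s)C_k(s)x\,ds=C_k(t)x-\Big(\int_0^tk(s)\,ds\Big)x .$$ It is \emph{non-degenerate} if $C_k(t)x=0$ for all $t\in[0,\tau]$ implies $x=0$. The \emph{extended families} $(C_{k^{*n}}(t))_{t\in[0,n\tau]}$, $n\ge1$, are defined recursively from $C_{k^{*1}}=C_k$ by $$C_{k^{*(n+1)}}(t)x=\int_0^t k(t-r)C_{k^{*n}}(r)x\,dr,\qquad 0\le t\le n\tau,$$ and, for $n\tau\le t\le(n+1)\tau$, $$\begin{aligned}C_{k^{*(n+1)}}(t)x={}&2C_{k^{*n}}(n\tau)C_k(t-n\tau)x+\int_0^{n\tau}k(t-r)C_{k^{*n}}(r)x\,dr+\int_0^{t-n\tau}k^{*n}(t-r)C_k(r)x\,dr\\&-\int_{2n\tau-t}^{n\tau}k(r+t-2n\tau)C_{k^{*n}}(r)x\,dr-\int_0^{t-n\tau}k^{*n}(r-t+2n\tau)C_k(r)x\,dr.\end{aligned}$$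 \textbf{Theorem.} Let $k\in L^1_{loc}([0,\infty))$ with $0\in\operatorname{supp}(k)$, let $0<\tau<\infty$, and let $(C_k(t))_{t\in[0,\tau]}$ be a non-degenerate local $k$-convoluted cosine function on $X$ generated by $A$. For $f\in\mathcal D_{k^{*\infty}}$ and $x\in X$ define $$\mathcal C_k(f)x=\int_0^{n\tau}W_{k^{*n}}f(t)\,C_{k^{*n}}(t)x\,dt\qquad\text{whenever } n\ge1,\ \operatorname{supp}f\subset[0,n\tau].$$ Then: (i) $\mathcal C_k$ is well defined (the integrals converge and do not depend on the admissible $n$), takes values in $\mathcal B(X)$, and is a continuous linear map $\mathcal D_{k^{*\infty}}\to\mathcal B(X)$, where $\mathcal B(X)$ carries the operator norm. (ii) For all $\varphi,\psi\in\mathcal D_{k^{*\infty}}$ one has $\varphi*_c\psi\in\mathcal D_{k^{*\infty}}$ and $\mathcal C_k(\varphi*_c\psi)=\mathcal C_k(\varphi)\,\mathcal C_k(\psi)$. (iii) For all $f\in\mathcal D_{k^{*\infty}}$ and $x\in X$ one has $f''\in\mathcal D_{k^{*\infty}}$, $\mathcal C_k(f)x\in D(A)$ and $A\,\mathcal C_k(f)x=\mathcal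 C_k(f'')x+f'(0)x$. -/

import Mathlib

open Set MeasureTheory Topology
open scoped ContDiff

noncomputable section

namespace ConvolutedCosine

/-! Functions on `[0, ∞)` are functions `ℝ → ℂ` of which only the values on `[0, ∞)` matter; test
functions on `[0, ∞)`, and the results of the convolution products below, are extended by `0` to
the negative half line, so that equality of such functions is equality on `[0, ∞)`. -/

/-- The convolution `(f * g)(t) = ∫₀ᵗ f(t - s) g(s) ds`, `t ≥ 0`. -/
def conv (f g : ℝ → ℂ) : ℝ → ℂ :=
  (Ici (0 : ℝ)).indicator fun t => ∫ s in (0 : ℝ)..t, f (t - s) * g s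

/-- The dual convolution `(f ∘ g)(t) = ∫ₜ^∞ f(s - t) g(s) ds`, `t ≥ 0`. -/
def dualConv (f g : ℝ → ℂ) : ℝ → ℂ :=
  (Ici (0 : ℝ)).indicator fun t => ∫ s in Ioi t, f (s - t) * g s

/-- The cosine convolution `f *_c g = (f * g + f ∘ g + g ∘ f) / 2`. -/
def cosConv (f g : ℝ → ℂ) : ℝ → ℂ :=
  (1 / 2 : ℂ) • (conv f g + dualConv f g + dualConv g f)

/-- The convolution powers `k^{*1} = k`, `k^{*(n+1)} = k * k^{*n}`. (The index `0` is not used.) -/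
def convPow (k : ℝ → ℂ) : ℕ → ℝ → ℂ
  | 0 => 0
  | 1 => k
  | n + 2 => conv k (convPow k (n + 1))

/-- `0` belongs to the (essential) support of `k`, a locally integrable function on `[0, ∞)`:
`k` does not vanish almost everywhere on any interval `(0, ε)`. -/
def ZeroMemSupp (k : ℝ → ℂ) : Prop :=
  ∀ ε : ℝ, 0 < ε → ¬ ∀ᵐ t ∂(volume.restrict (Ioo 0 ε)), k t = 0

/-- The space `𝒟₊` of the restrictions to `[0, ∞)` of smooth compactly supported functions on `ℝ`. -/
def Dplus : Submodule ℂ (ℝ → ℂ) where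
  carrier := {f | (∀ t < 0, f t = 0) ∧
    ∃ φ : ℝ → ℂ, ContDiff ℝ ∞ φ ∧ HasCompactSupport φ ∧ ∀ t, 0 ≤ t → f t = φ t}
  zero_mem' := ⟨fun _ _ => rfl, 0, contDiff_const, HasCompactSupport.zero, fun _ _ => rfl⟩
  add_mem' := by
    rintro f g ⟨hf, φ, h1, h2, h3⟩ ⟨hg, ψ, h4, h5, h6⟩
    refine ⟨fun t ht => ?_, φ + ψ, h1.add h4, h2.add h5, fun t ht => ?_⟩
    · simp [hf t ht, hg t ht]
    · simp [h3 t ht, h6 t ht]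
  smul_mem' := by
    rintro c f ⟨hf, φ, h1, h2, h3⟩
    refine ⟨fun t ht => ?_, c • φ, contDiff_const.smul h1, ?_, fun t ht => ?_⟩
    · simp [hf t ht]
    · exact h2.mono (Function.support_const_smul_subset c φ)
    · simp [h3 t ht]

/-- The space `𝒟_k = {k ∘ g : g ∈ 𝒟₊}`, the integrals being absolutely convergent (which is
automatic when `k` is locally integrable on `[0, ∞)`). -/
def Dk (k : ℝ → ℂ) : Submodule ℂ (ℝ → ℂ) where
  carrier := {f | ∃ g ∈ Dplus,
    (∀ t, 0 ≤ t → IntegrableOn (fun s => k (s - t) * g s) (Ioi t)) ∧ dualConv k g = f}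
  zero_mem' := by
    refine ⟨0, Dplus.zero_mem, fun t _ => by simp, ?_⟩
    funext t
    simp [dualConv]
  add_mem' := by
    rintro _ _ ⟨g, hg, ig, rfl⟩ ⟨h, hh, ih, rfl⟩
    refine ⟨g + h, Dplus.add_mem hg hh, fun t ht => ?_, ?_⟩
    · refine ((ig t ht).add (ih t ht)).congr (Filter.Eventually.of_forall fun s => ?_)
      simp [mul_add]
    · funext t
      by_cases ht : 0 ≤ t
      · have := integral_add (ig t ht) (ih t ht)
        simpa [dualConv, ht, mul_add] using this
      · simp [dualConv, ht]
  smul_mem' := by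
    rintro c _ ⟨g, hg, ig, rfl⟩
    refine ⟨c • g, Dplus.smul_mem c hg, fun t ht => ?_, ?_⟩
    · refine ((ig t ht).const_mul c).congr (Filter.Eventually.of_forall fun s => ?_)
      simp [mul_left_comm]
    · funext t
      by_cases ht : 0 ≤ t
      · simp [dualConv, ht, mul_left_comm _ c, integral_const_mul]
      · simp [dualConv, ht]

/-- `W_k f`: the function `g ∈ 𝒟₊` with `k ∘ g = f`, for `f ∈ 𝒟_k`
(it is unique when `0 ∈ supp k`). -/
def W (k f : ℝ → ℂ) : ℝ → ℂ :=
  Function.invFunOn (dualConv k) (Dplus : Set (ℝ → ℂ)) f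

/-- The test space `𝒟_{k^{*∞}} = ⋂_{n ≥ 1} 𝒟_{k^{*n}}`. -/
def Dinf (k : ℝ → ℂ) : Submodule ℂ (ℝ → ℂ) :=
  ⨅ (n : ℕ) (_ : 1 ≤ n), Dk (convPow k n)

/-- The topology of uniform convergence on `[0, ∞)` of functions together with all their
derivatives. -/
@[reducible] def smoothTopology : TopologicalSpace (ℝ → ℂ) :=
  ⨅ m : ℕ, TopologicalSpace.induced
    (fun g => UniformFun.ofFun (iteratedDerivWithin m g (Ici 0))) inferInstance

/-- The functions in `𝒟_{k^{*∞}}` with support in `[0, a]`. -/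
def DinfStep (k : ℝ → ℂ) (a : ℝ) : Set (Dinf k) :=
  {f | tsupport (f : ℝ → ℂ) ⊆ Icc 0 a}

/-- The topology of the functions in `𝒟_{k^{*∞}}` with support in `[0, a]`: uniform convergence of
all derivatives of `W_{k^{*n}} f`, for every `n ≥ 1`. -/
@[reducible] def stepTopology (k : ℝ → ℂ) (a : ℝ) : TopologicalSpace (DinfStep k a) :=
  ⨅ (n : ℕ) (_ : 1 ≤ n), TopologicalSpace.induced
    (fun f => W (convPow k n) (f : Dinf k)) smoothTopology

/-- The topology of `𝒟_{k^{*∞}}`: the locally convex inductive limit of the subspaces of functions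
with support in `[0, a]`, that is, the finest locally convex vector space topology for which the
inclusions of these subspaces are continuous. -/
@[reducible] def testTopology (k : ℝ → ℂ) : TopologicalSpace (Dinf k) :=
  sInf {t | @IsTopologicalAddGroup (Dinf k) t _ ∧ @ContinuousSMul ℂ (Dinf k) _ _ t ∧
    @LocallyConvexSpace ℝ (Dinf k) _ _ _ _ t ∧
    ∀ a : ℝ, Continuous[stepTopology k a, t] (Subtype.val : DinfStep k a → Dinf k)}

variable {X : Type*} [NormedAddCommGroup X] [NormedSpace ℂ X]

/-- `(C(t))`, `t ∈ [0, τ]`, is a local `k`-convoluted cosine function generated by the closed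
operator `A`. -/
structure IsLocalConvolutedCosine (A : X →ₗ.[ℂ] X) (k : ℝ → ℂ) (τ : ℝ)
    (C : ℝ → X →L[ℂ] X) : Prop where
  isClosed : A.IsClosed
  continuousOn : ∀ x : X, ContinuousOn (fun t => C t x) (Icc 0 τ)
  commutes : ∀ t ∈ Icc 0 τ, ∀ x : A.domain,
    ∃ h : C t x ∈ A.domain, A ⟨C t x, h⟩ = C t (A x)
  duhamel : ∀ t ∈ Icc 0 τ, ∀ x : X,
    ∃ h : (∫ s in (0 : ℝ)..t, (t - s) • C s x) ∈ A.domain,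
      A ⟨∫ s in (0 : ℝ)..t, (t - s) • C s x, h⟩ = C t x - (∫ s in (0 : ℝ)..t, k s) • x

/-- Non-degeneracy of `(C(t))`, `t ∈ [0, τ]`. -/
def NonDegenerate (τ : ℝ) (C : ℝ → X →L[ℂ] X) : Prop :=
  ∀ x : X, (∀ t ∈ Icc 0 τ, C t x = 0) → x = 0

/-- The passage from `(C_{k^{*n}}(t))` on `[0, nτ]` to `(C_{k^{*(n+1)}}(t))` on `[0, (n+1)τ]`. -/
def extStep (k : ℝ → ℂ) (τ : ℝ) (C : ℝ → X →L[ℂ] X) (n : ℕ) (Cn : ℝ → X → X)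
    (t : ℝ) (x : X) : X :=
  if t ≤ n * τ then ∫ r in (0 : ℝ)..t, k (t - r) • Cn r x
  else
    (2 : ℂ) • Cn (n * τ) (C (t - n * τ) x)
      + (∫ r in (0 : ℝ)..(n * τ), k (t - r) • Cn r x)
      + (∫ r in (0 : ℝ)..(t - n * τ), convPow k n (t - r) • C r x)
      - (∫ r in (2 * n * τ - t)..(n * τ), k (r + t - 2 * n * τ) • Cn r x)
      - ∫ r in (0 : ℝ)..(t - n * τ), convPow k n (r - t + 2 * n * τ) • C r x

/-- The extended families `C_{k^{*n}}(t) x`, `0 ≤ t ≤ nτ`, `n ≥ 1`. (The index `0` is not used.) -/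
def extFamily (k : ℝ → ℂ) (τ : ℝ) (C : ℝ → X →L[ℂ] X) : ℕ → ℝ → X → X
  | 0 => fun _ _ => 0
  | 1 => fun t x => C t x
  | n + 2 => extStep k τ C (n + 1) (extFamily k τ C (n + 1))

/-- The first derivative on `[0, ∞)` (one-sided at `0`). -/
def D1 (f : ℝ → ℂ) : ℝ → ℂ := derivWithin f (Ici 0)

end ConvolutedCosine

end

open ConvolutedCosine

/-! Write E_n for the extended family on [0, nτ]. If f = k^{*n} ∘ g with g supported in [0, nτ],
then 𝒞(f) = ∫ g E_n. The guiding principle is duality: convolution by k is adjoint to g ↦ k ∘ g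
(`integral_smul_cv`), so statements about E_n become identities between smooth functions, and the
merely integrable k is never differentiated.

Uniqueness of g and control of its support are Titchmarsh's convolution theorem: reversing time at
the end of the support turns k ∘ g into an ordinary convolution (`eq_zero_of_dc_eq_zero`).
Titchmarsh's theorem is reduced by a concavity argument to the case of a square h * h = 0, which
follows from Liouville's theorem and Fourier inversion. Since E_{n+1} = k * E_n on [0, nτ], duality
shows that 𝒞(f) does not depend on n (`IsTower.integral_eq`).

The closed operator A is encoded by bounded operators a, b with a u = b v exactly on the graph
(`exists_graph_operators`). With K = k^{*n} and T = nτ, the Duhamel equation of E = E_n has a weak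
form: A ∫ φ E x = ∫ φ'' E x + (K ∘ φ')(0) x for smooth φ vanishing on [T, ∞) (`IsFamily.weak_tail`;
converse in `duhamel_of_weak`). For φ = g this is already (iii), because differentiation commutes
with K ∘ ·. It also proves that the extension formula yields a family for the next convolution
power: tested against g, the extension becomes integrals of the old families against smooth
functions, and the boundary terms at T cancel (`duhamel_extFun_weak`).

For (ii), (K ∘ g) *_c (K ∘ h) equals K ∘ w with an explicit w (`cosLift`), so the test space is
closed under *_c. Fix h and x, and put y = ∫ h E x. The functionals g ↦ ∫ w E x and g ↦ ∫ g E y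
satisfy the same wave equation with the same source, so their difference is a solution with zero
data, and uniqueness annihilates it on all g = K ∘ m (`IsFamily.integral_dc_smul_eq_zero`). The left
factor can always be given this form, because it also lies in 𝒟_{k^{*2n}}.

Continuity on functions supported in [0, a] needs only the sup norm of W_{k^{*n}} f for one n with a
≤ nτ; the universal property of the inductive limit does the rest. -/

namespace ConvolutedCosine

/-! ### Convolution on a finite interval and Fubini on a triangle. -/

section Convolution

variable {Y : Type*} [NormedAddCommGroup Y] [NormedSpace ℂ Y]

/-- The triangle `0 < s ≤ t ≤ R` of pairs `(t, s)`. -/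
def triangle (R : ℝ) : Set (ℝ × ℝ) := {p | 0 < p.2 ∧ p.2 ≤ p.1 ∧ p.1 ≤ R}

lemma measurableSet_triangle (R : ℝ) : MeasurableSet (triangle R) :=
  (measurableSet_lt measurable_const measurable_snd).inter
    ((measurableSet_le measurable_snd measurable_fst).inter
      (measurableSet_le measurable_fst measurable_const))

/-- Fubini's theorem on a triangle. -/
lemma integral_triangle_swap {H : ℝ → ℝ → Y} {R : ℝ} (hR : 0 ≤ R)
    (hH : IntegrableOn (Function.uncurry H) (triangle R)) :
    ∫ t in (0 : ℝ)..R, ∫ s in (0 : ℝ)..t, H t s = ∫ s in (0 : ℝ)..R, ∫ t in s..R, H t s := by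
  set H' : ℝ → ℝ → Y := fun t s => (triangle R).indicator (Function.uncurry H) (t, s) with hH'
  have hi : Integrable (Function.uncurry H') := by
    rw [← integrable_indicator_iff (measurableSet_triangle R)] at hH
    exact hH
  have h1 : ∀ t ∈ uIcc 0 R, ∫ s in (0 : ℝ)..t, H t s = ∫ s in (0 : ℝ)..R, H' t s := by
    intro t ht
    rw [uIcc_of_le hR] at ht
    rw [intervalIntegral.integral_of_le ht.1, intervalIntegral.integral_of_le hR,
      ← integral_indicator measurableSet_Ioc, ← integral_indicator measurableSet_Ioc]
    congr 1
    funext s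
    by_cases hs : s ∈ Ioc 0 t
    · have hs' : s ∈ Ioc 0 R := ⟨hs.1, hs.2.trans ht.2⟩
      have : (t, s) ∈ triangle R := ⟨hs.1, hs.2, ht.2⟩
      simp [hs, hs', hH', this]
    · have : (t, s) ∉ triangle R := fun h => hs ⟨h.1, h.2.1⟩
      rw [indicator_of_notMem hs]
      simp [indicator_apply, hH', this]
  have h2 : ∀ s ∈ Ioc 0 R, ∫ t in s..R, H t s = ∫ t in (0 : ℝ)..R, H' t s := by
    intro s hs
    rw [intervalIntegral.integral_of_le hs.2, intervalIntegral.integral_of_le hR,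
      ← integral_Icc_eq_integral_Ioc,
      ← integral_indicator measurableSet_Ioc, ← integral_indicator measurableSet_Icc]
    congr 1
    funext t
    by_cases ht : t ∈ Icc s R
    · have ht' : t ∈ Ioc 0 R := ⟨hs.1.trans_le ht.1, ht.2⟩
      have : (t, s) ∈ triangle R := ⟨hs.1, ht.1, ht.2⟩
      simp [ht, ht', hH', this]
    · have : (t, s) ∉ triangle R := fun h => ht ⟨h.2.1, h.2.2⟩
      rw [indicator_of_notMem ht]
      simp [indicator_apply, hH', this]
  rw [intervalIntegral.integral_congr h1, intervalIntegral_intervalIntegral_swap hi.integrableOn,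
    intervalIntegral.integral_of_le hR, intervalIntegral.integral_of_le hR]
  exact setIntegral_congr_fun measurableSet_Ioc fun s hs => (h2 s hs).symm

lemma triangle_subset (R : ℝ) : triangle R ⊆ Icc 0 R ×ˢ Icc 0 R :=
  fun _ h => ⟨⟨h.1.le.trans h.2.1, h.2.2⟩, h.1.le, h.2.1.trans h.2.2⟩

lemma integral_triangle_swap_of_continuous {H : ℝ → ℝ → Y} {R : ℝ} (hR : 0 ≤ R)
    (hH : Continuous (Function.uncurry H)) :
    ∫ t in (0 : ℝ)..R, ∫ s in (0 : ℝ)..t, H t s = ∫ s in (0 : ℝ)..R, ∫ t in s..R, H t s :=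
  integral_triangle_swap hR <|
    (hH.continuousOn.integrableOn_compact (isCompact_Icc.prod isCompact_Icc)).mono_set
      (triangle_subset R)

/-- The convolution over `[0, t]` of a scalar function and a vector valued one. -/
noncomputable def cv (κ : ℝ → ℂ) (F : ℝ → Y) (t : ℝ) : Y :=
  ∫ s in (0 : ℝ)..t, κ (t - s) • F s

lemma cv_eq_flip (κ : ℝ → ℂ) (F : ℝ → Y) (t : ℝ) :
    cv κ F t = ∫ u in (0 : ℝ)..t, κ u • F (t - u) := by
  have := intervalIntegral.integral_comp_sub_left (a := 0) (b := t)
    (fun u => κ u • F (t - u)) t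
  simpa [cv] using this

lemma cv_comm (f g : ℝ → ℂ) : cv f g = cv g f := by
  funext t
  rw [cv_eq_flip, cv]
  simp [mul_comm]

@[fun_prop]
lemma continuous_cv {κ : ℝ → ℂ} {F : ℝ → Y} (hκ : Continuous κ) (hF : Continuous F) :
    Continuous (cv κ F) := by
  unfold cv
  fun_prop

lemma cv_congr {κ κ' : ℝ → ℂ} {F F' : ℝ → Y} {t : ℝ} (ht : 0 ≤ t)
    (h1 : ∀ s ∈ Icc 0 t, κ s = κ' s) (h2 : ∀ s ∈ Icc 0 t, F s = F' s) : cv κ F t = cv κ' F' t := by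
  refine intervalIntegral.integral_congr fun s hs => ?_
  rw [uIcc_of_le ht] at hs
  rw [h1 _ ⟨by linarith [hs.2], by linarith [hs.1]⟩, h2 s hs]

lemma cv_assoc_of_integrableOn {k f g : ℝ → ℂ} {t : ℝ} (ht : 0 ≤ t)
    (hk : IntegrableOn (fun p : ℝ × ℝ => k (t - p.1) * f (p.1 - p.2) * g p.2) (triangle t)) :
    cv (cv k f) g t = cv k (cv f g) t := by
  have h := integral_triangle_swap (H := fun p s => k (t - p) * f (p - s) * g s) ht hk
  have e1 : cv k (cv f g) t = ∫ p in (0 : ℝ)..t, ∫ s in (0 : ℝ)..p, k (t - p) * f (p - s) * g s := by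
    unfold cv
    refine intervalIntegral.integral_congr fun p _ => ?_
    simp only [smul_eq_mul, mul_assoc]
    rw [intervalIntegral.integral_const_mul]
  rw [e1, h]
  unfold cv
  refine intervalIntegral.integral_congr fun s _ => ?_
  simp only [smul_eq_mul]
  rw [intervalIntegral.integral_mul_const]
  congr 1
  have := intervalIntegral.integral_comp_sub_right (a := s) (b := t)
    (fun r => k (t - s - r) * f r) s
  simp only [sub_self] at this
  rw [← this]
  refine intervalIntegral.integral_congr fun p _ => ?_
  congr 2
  ring

lemma cv_assoc {k f g : ℝ → ℂ} (hk : Continuous k) (hf : Continuous f) (hg : Continuous g)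
    {t : ℝ} (ht : 0 ≤ t) : cv (cv k f) g t = cv k (cv f g) t :=
  cv_assoc_of_integrableOn ht <|
    ((show Continuous fun p : ℝ × ℝ => k (t - p.1) * f (p.1 - p.2) * g p.2 by
      fun_prop).continuousOn.integrableOn_compact (isCompact_Icc.prod isCompact_Icc)).mono_set
      (triangle_subset t)

lemma cv_mul_id {f g : ℝ → ℂ} (hf : Continuous f) (hg : Continuous g) (t : ℝ) :
    (t : ℂ) * cv f g t = cv (fun s => (s : ℂ) * f s) g t + cv f (fun s => (s : ℂ) * g s) t := by
  unfold cv
  rw [← intervalIntegral.integral_const_mul, ← intervalIntegral.integral_add]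
  · refine intervalIntegral.integral_congr fun s _ => ?_
    simp only [smul_eq_mul, Complex.ofReal_sub]
    ring
  · exact Continuous.intervalIntegrable (by fun_prop) _ _
  · exact Continuous.intervalIntegrable (by fun_prop) _ _

end Convolution

/-! ### Titchmarsh's convolution theorem. -/

section Titchmarsh

/-- The finite Laplace transform `λ ↦ ∫₀ᴿ e^{λ(R - t)} h(t) dt`. -/
noncomputable def laplace (h : ℝ → ℂ) (R R' : ℝ) (z : ℂ) : ℂ :=
  ∫ t in (0 : ℝ)..R', Complex.exp (z * ((R - t : ℝ) : ℂ)) * h t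

lemma norm_cexp_mul_real (z : ℂ) (x : ℝ) : ‖Complex.exp (z * (x : ℂ))‖ = Real.exp (z.re * x) := by
  rw [Complex.norm_exp]
  simp

lemma laplace_differentiable {h : ℝ → ℂ} (hh : Continuous h) (R : ℝ) (hR : 0 ≤ R) :
    Differentiable ℂ (laplace h R R) := by
  intro z₀
  obtain ⟨M, hM⟩ := (isCompact_Icc (a := (0 : ℝ)) (b := R)).exists_bound_of_continuousOn
    hh.continuousOn
  refine (intervalIntegral.hasDerivAt_integral_of_dominated_loc_of_deriv_le (𝕜 := ℂ)
    (F' := fun z t => ((R - t : ℝ) : ℂ) * Complex.exp (z * ((R - t : ℝ) : ℂ)) * h t)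
    (bound := fun _ => R * Real.exp ((|z₀.re| + 1) * R) * M) (Metric.ball_mem_nhds z₀ one_pos)
    ?_ ?_ ?_ ?_ ?_ ?_).2.differentiableAt
  · exact Filter.Eventually.of_forall fun z => (by fun_prop : Continuous _).aestronglyMeasurable
  · exact Continuous.intervalIntegrable (by fun_prop) _ _
  · exact (by fun_prop : Continuous _).aestronglyMeasurable
  · refine Filter.Eventually.of_forall fun t ht z hz => ?_
    rw [uIoc_of_le hR] at ht
    rw [norm_mul, norm_mul, norm_cexp_mul_real, Complex.norm_real, Real.norm_eq_abs,
      abs_of_nonneg (by linarith [ht.2])]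
    have hre : z.re ≤ |z₀.re| + 1 := by
      have h1 : |z.re - z₀.re| ≤ ‖z - z₀‖ := by simpa using Complex.abs_re_le_norm (z - z₀)
      have h2 : ‖z - z₀‖ < 1 := by simpa [dist_eq_norm] using hz
      have := le_abs_self (z.re - z₀.re)
      have := le_abs_self z₀.re
      linarith
    have hM0 := hM t ⟨ht.1.le, ht.2⟩
    have hexp : z.re * (R - t) ≤ (|z₀.re| + 1) * R :=
      (mul_le_mul_of_nonneg_right hre (by linarith [ht.2])).trans
        (mul_le_mul_of_nonneg_left (by linarith [ht.1]) (by positivity))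
    have : R - t ≤ R := by linarith [ht.1]
    gcongr
  · exact intervalIntegrable_const
  · refine Filter.Eventually.of_forall fun t _ z _ => ?_
    have : HasDerivAt (fun z : ℂ => Complex.exp (z * ((R - t : ℝ) : ℂ)))
        (Complex.exp (z * ((R - t : ℝ) : ℂ)) * (1 * ((R - t : ℝ) : ℂ))) z :=
      ((hasDerivAt_id z).mul_const _).cexp
    refine (this.mul_const (h t)).congr_deriv ?_
    ring

lemma norm_laplace_le_of_re_nonpos {h : ℝ → ℂ} {R M : ℝ} (hR : 0 ≤ R)
    (hM : ∀ t ∈ Icc 0 R, ‖h t‖ ≤ M) {z : ℂ} (hz : z.re ≤ 0) : ‖laplace h R R z‖ ≤ M * R := by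
  have := intervalIntegral.norm_integral_le_of_norm_le_const (a := 0) (b := R)
    (f := fun t => Complex.exp (z * ((R - t : ℝ) : ℂ)) * h t) (C := M) fun t ht => by
      rw [uIoc_of_le hR] at ht
      rw [norm_mul, norm_cexp_mul_real]
      have h1 : Real.exp (z.re * (R - t)) ≤ 1 :=
        Real.exp_le_one_iff.2 (mul_nonpos_of_nonpos_of_nonneg hz (by linarith [ht.2]))
      calc _ ≤ 1 * ‖h t‖ := by gcongr
        _ ≤ M := by simpa using hM t ⟨ht.1.le, ht.2⟩
  simpa [laplace, abs_of_nonneg hR] using this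

/-- The square of the transform over [0, 2R] is an integral of e^{z(2R - t - s)} h(t) h(s) over a
square. The half t + s ≤ 2R equals ∫ e^{z(2R - p)} (h * h)(p) dp and vanishes; on the other half the
exponential has modulus at most 1. -/
lemma norm_laplace_sq_le {h : ℝ → ℂ} (hh : Continuous h) {R M : ℝ} (hR : 0 ≤ R)
    (hM : ∀ t ∈ Icc 0 (2 * R), ‖h t‖ ≤ M) (hcv : ∀ t ∈ Icc 0 (2 * R), cv h h t = 0)
    {z : ℂ} (hz : 0 ≤ z.re) : ‖laplace h R (2 * R) z‖ ≤ 2 * R * M := by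
  have hM0 : 0 ≤ M := (norm_nonneg _).trans (hM 0 ⟨le_rfl, by linarith⟩)
  set e : ℝ → ℂ := fun t => Complex.exp (z * ((R - t : ℝ) : ℂ)) * h t with he
  have hec : Continuous e := by fun_prop
  have hec2 : Continuous fun s => ∫ t in (2 * R - s)..(2 * R), e t := by
    simp_rw [intervalIntegral.integral_symm (2 * R)]
    fun_prop
  have hsq : laplace h R (2 * R) z ^ 2 =
      (∫ s in (0 : ℝ)..(2 * R), (∫ t in (0 : ℝ)..(2 * R - s), e t) * e s) +
      ∫ s in (0 : ℝ)..(2 * R), (∫ t in (2 * R - s)..(2 * R), e t) * e s := by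
    rw [← intervalIntegral.integral_add (Continuous.intervalIntegrable (by fun_prop) _ _)
      (Continuous.intervalIntegrable (by fun_prop) _ _)]
    simp_rw [← add_mul, intervalIntegral.integral_add_adjacent_intervals
      (hec.intervalIntegrable _ _) (hec.intervalIntegrable _ _)]
    rw [intervalIntegral.integral_const_mul, sq]
    rfl
  have hfirst : ∫ s in (0 : ℝ)..(2 * R), (∫ t in (0 : ℝ)..(2 * R - s), e t) * e s = 0 := by
    have h1 : ∀ s, (∫ t in (0 : ℝ)..(2 * R - s), e t) * e s
        = ∫ p in s..(2 * R), e (p - s) * e s := fun s => by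
      rw [intervalIntegral.integral_mul_const, intervalIntegral.integral_comp_sub_right, sub_self]
    simp_rw [h1]
    rw [← integral_triangle_swap_of_continuous (H := fun p s => e (p - s) * e s)
      (by linarith) (by unfold Function.uncurry; fun_prop)]
    refine (intervalIntegral.integral_congr (g := fun _ => (0 : ℂ)) fun p hp => ?_).trans (by simp)
    rw [uIcc_of_le (by linarith)] at hp
    have h2 : ∀ s, e (p - s) * e s
        = Complex.exp (z * ((2 * R - p : ℝ) : ℂ)) * (h (p - s) * h s) := fun s => by
      simp only [he]
      rw [show z * ((2 * R - p : ℝ) : ℂ)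
        = z * ((R - (p - s) : ℝ) : ℂ) + z * ((R - s : ℝ) : ℂ) by push_cast; ring, Complex.exp_add]
      ring
    simp_rw [h2]
    rw [intervalIntegral.integral_const_mul]
    have := hcv p hp
    simp only [cv, smul_eq_mul] at this
    rw [this, mul_zero]
  have hsecond : ‖∫ s in (0 : ℝ)..(2 * R), (∫ t in (2 * R - s)..(2 * R), e t) * e s‖
      ≤ 2 * R * M * M * |2 * R - 0| := by
    refine intervalIntegral.norm_integral_le_of_norm_le_const fun s hs => ?_
    rw [uIoc_of_le (by linarith)] at hs
    rw [← intervalIntegral.integral_mul_const]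
    refine (intervalIntegral.norm_integral_le_of_norm_le_const (C := M * M) fun t ht => ?_).trans ?_
    · rw [uIoc_of_le (by linarith [hs.1])] at ht
      have h2 : e t * e s
          = Complex.exp (z * ((2 * R - t - s : ℝ) : ℂ)) * (h t * h s) := by
        simp only [he]
        rw [show z * ((2 * R - t - s : ℝ) : ℂ)
          = z * ((R - t : ℝ) : ℂ) + z * ((R - s : ℝ) : ℂ) by push_cast; ring, Complex.exp_add]
        ring
      rw [h2, norm_mul, norm_cexp_mul_real, norm_mul]
      have h3 : Real.exp (z.re * (2 * R - t - s)) ≤ 1 :=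
        Real.exp_le_one_iff.2 (mul_nonpos_of_nonneg_of_nonpos hz (by linarith [ht.1]))
      have h4 := hM t ⟨by linarith [ht.1, hs.2], ht.2⟩
      have h5 := hM s ⟨hs.1.le, hs.2⟩
      calc _ ≤ 1 * (M * M) := by gcongr
        _ = M * M := one_mul _
    · rw [abs_of_nonneg (by linarith [hs.1])]
      nlinarith [mul_nonneg hM0 hM0, hs.2]
  have : ‖laplace h R (2 * R) z‖ ^ 2 ≤ (2 * R * M) ^ 2 := by
    rw [← norm_pow, hsq, hfirst, zero_add]
    refine hsecond.trans (le_of_eq ?_)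
    rw [sub_zero, abs_of_nonneg (by linarith)]
    ring
  exact le_of_sq_le_sq this (by positivity)

/-- For Re z ≤ 0 the bound is trivial. For Re z ≥ 0 the transforms over [0, R] and [0, 2R] differ by
an integral over [R, 2R], where R - t ≤ 0 keeps the exponential at most 1 in modulus. -/
lemma laplace_bounded {h : ℝ → ℂ} (hh : Continuous h) {R : ℝ} (hR : 0 ≤ R)
    (hcv : ∀ t ∈ Icc 0 (2 * R), cv h h t = 0) : ∃ B, ∀ z, ‖laplace h R R z‖ ≤ B := by
  obtain ⟨M, hM⟩ := (isCompact_Icc (a := (0 : ℝ)) (b := 2 * R)).exists_bound_of_continuousOn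
    hh.continuousOn
  have hM0 : 0 ≤ M := (norm_nonneg _).trans (hM 0 ⟨le_rfl, by linarith⟩)
  refine ⟨3 * (R * M), fun z => ?_⟩
  rcases le_total z.re 0 with hz | hz
  · refine (norm_laplace_le_of_re_nonpos hR
      (fun t ht => hM t ⟨ht.1, by linarith [ht.2]⟩) hz).trans ?_
    nlinarith [mul_nonneg hR hM0]
  · have h1 := norm_laplace_sq_le hh hR hM hcv hz
    have hec : Continuous fun t : ℝ => Complex.exp (z * ((R - t : ℝ) : ℂ)) * h t := by fun_prop
    have h2 : laplace h R R z = laplace h R (2 * R) z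
        - ∫ t in R..(2 * R), Complex.exp (z * ((R - t : ℝ) : ℂ)) * h t := by
      rw [eq_sub_iff_add_eq]
      exact intervalIntegral.integral_add_adjacent_intervals
        (hec.intervalIntegrable _ _) (hec.intervalIntegrable _ _)
    have h3 : ‖∫ t in R..(2 * R), Complex.exp (z * ((R - t : ℝ) : ℂ)) * h t‖
        ≤ M * |2 * R - R| := by
      refine intervalIntegral.norm_integral_le_of_norm_le_const fun t ht => ?_
      rw [uIoc_of_le (by linarith)] at ht
      rw [norm_mul, norm_cexp_mul_real]
      have h4 : Real.exp (z.re * (R - t)) ≤ 1 :=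
        Real.exp_le_one_iff.2 (mul_nonpos_of_nonneg_of_nonpos hz (by linarith [ht.1]))
      calc _ ≤ 1 * M := by
            gcongr
            exact hM t ⟨by linarith [ht.1], ht.2⟩
        _ = M := one_mul _
    rw [show 2 * R - R = R by ring, abs_of_nonneg hR] at h3
    rw [h2]
    refine (norm_sub_le _ _).trans ?_
    linarith

/-- Liouville: a bounded entire function is constant, and dominated convergence along z → -∞ shows
that the constant is 0, the point t = R being negligible. -/
lemma laplace_eq_zero {h : ℝ → ℂ} (hh : Continuous h) {R : ℝ} (hR : 0 ≤ R)
    (hcv : ∀ t ∈ Icc 0 (2 * R), cv h h t = 0) (z : ℂ) : laplace h R R z = 0 := by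
  obtain ⟨B, hB⟩ := laplace_bounded hh hR hcv
  have hconst : ∀ w, laplace h R R w = laplace h R R z := fun w =>
    (laplace_differentiable hh R hR).apply_eq_apply_of_bounded
      (isBounded_iff_forall_norm_le.2 ⟨B, by rintro _ ⟨w, rfl⟩; exact hB w⟩) w z
  obtain ⟨M, hM⟩ := (isCompact_Icc (a := (0 : ℝ)) (b := R)).exists_bound_of_continuousOn
    hh.continuousOn
  have hlim : Filter.Tendsto (fun x : ℝ => laplace h R R ((-x : ℝ) : ℂ)) Filter.atTop
      (𝓝 (∫ _ in (0 : ℝ)..R, (0 : ℂ))) := by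
    refine intervalIntegral.tendsto_integral_filter_of_dominated_convergence (fun _ => M) ?_ ?_
      intervalIntegrable_const ?_
    · exact Filter.Eventually.of_forall fun x => (by fun_prop : Continuous _).aestronglyMeasurable
    · filter_upwards [Filter.eventually_ge_atTop 0] with x hx
      refine Filter.Eventually.of_forall fun t ht => ?_
      rw [uIoc_of_le hR] at ht
      rw [norm_mul, norm_cexp_mul_real]
      have h4 : Real.exp ((((-x : ℝ) : ℂ)).re * (R - t)) ≤ 1 := by
        rw [Complex.ofReal_re]
        exact Real.exp_le_one_iff.2 (mul_nonpos_of_nonpos_of_nonneg (by linarith)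
          (by linarith [ht.2]))
      calc _ ≤ 1 * M := by
            gcongr
            exact hM t ⟨ht.1.le, ht.2⟩
        _ = M := one_mul _
    · have hne : ∀ᵐ t : ℝ, t ≠ R := by simp [ae_iff]
      filter_upwards [hne] with t htR ht
      rw [uIoc_of_le hR] at ht
      have hpos : 0 < R - t := sub_pos.2 (lt_of_le_of_ne ht.2 htR)
      rw [tendsto_zero_iff_norm_tendsto_zero]
      simp_rw [norm_mul, norm_cexp_mul_real, Complex.ofReal_re]
      rw [show (0 : ℝ) = 0 * ‖h t‖ by simp]
      refine Filter.Tendsto.mul_const _ (Real.tendsto_exp_atBot.comp ?_)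
      simp_rw [neg_mul]
      exact Filter.tendsto_neg_atTop_atBot.comp (Filter.tendsto_id.atTop_mul_const hpos)
  simp_rw [hconst] at hlim
  simpa using tendsto_nhds_unique tendsto_const_nhds hlim

/-- Titchmarsh's theorem for a convolution square. -/
lemma eq_zero_of_cv_self_eq_zero {h : ℝ → ℂ} (hh : Continuous h) {R : ℝ} (hR : 0 ≤ R)
    (hcv : ∀ t ∈ Icc 0 (2 * R), cv h h t = 0) : ∀ t ∈ Ioo 0 R, h t = 0 := by
  set φ : ℝ → ℂ := (Ioc 0 R).indicator h with hφ
  have hi : Integrable φ := by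
    rw [hφ, integrable_indicator_iff measurableSet_Ioc]
    exact (hh.integrableOn_Icc).mono_set Ioc_subset_Icc_self
  have hF : FourierTransform.fourier φ = 0 := by
    funext w
    rw [Real.fourier_real_eq_integral_exp_smul]
    -- At z = 2πiw the finite transform is, up to the unimodular factor e^{2πiwR}, the Fourier
    -- transform of h cut off to (0, R]. Inversion then applies at interior points, where the
    -- cut-off function is still continuous.
    have h0 := laplace_eq_zero hh hR hcv (2 * Real.pi * w * Complex.I)
    have : laplace h R R (2 * Real.pi * w * Complex.I)
        = Complex.exp (2 * Real.pi * w * Complex.I * R) *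
          ∫ v : ℝ, Complex.exp (((-2 * Real.pi * v * w : ℝ) : ℂ) * Complex.I) • φ v := by
      rw [laplace, intervalIntegral.integral_of_le hR, ← integral_indicator measurableSet_Ioc,
        ← integral_const_mul]
      congr 1
      funext t
      by_cases ht : t ∈ Ioc 0 R
      · simp only [hφ, indicator_of_mem ht, smul_eq_mul]
        rw [← mul_assoc, ← Complex.exp_add]
        congr 2
        push_cast
        ring
      · simp [hφ, indicator_of_notMem ht]
    rw [this] at h0
    simpa using h0
  intro t ht
  have hev : φ =ᶠ[𝓝 t] h := by
    filter_upwards [Ioo_mem_nhds ht.1 ht.2] with s hs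
    simp [hφ, indicator_of_mem (Ioo_subset_Ioc_self hs)]
  have hct : ContinuousAt φ t := hh.continuousAt.congr hev.symm
  have := hi.fourierInv_fourier_eq (by rw [hF]; exact integrable_zero _ _ _) hct
  rw [← hev.eq_of_nhds, ← this, hF]
  simp [Real.fourierInv_eq]

/-- `h` vanishes on `[0, R]`. -/
def ZeroUpTo (h : ℝ → ℂ) (R : ℝ) : Prop := ∀ t ∈ Icc 0 R, h t = 0

lemma ZeroUpTo.cv {f g : ℝ → ℂ} {R R' : ℝ} (hf : ZeroUpTo f R) (hg : ZeroUpTo g R') :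
    ZeroUpTo (ConvolutedCosine.cv f g) (R + R') := by
  intro t ht
  refine (intervalIntegral.integral_congr (g := fun _ => (0 : ℂ)) fun s hs => ?_).trans (by simp)
  rw [uIcc_of_le ht.1] at hs
  rcases le_total s R' with h | h
  · simp [hg s ⟨hs.1, h⟩]
  · simp [hf (t - s) ⟨by linarith [hs.2], by linarith [ht.2]⟩]

lemma ZeroUpTo.of_Ioo {h : ℝ → ℂ} (hh : Continuous h) (h0 : h 0 = 0) {R : ℝ}
    (H : ∀ t ∈ Ioo 0 R, h t = 0) : ZeroUpTo h R := by
  intro t ht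
  rcases ht.1.eq_or_lt with rfl | h1
  · exact h0
  · have hR : (0 : ℝ) ≠ R := by linarith [ht.2]
    have : t ∈ closure (Ioo 0 R) := by rw [closure_Ioo hR]; exact ht
    exact (isClosed_singleton.preimage hh).closure_subset_iff.2 (fun s hs => H s hs) this

lemma cv_zero {f g : ℝ → ℂ} : cv f g 0 = 0 := by simp [cv]

lemma ZeroUpTo.of_cv_self {h : ℝ → ℂ} (hh : Continuous h) (h0 : h 0 = 0) {R : ℝ}
    (H : ZeroUpTo (ConvolutedCosine.cv h h) (2 * R)) : ZeroUpTo h R := by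
  rcases lt_or_ge R 0 with hR | hR
  · intro t ht
    linarith [ht.1, ht.2]
  · exact .of_Ioo hh h0 (eq_zero_of_cv_self_eq_zero hh hR H)

lemma cv_add_right {f g h : ℝ → ℂ} (hf : Continuous f) (hg : Continuous g) (hh : Continuous h)
    (t : ℝ) : cv f (fun s => g s + h s) t = cv f g t + cv f h t := by
  unfold cv
  rw [← intervalIntegral.integral_add (Continuous.intervalIntegrable (by fun_prop) _ _)
      (Continuous.intervalIntegrable (by fun_prop) _ _)]
  simp [mul_add]

/-- The exchange `(f * tg) * (tf * g) = (f * g) * (tf * tg)`. -/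
lemma cv_cv_exchange {f g f' g' : ℝ → ℂ} (hf : Continuous f) (hg : Continuous g)
    (hf' : Continuous f') (hg' : Continuous g') {t : ℝ} (ht : 0 ≤ t) :
    cv (cv f g') (cv f' g) t = cv (cv f g) (cv f' g') t := by
  rw [cv_assoc hf hg' (by fun_prop) ht, cv_assoc hf hg (by fun_prop) ht]
  refine cv_congr ht (fun _ _ => rfl) fun s hs => ?_
  rw [← cv_assoc hg' hf' hg hs.1, ← cv_assoc hg hf' hg' hs.1, cv_comm _ g]
  rw [cv_assoc hg hf' hg' hs.1]
  refine cv_congr hs.1 (fun _ _ => rfl) fun r _ => ?_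
  rw [cv_comm]

/-- If `f * g` and `tf * tg` vanish up to `R` and `R''`, then `f * tg` and `tf * g` vanish up to
`(R + R'') / 2`. -/
lemma ZeroUpTo.cv_step {f g : ℝ → ℂ} (hf : Continuous f) (hg : Continuous g) {R R'' : ℝ}
    (h0 : ZeroUpTo (ConvolutedCosine.cv f g) R)
    (h1 : ZeroUpTo (ConvolutedCosine.cv f fun s => (s : ℂ) * g s) R'')
    (h2 : ZeroUpTo (ConvolutedCosine.cv (fun s => (s : ℂ) * f s) fun s => (s : ℂ) * g s) R'') :
    ZeroUpTo (ConvolutedCosine.cv f fun s => (s : ℂ) * g s) ((R + R'') / 2) := by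
  set f' : ℝ → ℂ := fun s => (s : ℂ) * f s with hf'
  set g' : ℝ → ℂ := fun s => (s : ℂ) * g s with hg'
  have hf'c : Continuous f' := by fun_prop
  have hg'c : Continuous g' := by fun_prop
  refine .of_cv_self (by fun_prop) cv_zero fun t ht => ?_
  rw [show 2 * ((R + R'') / 2) = R + R'' by ring] at ht
  have ha : ZeroUpTo (fun s : ℝ => (s : ℂ) * ConvolutedCosine.cv f g s) R :=
    fun s hs => by simp [h0 s hs]
  -- The product rule for multiplication by t expands (f * tg) * t(f * g). The left side and the
  -- cross term (f * tg) * (tf * g) = (f * g) * (tf * tg) vanish up to R + R'', hence so does the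
  -- square of f * tg.
  have key : ConvolutedCosine.cv (ConvolutedCosine.cv f g') (fun s : ℝ => (s : ℂ) * ConvolutedCosine.cv f g s) t
      = ConvolutedCosine.cv (ConvolutedCosine.cv f g') (ConvolutedCosine.cv f' g) t
        + ConvolutedCosine.cv (ConvolutedCosine.cv f g') (ConvolutedCosine.cv f g') t := by
    rw [← cv_add_right (by fun_prop) (by fun_prop) (by fun_prop)]
    refine cv_congr ht.1 (fun _ _ => rfl) fun s _ => cv_mul_id hf hg s
  rw [cv_cv_exchange hf hg hf'c hg'c ht.1, (h0.cv h2) t ht, zero_add, cv_comm] at key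
  rw [← key]
  exact (ha.cv h1) t ht

/-- `s ↦ sⁱ f(s)`. -/
def powMul (i : ℕ) (f : ℝ → ℂ) (s : ℝ) : ℂ := (s : ℂ) ^ i * f s

@[fun_prop]
lemma continuous_powMul (i : ℕ) {f : ℝ → ℂ} (hf : Continuous f) : Continuous (powMul i f) := by
  unfold powMul
  fun_prop

lemma powMul_succ (i : ℕ) (f : ℝ → ℂ) : powMul (i + 1) f = fun s : ℝ => (s : ℂ) * powMul i f s := by
  funext s
  simp only [powMul]
  ring

lemma powMul_zero (f : ℝ → ℂ) : powMul 0 f = f := by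
  funext s
  simp [powMul]

/-- The numbers `R ≤ T` such that all `tⁱ f * tʲ g`, `i + j = n`, vanish on `[0, R]`. -/
def zeroRadii (f g : ℝ → ℂ) (T : ℝ) (n : ℕ) : Set ℝ :=
  {R | R ≤ T ∧ ∀ i j, i + j = n → ZeroUpTo (cv (powMul i f) (powMul j g)) R}

lemma zero_mem_zeroRadii (f g : ℝ → ℂ) {T : ℝ} (hT : 0 ≤ T) (n : ℕ) : 0 ∈ zeroRadii f g T n :=
  ⟨hT, fun i j _ t ht => by
    rw [le_antisymm ht.2 ht.1]
    exact cv_zero⟩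

lemma bddAbove_zeroRadii (f g : ℝ → ℂ) (T : ℝ) (n : ℕ) : BddAbove (zeroRadii f g T n) :=
  ⟨T, fun _ h => h.1⟩

/-- This is the midpoint inequality that makes the suprema of `zeroRadii` concave in n. -/
lemma zeroRadii_step {f g : ℝ → ℂ} (hf : Continuous f) (hg : Continuous g) {T : ℝ}
    {n : ℕ} {R R'' : ℝ} (h0 : R ∈ zeroRadii f g T n) (h2 : R'' ∈ zeroRadii f g T (n + 2)) :
    (R + R'') / 2 ∈ zeroRadii f g T (n + 1) := by
  -- Level n + 2 controls level n + 1: t (tⁱ f * tʲ g) is a sum of two terms of level n + 2, and the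
  -- factor t is cancelled away from 0.
  have h1 : ∀ i j, i + j = n + 1 → ZeroUpTo (cv (powMul i f) (powMul j g)) R'' := by
    intro i j hij
    refine .of_Ioo (by fun_prop) cv_zero fun t ht => ?_
    have h3 := h2.2 (i + 1) j (by omega) t ⟨ht.1.le, ht.2.le⟩
    have h4 := h2.2 i (j + 1) (by omega) t ⟨ht.1.le, ht.2.le⟩
    have h5 := cv_mul_id (continuous_powMul i hf) (continuous_powMul j hg) t
    rw [← powMul_succ, ← powMul_succ, h3, h4, add_zero] at h5
    exact (mul_eq_zero.1 h5).resolve_left (by exact_mod_cast ht.1.ne')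
  refine ⟨by linarith [h0.1, h2.1], fun i j hij => ?_⟩
  -- For j = 0 the factor t has to be split off from the power of f instead, so commutativity
  -- exchanges the two roles.
  rcases j with _ | j
  · obtain rfl : i = n + 1 := by omega
    rw [powMul_succ, cv_comm]
    refine ZeroUpTo.cv_step (by fun_prop) (by fun_prop) ?_ ?_ ?_
    · rw [cv_comm]
      exact h0.2 n 0 rfl
    · rw [← powMul_succ, cv_comm]
      exact h1 _ _ rfl
    · rw [← powMul_succ, ← powMul_succ, cv_comm]
      exact h2.2 _ _ rfl
  · rw [powMul_succ]
    refine ZeroUpTo.cv_step (by fun_prop) (by fun_prop) (h0.2 i j (by omega)) ?_ ?_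
    · rw [← powMul_succ]
      exact h1 _ _ hij
    · rw [← powMul_succ, ← powMul_succ]
      exact h2.2 _ _ (by omega)

/-- A sequence that is concave and bounded below is monotone. -/
lemma monotone_of_concave {S : ℕ → ℝ} (h0 : ∀ n, 0 ≤ S n)
    (h : ∀ n, S n + S (n + 2) ≤ 2 * S (n + 1)) : Monotone S := by
  refine monotone_nat_of_le_succ fun n => ?_
  by_contra hlt
  push Not at hlt
  -- By concavity a drop d repeats at every later step, which would drive the sequence below 0.
  set d := S n - S (n + 1) with hd
  have hdpos : 0 < d := by linarith
  have hinc : ∀ m, d ≤ S (n + m) - S (n + m + 1) := by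
    intro m
    induction m with
    | zero => exact hd.le
    | succ m ih =>
      have := h (n + m)
      rw [← add_assoc]
      have e : n + m + 2 = n + m + 1 + 1 := rfl
      rw [e] at this
      linarith
  have hdec : ∀ m : ℕ, S (n + m) ≤ S n - m * d := by
    intro m
    induction m with
    | zero => simp
    | succ m ih =>
      have := hinc m
      rw [← add_assoc]
      push_cast
      linarith
  obtain ⟨m, hm⟩ := exists_nat_gt (S n / d)
  have := (div_lt_iff₀ hdpos).1 hm
  linarith [hdec m, h0 (n + m)]

/-- The suprema of the radii are nonnegative and concave in n, hence nondecreasing, and at n = 0 the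
supremum is at least T. The cap R ≤ T in `zeroRadii` keeps them finite; a supremum need not be
attained, whence t < T. -/
lemma cv_powMul_eq_zero {f g : ℝ → ℂ} (hf : Continuous f) (hg : Continuous g) {T : ℝ}
    (hfg : ZeroUpTo (cv f g) T) (n : ℕ) {t : ℝ} (ht : t ∈ Ico 0 T) :
    cv f (powMul n g) t = 0 := by
  have hT : 0 ≤ T := ht.1.trans ht.2.le
  have hne : ∀ n, (zeroRadii f g T n).Nonempty := fun n => ⟨0, zero_mem_zeroRadii f g hT n⟩
  have hmono : Monotone fun n => sSup (zeroRadii f g T n) := by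
    refine monotone_of_concave
      (fun n => le_csSup (bddAbove_zeroRadii f g T n) (zero_mem_zeroRadii f g hT n)) fun n => ?_
    rw [← csSup_add (hne n) (bddAbove_zeroRadii f g T n) (hne _) (bddAbove_zeroRadii f g T _)]
    refine csSup_le ((hne _).add (hne _)) ?_
    rintro _ ⟨R, hR, R'', hR'', rfl⟩
    have := le_csSup (bddAbove_zeroRadii f g T _) (zeroRadii_step hf hg hR hR'')
    linarith
  have hT0 : T ∈ zeroRadii f g T 0 := ⟨le_rfl, fun i j hij => by
    obtain ⟨rfl, rfl⟩ : i = 0 ∧ j = 0 := by omega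
    simpa [powMul_zero] using hfg⟩
  have h1 : t < sSup (zeroRadii f g T n) :=
    ht.2.trans_le ((le_csSup (bddAbove_zeroRadii f g T 0) hT0).trans (hmono (Nat.zero_le n)))
  obtain ⟨R, hR, htR⟩ := exists_lt_of_lt_csSup (hne n) h1
  have := hR.2 0 n (by omega) t ⟨ht.1, htR.le⟩
  simpa [powMul_zero] using this

/-- A continuous function all of whose moments vanish is zero. -/
lemma eq_zero_of_moments {h : ℝ → ℂ} (hh : Continuous h) {t : ℝ} (ht : 0 < t)
    (hm : ∀ n : ℕ, ∫ s in (0 : ℝ)..t, (s : ℂ) ^ n * h s = 0) : ∀ s ∈ Ioo 0 t, h s = 0 := by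
  have hpoly : ∀ p : Polynomial ℝ, ∫ s in (0 : ℝ)..t, p.eval s • h s = 0 := by
    intro p
    have : ∀ s : ℝ, p.eval s • h s
        = ∑ n ∈ Finset.range (p.natDegree + 1), (p.coeff n : ℂ) * ((s : ℂ) ^ n * h s) := by
      intro s
      rw [Polynomial.eval_eq_sum_range, Finset.sum_smul]
      refine Finset.sum_congr rfl fun n _ => ?_
      rw [Complex.real_smul]
      push_cast
      ring
    simp_rw [this]
    rw [intervalIntegral.integral_finsetSum
      fun n _ => Continuous.intervalIntegrable (by fun_prop) _ _]
    simp [intervalIntegral.integral_const_mul, hm]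
  obtain ⟨M, hM⟩ := (isCompact_Icc (a := (0 : ℝ)) (b := t)).exists_bound_of_continuousOn
    hh.continuousOn
  have hM0 : 0 ≤ M := (norm_nonneg _).trans (hM 0 ⟨le_rfl, ht.le⟩)
  have hg : ∀ g : ℝ → ℝ, Continuous g → ∫ s in (0 : ℝ)..t, g s • h s = 0 := by
    intro g hg
    refine norm_le_zero_iff.1 (le_of_forall_pos_le_add fun ε hε => ?_)
    rw [zero_add]
    -- The tolerance is chosen so that, multiplied by the bound M + 1 for h and the length t, it
    -- gives ε.
    obtain ⟨p, hp⟩ := exists_polynomial_near_of_continuousOn 0 t g hg.continuousOn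
      (ε / ((M + 1) * t)) (by positivity)
    have h1 : ∫ s in (0 : ℝ)..t, g s • h s = ∫ s in (0 : ℝ)..t, (g s - p.eval s) • h s := by
      simp_rw [sub_smul]
      rw [intervalIntegral.integral_sub (Continuous.intervalIntegrable (by fun_prop) _ _)
        (Continuous.intervalIntegrable (by fun_prop) _ _), hpoly p, sub_zero]
    rw [h1]
    refine (intervalIntegral.norm_integral_le_of_norm_le_const
      (C := ε / ((M + 1) * t) * (M + 1)) fun s hs => ?_).trans (le_of_eq ?_)
    · rw [uIoc_of_le ht.le] at hs
      have hs' : s ∈ Icc 0 t := ⟨hs.1.le, hs.2⟩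
      rw [norm_smul, Real.norm_eq_abs, abs_sub_comm]
      have h2 := (hp s hs').le
      have h3 := hM s hs'
      have h4 : ‖h s‖ ≤ M + 1 := by linarith
      gcongr
    · rw [sub_zero, abs_of_pos ht]
      field_simp
  have hae : ∀ᵐ s : ℝ, s ∈ Ioo 0 t → h s = 0 := by
    refine isOpen_Ioo.ae_eq_zero_of_integral_contDiff_smul_eq_zero
      (hh.locallyIntegrable.locallyIntegrableOn _) fun g hgc _ hgs => ?_
    rw [← hg g hgc.continuous, intervalIntegral.integral_of_le ht.le]
    refine (setIntegral_eq_integral_of_forall_compl_eq_zero fun s hs => ?_).symm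
    rw [image_eq_zero_of_notMem_tsupport (fun h => hs (Ioo_subset_Ioc_self (hgs h))), zero_smul]
  have := Measure.eqOn_open_of_ae_eq (μ := (volume : Measure ℝ)) (f := h) (g := fun _ => 0)
    (U := Ioo 0 t) ((ae_restrict_iff' measurableSet_Ioo).2 hae) isOpen_Ioo hh.continuousOn
    continuousOn_const
  exact this

/-- Titchmarsh's convolution theorem, for continuous functions. -/
theorem titchmarsh {f g : ℝ → ℂ} (hf : Continuous f) (hg : Continuous g) {T : ℝ}
    (hfg : ZeroUpTo (cv f g) T) {u s : ℝ} (hu : 0 < u) (hs : 0 < s) (hus : u + s < T) :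
    f u * g s = 0 := by
  -- The n-th moment of the integrand r ↦ f(u + s - r) g(r) is (f * tⁿ g)(u + s) = 0. The value of
  -- this integrand at r = s is f(u) g(s).
  have := eq_zero_of_moments (h := fun r => f (u + s - r) * g r) (by fun_prop) (t := u + s)
    (by linarith) (fun n => by
      have := cv_powMul_eq_zero hf hg hfg n (t := u + s) ⟨by linarith, hus⟩
      rw [← this]
      refine intervalIntegral.integral_congr fun r _ => ?_
      simp only [powMul, smul_eq_mul]
      ring) s ⟨hs, by linarith⟩
  simpa using this

end Titchmarsh

/-! ### Dual convolution with smooth functions that vanish far to the right. -/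

section DualConvolution

variable {Y : Type*} [NormedAddCommGroup Y] [NormedSpace ℂ Y]

/-- `k` is integrable on all intervals `[0, R]`. -/
def LInt (k : ℝ → ℂ) : Prop := ∀ R, 0 ≤ R → IntervalIntegrable k volume 0 R

lemma LInt.of_locallyIntegrableOn {k : ℝ → ℂ} (hk : LocallyIntegrableOn k (Ici 0)) : LInt k :=
  fun R hR => (intervalIntegrable_iff_integrableOn_Icc_of_le hR).2
    (hk.integrableOn_compact_subset Icc_subset_Ici_self isCompact_Icc)

/-- A smooth function on `ℝ` that vanishes on `[R, ∞)`. -/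
structure Tail (φ : ℝ → ℂ) (R : ℝ) : Prop where
  smooth : ContDiff ℝ ∞ φ
  zero : ∀ t, R ≤ t → φ t = 0

lemma Tail.continuous {φ : ℝ → ℂ} {R : ℝ} (h : Tail φ R) : Continuous φ := h.smooth.continuous

lemma Tail.mono {φ : ℝ → ℂ} {R R' : ℝ} (h : Tail φ R) (hR : R ≤ R') : Tail φ R' :=
  ⟨h.smooth, fun t ht => h.zero t (hR.trans ht)⟩

lemma contDiff_deriv {φ : ℝ → ℂ} (h : ContDiff ℝ ∞ φ) : ContDiff ℝ ∞ (deriv φ) :=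
  (contDiff_infty_iff_deriv.1 h).2

lemma hasDerivAt_of_smooth {φ : ℝ → ℂ} (h : ContDiff ℝ ∞ φ) (t : ℝ) :
    HasDerivAt φ (deriv φ t) t :=
  ((contDiff_infty_iff_deriv.1 h).1 t).hasDerivAt

lemma Tail.deriv_zero {φ : ℝ → ℂ} {R : ℝ} (h : Tail φ R) {t : ℝ} (ht : R ≤ t) :
    deriv φ t = 0 := by
  have hc : Continuous (deriv φ) := (contDiff_deriv h.smooth).continuous
  have h1 : ∀ s ∈ Ioi R, deriv φ s = 0 := fun s hs => by
    have : φ =ᶠ[𝓝 s] fun _ => 0 := by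
      filter_upwards [Ioi_mem_nhds hs] with r hr using h.zero r (le_of_lt hr)
    rw [this.deriv_eq, deriv_const]
  have : t ∈ closure (Ioi R) := by rw [closure_Ioi]; exact ht
  exact (isClosed_singleton.preimage hc).closure_subset_iff.2 (fun s hs => h1 s hs) this

lemma Tail.deriv {φ : ℝ → ℂ} {R : ℝ} (h : Tail φ R) : Tail (deriv φ) R :=
  ⟨contDiff_deriv h.smooth, fun _ ht => h.deriv_zero ht⟩

lemma Tail.comp_add {φ : ℝ → ℂ} {R : ℝ} (h : Tail φ R) (c : ℝ) :
    Tail (fun t => φ (c + t)) (R - c) :=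
  ⟨h.smooth.comp (contDiff_const.add contDiff_id), fun t ht => h.zero _ (by linarith)⟩

lemma Tail.const_mul {φ : ℝ → ℂ} {R : ℝ} (h : Tail φ R) (c : ℂ) : Tail (fun t => c * φ t) R :=
  ⟨contDiff_const.mul h.smooth, fun t ht => by simp [h.zero t ht]⟩

lemma Tail.add {φ ψ : ℝ → ℂ} {R : ℝ} (h : Tail φ R) (h' : Tail ψ R) :
    Tail (fun t => φ t + ψ t) R :=
  ⟨h.smooth.add h'.smooth, fun t ht => by simp [h.zero t ht, h'.zero t ht]⟩

lemma Tail.sub {φ ψ : ℝ → ℂ} {R : ℝ} (h : Tail φ R) (h' : Tail ψ R) :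
    Tail (fun t => φ t - ψ t) R :=
  ⟨h.smooth.sub h'.smooth, fun t ht => by simp [h.zero t ht, h'.zero t ht]⟩

/-- A smooth antiderivative that vanishes on `[R, ∞)`. -/
lemma Tail.exists_antideriv {φ : ℝ → ℂ} {R : ℝ} (h : Tail φ R) :
    ∃ Φ, Tail Φ R ∧ _root_.deriv Φ = φ := by
  have hd : ∀ t, HasDerivAt (fun t => ∫ s in R..t, φ s) (φ t) t := fun t =>
    intervalIntegral.integral_hasDerivAt_right (h.continuous.intervalIntegrable _ _)
      (h.continuous.stronglyMeasurableAtFilter _ _) h.continuous.continuousAt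
  have hd' : _root_.deriv (fun t => ∫ s in R..t, φ s) = φ := funext fun t => (hd t).deriv
  refine ⟨fun t => ∫ s in R..t, φ s, ⟨?_, fun t ht => ?_⟩, hd'⟩
  · rw [contDiff_infty_iff_deriv, hd']
    exact ⟨fun t => (hd t).differentiableAt, h.smooth⟩
  · refine (intervalIntegral.integral_congr (g := fun _ => (0 : ℂ)) fun s hs => ?_).trans (by simp)
    rw [uIcc_of_le ht] at hs
    exact h.zero s hs.1

/-- The dual convolution `t ↦ ∫₀^∞ k(u) φ(t + u) du`, on the whole real line. -/
noncomputable def dc (k φ : ℝ → ℂ) (t : ℝ) : ℂ := ∫ u in Ioi 0, k u * φ (t + u)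

lemma dc_eq {k φ : ℝ → ℂ} {R t M : ℝ} (h : ∀ s, R ≤ s → φ s = 0) (hM : 0 ≤ M) (hR : R - t ≤ M) :
    dc k φ t = ∫ u in (0 : ℝ)..M, k u * φ (t + u) := by
  rw [dc, intervalIntegral.integral_of_le hM]
  refine (setIntegral_eq_of_subset_of_forall_sdiff_eq_zero measurableSet_Ioi
    Ioc_subset_Ioi_self fun u hu => ?_)
  rw [h (t + u), mul_zero]
  have : M < u := by
    by_contra hc
    exact hu.2 ⟨hu.1, not_lt.1 hc⟩
  linarith

lemma dc_zero_of_le {k φ : ℝ → ℂ} {R t : ℝ} (h : ∀ s, R ≤ s → φ s = 0) (ht : R ≤ t) :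
    dc k φ t = 0 := by
  rw [dc_eq h le_rfl (by linarith)]
  simp

lemma LInt.intervalIntegrable_mul {k φ : ℝ → ℂ} (hk : LInt k) {M : ℝ} (hM : 0 ≤ M)
    (hφ : Continuous φ) : IntervalIntegrable (fun u => k u * φ u) volume 0 M :=
  (hk M hM).mul_continuousOn hφ.continuousOn

lemma dc_integrableOn {k φ : ℝ → ℂ} (hk : LInt k) {R : ℝ} (hφ : Tail φ R) (t : ℝ) :
    IntegrableOn (fun u => k u * φ (t + u)) (Ioi 0) := by
  have hc : Continuous fun u => φ (t + u) := hφ.continuous.comp (continuous_const.add continuous_id)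
  have h := (hk.intervalIntegrable_mul (le_max_left 0 (R - t)) hc)
  rw [intervalIntegrable_iff_integrableOn_Ioc_of_le (le_max_left 0 (R - t))] at h
  refine IntegrableOn.of_forall_sdiff_eq_zero h measurableSet_Ioi fun u hu => ?_
  rw [hφ.zero, mul_zero]
  have : max 0 (R - t) < u := by
    by_contra hc
    exact hu.2 ⟨hu.1, not_lt.1 hc⟩
  linarith [le_max_right 0 (R - t)]

/-- The shift s = t + u identifies the two forms on the half line. `dc` makes sense for negative t
as well, so its smoothness can be discussed on the whole line, without one-sided derivatives. -/
lemma dualConv_indicator (k φ : ℝ → ℂ) :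
    dualConv k ((Ici 0).indicator φ) = (Ici 0).indicator (dc k φ) := by
  funext t
  by_cases ht : t ∈ Ici (0 : ℝ)
  · rw [dualConv, indicator_of_mem ht, indicator_of_mem ht, dc]
    have := (measurePreserving_add_left volume t).setIntegral_preimage_emb
      (measurableEmbedding_addLeft t) (fun s => k (s - t) * φ s) (Ioi t)
    rw [preimage_const_add_Ioi, sub_self] at this
    simp only [add_sub_cancel_left] at this
    rw [this]
    refine setIntegral_congr_fun measurableSet_Ioi fun s hs => ?_
    rw [indicator_of_mem (show s ∈ Ici (0 : ℝ) from (mem_Ici.1 ht).trans (mem_Ioi.1 hs).le)]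
  · rw [dualConv, indicator_of_notMem ht, indicator_of_notMem ht]

lemma dc_hasDerivAt {k φ : ℝ → ℂ} (hk : LInt k) {R : ℝ} (hφ : Tail φ R) (t : ℝ) :
    HasDerivAt (dc k φ) (dc k (deriv φ) t) t := by
  -- One unit more than R - t, so that truncating at M is legitimate at all points within distance 1
  -- of t.
  set M := max 0 (R - t + 1) with hM
  have hM0 : 0 ≤ M := le_max_left _ _
  have hM1 : R - t + 1 ≤ M := le_max_right _ _
  have hcd : Continuous (deriv φ) := hφ.deriv.continuous
  have hc : Continuous φ := hφ.continuous
  obtain ⟨B, hB⟩ := (isCompact_Icc (a := t - 1) (b := t + 1 + M)).exists_bound_of_continuousOn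
    hcd.continuousOn
  have key := (intervalIntegral.hasDerivAt_integral_of_dominated_loc_of_deriv_le (𝕜 := ℝ)
    (F := fun s u => k u * φ (s + u)) (F' := fun s u => k u * deriv φ (s + u)) (a := 0) (b := M)
    (μ := volume)
    (bound := fun u => ‖k u‖ * B) (Metric.ball_mem_nhds t one_pos)
    (Filter.Eventually.of_forall fun s =>
      ((hk.intervalIntegrable_mul hM0 (φ := fun u => φ (s + u)) (by fun_prop)).def').1)
    (hk.intervalIntegrable_mul hM0 (φ := fun u => φ (t + u)) (by fun_prop))
    ((hk.intervalIntegrable_mul hM0 (φ := fun u => deriv φ (t + u)) (by fun_prop)).def').1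
    (Filter.Eventually.of_forall fun u hu s hs => by
      rw [uIoc_of_le hM0] at hu
      rw [norm_mul]
      have hs' := abs_lt.1 (by simpa [Real.dist_eq] using hs : |s - t| < 1)
      exact mul_le_mul_of_nonneg_left
        (hB _ ⟨by linarith [hu.1, hs'.1], by linarith [hu.2, hs'.2]⟩) (norm_nonneg _))
    ((hk M hM0).norm.mul_const B)
    (Filter.Eventually.of_forall fun u _ s _ => by
      have := (hasDerivAt_of_smooth hφ.smooth (s + u)).comp_add_const s u
      exact this.const_mul (k u))).2
  rw [dc_eq hφ.deriv.zero hM0 (by linarith)]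
  refine key.congr_of_eventuallyEq ?_
  filter_upwards [Ioi_mem_nhds (show t - 1 < t by linarith)] with s hs
  have : t - 1 < s := hs
  exact dc_eq hφ.zero hM0 (by linarith)

lemma deriv_dc {k φ : ℝ → ℂ} (hk : LInt k) {R : ℝ} (hφ : Tail φ R) :
    deriv (dc k φ) = dc k (deriv φ) :=
  funext fun t => (dc_hasDerivAt hk hφ t).deriv

lemma Tail.dc {k φ : ℝ → ℂ} (hk : LInt k) {R : ℝ} (hφ : Tail φ R) :
    Tail (ConvolutedCosine.dc k φ) R := by
  refine ⟨contDiff_infty.2 fun n => ?_, fun t ht => dc_zero_of_le hφ.zero ht⟩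
  induction n generalizing φ with
  | zero =>
    exact contDiff_zero.2 (continuous_iff_continuousAt.2 fun t =>
      (dc_hasDerivAt hk hφ t).continuousAt)
  | succ n ih =>
    rw [Nat.cast_succ, contDiff_succ_iff_deriv]
    refine ⟨fun t => (dc_hasDerivAt hk hφ t).differentiableAt, by simp, ?_⟩
    rw [deriv_dc hk hφ]
    exact ih hφ.deriv

lemma dc_comp_add (k φ : ℝ → ℂ) (c : ℝ) : dc k (fun t => φ (c + t)) = fun t => dc k φ (c + t) := by
  funext t
  simp [dc, add_assoc]

lemma integrableOn_rect_smul {a b : ℝ → ℂ} {M N : ℝ} (hM : 0 ≤ M) (hN : 0 ≤ N)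
    (ha : IntervalIntegrable a volume 0 M)
    (hb : IntervalIntegrable b volume 0 N) {G : ℝ × ℝ → Y}
    (hG : ContinuousOn G (Icc 0 M ×ˢ Icc 0 N)) :
    IntegrableOn (fun p : ℝ × ℝ => (a p.1 * b p.2) • G p) (Icc 0 M ×ˢ Icc 0 N) := by
  rw [intervalIntegrable_iff_integrableOn_Icc_of_le ‹_›] at ha hb
  have h : IntegrableOn (fun p : ℝ × ℝ => a p.1 * b p.2) (Icc 0 M ×ˢ Icc 0 N) := by
    rw [IntegrableOn, Measure.volume_eq_prod, ← Measure.prod_restrict]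
    exact ha.mul_prod hb
  exact h.smul_continuousOn hG (isCompact_Icc.prod isCompact_Icc)

lemma swap_rect_smul {a b : ℝ → ℂ} {M N : ℝ} (hM : 0 ≤ M) (hN : 0 ≤ N)
    (ha : IntervalIntegrable a volume 0 M)
    (hb : IntervalIntegrable b volume 0 N) {G : ℝ × ℝ → Y}
    (hG : ContinuousOn G (Icc 0 M ×ˢ Icc 0 N)) :
    ∫ u in (0 : ℝ)..M, ∫ v in (0 : ℝ)..N, (a u * b v) • G (u, v)
      = ∫ v in (0 : ℝ)..N, ∫ u in (0 : ℝ)..M, (a u * b v) • G (u, v) := by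
  refine intervalIntegral_intervalIntegral_swap ?_
  rw [uIoc_of_le hM, uIoc_of_le hN]
  exact (integrableOn_rect_smul hM hN ha hb hG).mono_set
    (prod_mono Ioc_subset_Icc_self Ioc_subset_Icc_self)

lemma dc_dc_eq {a b φ : ℝ → ℂ} {R M t : ℝ} (hφ : ∀ s, R ≤ s → φ s = 0) (hM : 0 ≤ M)
    (hR : R - t ≤ M) :
    dc a (dc b φ) t
      = ∫ u in (0 : ℝ)..M, ∫ v in (0 : ℝ)..M, (a u * b v) * φ (t + u + v) := by
  rw [dc_eq (R := R) (fun s hs => dc_zero_of_le hφ hs) hM hR]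
  refine intervalIntegral.integral_congr fun u hu => ?_
  rw [uIcc_of_le hM] at hu
  rw [dc_eq hφ hM (by linarith [hu.1]), ← intervalIntegral.integral_const_mul]
  simp [mul_assoc]

/-- Both sides are the integral of a(u) b(v) φ(t + u + v) over one and the same square. -/
lemma dc_comm {a b φ : ℝ → ℂ} (ha : LInt a) (hb : LInt b) {R : ℝ} (hφ : Tail φ R) :
    dc a (dc b φ) = dc b (dc a φ) := by
  funext t
  have hM : 0 ≤ max 0 (R - t) := le_max_left _ _
  have hM' : R - t ≤ max 0 (R - t) := le_max_right _ _
  rw [dc_dc_eq hφ.zero hM hM', dc_dc_eq hφ.zero hM hM']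
  have := swap_rect_smul hM hM (ha _ hM) (hb _ hM) (G := fun p : ℝ × ℝ => φ (t + p.1 + p.2))
    (hφ.continuous.comp (by fun_prop)).continuousOn
  simp only [smul_eq_mul] at this
  rw [this]
  refine intervalIntegral.integral_congr fun v _ => intervalIntegral.integral_congr fun u _ => ?_
  rw [mul_comm (a u), add_right_comm]

end DualConvolution

/-! ### Duality between convolution and dual convolution. -/

section FubiniConv

variable {Y : Type*} [NormedAddCommGroup Y] [NormedSpace ℂ Y]

lemma integrable_conv_integrand {κ : ℝ → ℂ} {F : ℝ → Y} {R : ℝ} (hR : 0 ≤ R)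
    (hκ : IntervalIntegrable κ volume 0 R) (hF : IntervalIntegrable F volume 0 R) :
    Integrable (fun p : ℝ × ℝ => (Ioc 0 R).indicator κ (p.1 - p.2) • (Ioc 0 R).indicator F p.2) := by
  rw [intervalIntegrable_iff_integrableOn_Ioc_of_le hR,
    ← integrable_indicator_iff measurableSet_Ioc] at hκ hF
  exact hF.convolution_integrand (ContinuousLinearMap.lsmul ℂ ℂ (E := Y)).flip hκ

lemma cv_eq_integral_indicator {κ : ℝ → ℂ} {F : ℝ → Y} {R t : ℝ} (ht : t ∈ Icc 0 R) :
    cv κ F t = ∫ s, (Ioc 0 R).indicator κ (t - s) • (Ioc 0 R).indicator F s := by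
  rw [cv, intervalIntegral.integral_of_le ht.1, integral_Ioc_eq_integral_Ioo,
    ← integral_indicator measurableSet_Ioo]
  congr 1
  funext s
  by_cases hs : s ∈ Ioo 0 t
  · rw [indicator_of_mem hs, indicator_of_mem (show t - s ∈ Ioc 0 R from
      ⟨by linarith [hs.2], by linarith [hs.1, ht.2]⟩), indicator_of_mem (show s ∈ Ioc 0 R from
      ⟨hs.1, by linarith [hs.2, ht.2]⟩)]
  · rw [indicator_of_notMem hs]
    by_cases h1 : 0 < s
    · rw [indicator_of_notMem (show t - s ∉ Ioc 0 R from fun h => hs ⟨h1, by linarith [h.1]⟩),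
        zero_smul]
    · rw [indicator_of_notMem (show s ∉ Ioc 0 R from fun h => h1 h.1), smul_zero]

lemma intervalIntegrable_cv {κ : ℝ → ℂ} {F : ℝ → Y} {R : ℝ} (hR : 0 ≤ R)
    (hκ : IntervalIntegrable κ volume 0 R) (hF : IntervalIntegrable F volume 0 R) :
    IntervalIntegrable (cv κ F) volume 0 R := by
  rw [intervalIntegrable_iff_integrableOn_Ioc_of_le hR]
  refine ((integrable_conv_integrand hR hκ hF).integral_prod_left.integrableOn
    (s := Ioc 0 R)).congr_fun (fun t ht => ?_) measurableSet_Ioc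
  exact (cv_eq_integral_indicator ⟨ht.1.le, ht.2⟩).symm

/-- `∫₀ᴿ G (κ * F) = ∫₀ᴿ (κ ∘ G) F`. -/
lemma integral_smul_cv [CompleteSpace Y] {κ G : ℝ → ℂ} {F : ℝ → Y} {R : ℝ} (hR : 0 ≤ R)
    (hκ : IntervalIntegrable κ volume 0 R) (hF : IntervalIntegrable F volume 0 R)
    (hG : ContinuousOn G (Icc 0 R)) :
    ∫ t in (0 : ℝ)..R, G t • cv κ F t
      = ∫ r in (0 : ℝ)..R, (∫ u in (0 : ℝ)..(R - r), κ u * G (r + u)) • F r := by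
  have hint : IntegrableOn (Function.uncurry fun t r => (G t * κ (t - r)) • F r) (triangle R) := by
    have h1 := ((integrable_conv_integrand hR hκ hF).integrableOn
      (s := Icc 0 R ×ˢ Icc 0 R)).continuousOn_smul (f := fun p : ℝ × ℝ => G p.1)
      (hG.comp continuousOn_fst fun p hp => hp.1) (isCompact_Icc.prod isCompact_Icc)
    -- The indicators suppress κ(0), so the two integrands agree only off the diagonal, which is a
    -- null set.
    have hnull : (volume : Measure (ℝ × ℝ)) {p | p.1 = p.2} = 0 := by
      have hm : MeasurableSet {p : ℝ × ℝ | p.1 = p.2} := measurableSet_eq_fun measurable_fst measurable_snd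
      rw [Measure.volume_eq_prod, Measure.measure_prod_null hm]
      refine Filter.Eventually.of_forall fun a => ?_
      have : Prod.mk a ⁻¹' {p : ℝ × ℝ | p.1 = p.2} = {a} := by
        ext b
        simp [eq_comm]
      simp [this]
    have h2 := h1.mono_set (triangle_subset R)
    refine h2.congr ?_
    rw [Filter.EventuallyEq, ae_restrict_iff' (measurableSet_triangle R)]
    have : ∀ᵐ p : ℝ × ℝ, p.1 ≠ p.2 := by
      rw [ae_iff]; simpa using hnull
    filter_upwards [this] with p hp hpt
    have h3 : p.1 - p.2 ∈ Ioc 0 R :=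
      ⟨sub_pos.2 (lt_of_le_of_ne hpt.2.1 hp.symm), by linarith [hpt.1, hpt.2.2]⟩
    have h4 : p.2 ∈ Ioc 0 R := ⟨hpt.1, hpt.2.1.trans hpt.2.2⟩
    simp only [Function.uncurry, indicator_of_mem h3, indicator_of_mem h4, mul_smul]
  have e1 : ∀ t, G t • cv κ F t = ∫ r in (0 : ℝ)..t, (G t * κ (t - r)) • F r := fun t => by
    simp_rw [mul_smul]
    rw [intervalIntegral.integral_smul, cv]
  simp_rw [e1]
  rw [integral_triangle_swap hR hint]
  refine intervalIntegral.integral_congr fun r _ => ?_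
  rw [intervalIntegral.integral_smul_const]
  congr 1
  have := intervalIntegral.integral_comp_sub_right (a := r) (b := R)
    (fun u => κ u * G (r + u)) r
  rw [sub_self] at this
  rw [← this]
  refine intervalIntegral.integral_congr fun t _ => ?_
  simp only [add_sub_cancel]
  rw [mul_comm]

lemma integral_smul_cv_eq_dc [CompleteSpace Y] {κ G : ℝ → ℂ} {F : ℝ → Y} {R : ℝ} (hR : 0 ≤ R)
    (hκ : IntervalIntegrable κ volume 0 R) (hF : IntervalIntegrable F volume 0 R)
    (hG : Continuous G) (hG0 : ∀ t, R ≤ t → G t = 0) :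
    ∫ t in (0 : ℝ)..R, G t • cv κ F t = ∫ r in (0 : ℝ)..R, dc κ G r • F r := by
  rw [integral_smul_cv hR hκ hF hG.continuousOn]
  refine intervalIntegral.integral_congr fun r hr => ?_
  rw [uIcc_of_le hR] at hr
  rw [dc_eq hG0 (sub_nonneg.2 hr.2) le_rfl]

lemma conv_eq_cv {f g : ℝ → ℂ} {t : ℝ} (ht : 0 ≤ t) : conv f g t = cv f g t := by
  rw [conv, indicator_of_mem (show t ∈ Ici (0 : ℝ) from ht), cv]
  rfl

lemma LInt.conv {f g : ℝ → ℂ} (hf : LInt f) (hg : LInt g) : LInt (ConvolutedCosine.conv f g) := by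
  intro R hR
  refine (intervalIntegrable_cv hR (hf R hR) (hg R hR)).congr fun t ht => ?_
  rw [uIoc_of_le hR] at ht
  exact (conv_eq_cv ht.1.le).symm

lemma LInt.convPow {k : ℝ → ℂ} (hk : LInt k) (n : ℕ) : LInt (convPow k n) := by
  match n with
  | 0 => exact fun R _ => intervalIntegrable_const
  | 1 => exact hk
  | n + 2 => exact hk.conv (hk.convPow (n + 1))

lemma dc_conv {f g φ : ℝ → ℂ} (hf : LInt f) (hg : LInt g) {R : ℝ} (hφ : Tail φ R) :
    dc (conv f g) φ = dc f (dc g φ) := by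
  -- Duality carries the left factor f of f * g onto φ first, so the order produced is g ∘ (f ∘ φ).
  rw [dc_comm hf hg hφ]
  funext t
  have hM : 0 ≤ max 0 (R - t) := le_max_left _ _
  have hM' : R - t ≤ max 0 (R - t) := le_max_right _ _
  rw [dc_eq hφ.zero hM hM', dc_eq (hφ.dc hf).zero hM hM']
  have := integral_smul_cv_eq_dc hM (hf _ hM) (hg _ hM) (G := fun u => φ (t + u))
    (hφ.comp_add t).continuous (fun s hs => hφ.zero _ (by linarith))
  rw [dc_comp_add] at this
  simp only [smul_eq_mul] at this
  simp_rw [mul_comm (g _)]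
  rw [← this]
  refine intervalIntegral.integral_congr fun u hu => ?_
  rw [uIcc_of_le hM] at hu
  rw [conv_eq_cv hu.1, mul_comm]

/-- `k^{*(m+n)} ∘ φ = k^{*m} ∘ (k^{*n} ∘ φ)`. -/
lemma dc_convPow_add {k φ : ℝ → ℂ} (hk : LInt k) {R : ℝ} (hφ : Tail φ R) (m n : ℕ) :
    dc (convPow k (m + 1 + (n + 1))) φ = dc (convPow k (m + 1)) (dc (convPow k (n + 1)) φ) := by
  induction m with
  | zero =>
    rw [show 0 + 1 + (n + 1) = n + 2 by ring]
    exact dc_conv hk (hk.convPow _) hφ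
  | succ m ih =>
    rw [show m + 1 + 1 + (n + 1) = (m + 1 + n) + 2 by ring]
    rw [show convPow k (m + 1 + n + 2) = conv k (convPow k (m + 1 + n + 1)) from rfl,
      dc_conv hk (hk.convPow _) hφ, show m + 1 + n + 1 = m + 1 + (n + 1) by ring, ih]
    rw [show convPow k (m + 1 + 1) = conv k (convPow k (m + 1)) from rfl,
      dc_conv hk (hk.convPow _) (hφ.dc (hk.convPow _))]

end FubiniConv

/-! ### Injectivity of the dual convolution, from Titchmarsh's theorem. -/

section Injectivity

lemma LInt.indicator_Ici {k : ℝ → ℂ} (hk : LInt k) (a b : ℝ) :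
    IntervalIntegrable ((Ici 0).indicator k) volume a b := by
  have h : ∀ R, IntervalIntegrable ((Ici 0).indicator k) volume 0 R := by
    intro R
    rcases le_total 0 R with hR | hR
    · refine (hk R hR).congr fun t ht => ?_
      rw [uIoc_of_le hR] at ht
      rw [indicator_of_mem (show t ∈ Ici (0 : ℝ) from ht.1.le)]
    · refine (intervalIntegrable_const (c := (0 : ℂ))).congr_ae ?_
      rw [uIoc_of_ge hR, ← restrict_Ioo_eq_restrict_Ioc]
      refine (ae_restrict_iff' measurableSet_Ioo).2 (Filter.Eventually.of_forall fun t ht => ?_)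
      rw [indicator_of_notMem (show t ∉ Ici (0 : ℝ) from not_le.2 ht.2)]
  exact (h a).symm.trans (h b)

/-- The primitive `K(t) = ∫₀ᵗ k`, extended by `0` to the negative half line. -/
noncomputable def primitive (k : ℝ → ℂ) (t : ℝ) : ℂ := ∫ s in (0 : ℝ)..t, (Ici 0).indicator k s

lemma primitive_eq {k : ℝ → ℂ} {t : ℝ} (ht : 0 ≤ t) : primitive k t = ∫ s in (0 : ℝ)..t, k s := by
  refine intervalIntegral.integral_congr fun s hs => ?_
  rw [uIcc_of_le ht] at hs
  exact indicator_of_mem (show s ∈ Ici (0 : ℝ) from hs.1) k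

lemma continuous_primitive {k : ℝ → ℂ} (hk : LInt k) : Continuous (primitive k) :=
  intervalIntegral.continuous_primitive hk.indicator_Ici 0

lemma primitive_zero (k : ℝ → ℂ) : primitive k 0 = 0 := by simp [primitive]

/-- Integration by parts for `∫ φ k`. -/
lemma integral_mul_eq_sub_primitive {k φ : ℝ → ℂ} (hk : LInt k) (hφ : ContDiff ℝ ∞ φ) {T : ℝ}
    (hT : 0 ≤ T) : ∫ t in (0 : ℝ)..T, φ t * k t
      = φ T * primitive k T - ∫ t in (0 : ℝ)..T, deriv φ t * primitive k t := by
  have hd : Continuous (deriv φ) := (contDiff_deriv hφ).continuous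
  have h := integral_smul_cv (κ := fun _ => 1) (G := deriv φ) (F := k) hT intervalIntegrable_const
    (hk T hT) hd.continuousOn
  have h1 : ∀ t ∈ uIcc 0 T, deriv φ t • cv (fun _ => 1) k t = deriv φ t * primitive k t := by
    intro t ht
    rw [uIcc_of_le hT] at ht
    rw [primitive_eq ht.1]
    simp [cv]
  rw [intervalIntegral.integral_congr h1] at h
  have h2 : ∀ r ∈ uIcc 0 T, (∫ u in (0 : ℝ)..(T - r), (fun _ => (1 : ℂ)) u * deriv φ (r + u)) • k r
      = φ T * k r - φ r * k r := by
    intro r _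
    have : ∫ u in (0 : ℝ)..(T - r), deriv φ (r + u) = φ T - φ r := by
      rw [intervalIntegral.integral_comp_add_left (fun u => deriv φ u) r]
      simp only [add_zero, add_sub_cancel]
      exact intervalIntegral.integral_eq_sub_of_hasDerivAt (fun t _ => hasDerivAt_of_smooth hφ t)
        (hd.intervalIntegrable _ _)
    simp only [one_mul, this, smul_eq_mul]
    ring
  rw [intervalIntegral.integral_congr h2, intervalIntegral.integral_sub
    ((hk T hT).const_mul _) ((hk T hT).continuousOn_mul hφ.continuous.continuousOn),
    intervalIntegral.integral_const_mul, ← primitive_eq (k := k) hT] at h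
  rw [h]
  ring

lemma ae_eq_zero_of_primitive_eq_zero {k : ℝ → ℂ} (hk : LInt k) {ε : ℝ} (hε : 0 < ε)
    (h : ∀ t ∈ Ioo 0 ε, primitive k t = 0) : ∀ᵐ t ∂(volume.restrict (Ioo 0 ε)), k t = 0 := by
  rw [ae_restrict_iff' measurableSet_Ioo]
  filter_upwards [(hk ε hε.le).ae_hasDerivAt_integral] with t ht htε
  have h1 := ht (by rw [uIcc_of_le hε.le]; exact Ioo_subset_Icc_self htε) 0
    (by rw [uIcc_of_le hε.le]; exact ⟨le_rfl, hε.le⟩)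
  have h2 : (fun x => ∫ s in (0 : ℝ)..x, k s) =ᶠ[𝓝 t] fun _ => 0 := by
    filter_upwards [Ioo_mem_nhds htε.1 htε.2] with s hs
    rw [← primitive_eq hs.1.le, h s hs]
  exact h1.unique ((hasDerivAt_const t (0 : ℂ)).congr_of_eventuallyEq h2)

/-- Injectivity of `φ ↦ k ∘ φ`, together with its support version. -/
theorem eq_zero_of_dc_eq_zero {k φ : ℝ → ℂ} (hk : LInt k) (hk0 : ZeroMemSupp k) {R c : ℝ}
    (hφ : Tail φ R) (h : ∀ t, c ≤ t → dc k φ t = 0) : ∀ t, c ≤ t → φ t = 0 := by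
  -- Reversal at R turns the dual convolution into an ordinary one: (k ∘ φ)(R - t) = (k * g)(t). As
  -- g(0) = 0, integration by parts gives K * g' with the continuous primitive K of k, which
  -- Titchmarsh's theorem for continuous functions covers.
  set g : ℝ → ℂ := fun s => φ (R - s) with hg
  have hgs : ContDiff ℝ ∞ g := hφ.smooth.comp (contDiff_const.sub contDiff_id)
  have hg' : Continuous (deriv g) := (contDiff_deriv hgs).continuous
  have hzero : ZeroUpTo (cv (primitive k) (deriv g)) (R - c) := by
    intro t ht
    have h1 := h (R - t) (by linarith [ht.2])
    rw [dc_eq hφ.zero ht.1 (by linarith)] at h1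
    have h2 := integral_mul_eq_sub_primitive hk (φ := fun u => g (t - u))
      (hgs.comp (contDiff_const.sub contDiff_id)) ht.1
    have h3 : ∀ u, deriv (fun u => g (t - u)) u = - deriv g (t - u) := fun u => by
      exact ((hasDerivAt_of_smooth hgs (t - u)).comp_const_sub t u).deriv
    have h4 : g 0 = 0 := hφ.zero _ (by linarith)
    simp only [h3, sub_self, h4, zero_mul, zero_sub, neg_mul, intervalIntegral.integral_neg,
      neg_neg] at h2
    rw [cv_eq_flip]
    simp only [smul_eq_mul]
    simp_rw [mul_comm (primitive k _)]
    rw [← h2, ← h1]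
    refine intervalIntegral.integral_congr fun u _ => ?_
    simp only [hg]
    rw [mul_comm, sub_sub_eq_add_sub, add_comm R u, add_sub_assoc, add_comm u]
  have hg0 : ∀ s ∈ Ioo 0 (R - c), deriv g s = 0 := by
    intro s hs
    -- If g'(s) ≠ 0, Titchmarsh makes the primitive vanish on (0, R - c - s), hence k vanishes
    -- almost everywhere there, against 0 ∈ supp k.
    by_contra hne
    refine hk0 (R - c - s) (by linarith [hs.2]) (ae_eq_zero_of_primitive_eq_zero hk
      (by linarith [hs.2]) fun u hu => ?_)
    exact (mul_eq_zero.1 (titchmarsh (continuous_primitive hk) hg' hzero hu.1 hs.1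
      (by linarith [hu.2]))).resolve_right hne
  intro t ht
  rcases le_or_gt R t with hRt | hRt
  · exact hφ.zero t hRt
  · have h5 : ∫ s in (0 : ℝ)..(R - t), deriv g s = g (R - t) - g 0 :=
      intervalIntegral.integral_eq_sub_of_hasDerivAt (fun t _ => hasDerivAt_of_smooth hgs t)
        (hg'.intervalIntegrable _ _)
    have h6 : ∫ s in (0 : ℝ)..(R - t), deriv g s = 0 := by
      rw [intervalIntegral.integral_of_le (by linarith), integral_Ioc_eq_integral_Ioo]
      refine setIntegral_eq_zero_of_forall_eq_zero fun s hs => hg0 s ⟨hs.1, by linarith [hs.2]⟩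
    rw [h6] at h5
    simp only [hg, sub_sub_cancel, sub_zero, hφ.zero R le_rfl] at h5
    exact h5.symm

/-- Factors k are peeled off one at a time through k^{*(n+1)} ∘ φ = k ∘ (k^{*n} ∘ φ). No support
statement about k^{*n} itself is needed. -/
theorem eq_zero_of_dc_convPow_eq_zero {k φ : ℝ → ℂ} (hk : LInt k) (hk0 : ZeroMemSupp k) {n : ℕ}
    (hn : 1 ≤ n) {R c : ℝ} (hφ : Tail φ R) (h : ∀ t, c ≤ t → dc (convPow k n) φ t = 0) :
    ∀ t, c ≤ t → φ t = 0 := by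
  induction n, hn using Nat.le_induction with
  | base => exact eq_zero_of_dc_eq_zero hk hk0 hφ h
  | succ n hn ih =>
    obtain ⟨m, rfl⟩ := Nat.exists_eq_add_of_le' hn
    refine ih (eq_zero_of_dc_eq_zero hk hk0 (hφ.dc (hk.convPow _)) fun t ht => ?_)
    rw [← dc_conv hk (hk.convPow _) hφ]
    exact h t ht

end Injectivity

/-! ### Test functions, the inverse map, and one-sided derivatives. -/

section TestFunctions

/-- A smooth cutoff that is 0 for t ≤ -1 and 1 for t ≥ 0 restores compact support without changing φ
on [0, ∞). -/
lemma Tail.exists_compactSupport {φ : ℝ → ℂ} {R : ℝ} (h : Tail φ R) :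
    ∃ ψ, Tail ψ R ∧ HasCompactSupport ψ ∧ ∀ t, 0 ≤ t → ψ t = φ t := by
  refine ⟨fun t => (Real.smoothTransition (t + 1) : ℂ) * φ t, ⟨?_, fun t ht => ?_⟩, ?_, fun t ht => ?_⟩
  · refine ContDiff.mul ?_ h.smooth
    exact Complex.ofRealCLM.contDiff.comp
      (Real.smoothTransition.contDiff.comp (contDiff_id.add contDiff_const))
  · simp [h.zero t ht]
  · refine HasCompactSupport.intro (isCompact_Icc (a := -1) (b := R)) fun t ht => ?_
    rcases lt_or_ge t (-1) with h1 | h1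
    · rw [Real.smoothTransition.zero_of_nonpos (by linarith)]
      simp
    · rw [h.zero t (by by_contra hc; exact ht ⟨h1, by linarith⟩), mul_zero]
  · beta_reduce
    rw [Real.smoothTransition.one_of_one_le (by linarith), Complex.ofReal_one, one_mul]

lemma Tail.of_hasCompactSupport {φ : ℝ → ℂ} (h : ContDiff ℝ ∞ φ) (hc : HasCompactSupport φ) :
    ∃ R, 0 ≤ R ∧ Tail φ R := by
  obtain ⟨R, hR⟩ := hc.isCompact.bddAbove
  refine ⟨max 0 (R + 1), le_max_left _ _, h, fun t ht => image_eq_zero_of_notMem_tsupport fun hm => ?_⟩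
  linarith [hR hm, le_max_right 0 (R + 1)]

lemma indicator_Ici_congr {φ ψ : ℝ → ℂ} (h : ∀ t, 0 ≤ t → φ t = ψ t) :
    (Ici (0 : ℝ)).indicator φ = (Ici 0).indicator ψ :=
  indicator_congr fun t ht => h t ht

lemma eq_of_indicator_Ici_eq {φ ψ : ℝ → ℂ}
    (h : (Ici (0 : ℝ)).indicator φ = (Ici 0).indicator ψ) {t : ℝ} (ht : 0 ≤ t) : φ t = ψ t := by
  have := congrFun h t
  rwa [indicator_of_mem (show t ∈ Ici (0 : ℝ) from ht),
    indicator_of_mem (show t ∈ Ici (0 : ℝ) from ht)] at this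

lemma Tail.indicator_mem_Dplus {φ : ℝ → ℂ} {R : ℝ} (h : Tail φ R) :
    (Ici (0 : ℝ)).indicator φ ∈ Dplus := by
  obtain ⟨ψ, h1, h2, h3⟩ := h.exists_compactSupport
  refine ⟨fun t ht => indicator_of_notMem (show t ∉ Ici (0 : ℝ) from not_le.2 ht) _,
    ψ, h1.smooth, h2, fun t ht => ?_⟩
  rw [indicator_of_mem (show t ∈ Ici (0 : ℝ) from ht), h3 t ht]

lemma exists_tail_of_mem_Dplus {f : ℝ → ℂ} (hf : f ∈ Dplus) :
    ∃ φ R, 0 ≤ R ∧ Tail φ R ∧ f = (Ici 0).indicator φ := by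
  obtain ⟨h0, φ, h1, h2, h3⟩ := hf
  obtain ⟨R, hR, hT⟩ := Tail.of_hasCompactSupport h1 h2
  refine ⟨φ, R, hR, hT, funext fun t => ?_⟩
  rcases lt_or_ge t 0 with ht | ht
  · rw [h0 t ht, indicator_of_notMem (show t ∉ Ici (0 : ℝ) from not_le.2 ht)]
  · rw [h3 t ht, indicator_of_mem (show t ∈ Ici (0 : ℝ) from ht)]

lemma Tail.indicator_mem_Dk {k φ : ℝ → ℂ} (hk : LInt k) {R : ℝ} (h : Tail φ R) :
    (Ici (0 : ℝ)).indicator (ConvolutedCosine.dc k φ) ∈ Dk k := by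
  refine ⟨(Ici 0).indicator φ, h.indicator_mem_Dplus, fun t ht => ?_, dualConv_indicator k φ⟩
  have h1 := dc_integrableOn hk h t
  have h2 := (measurePreserving_add_left volume t).integrableOn_comp_preimage
      (measurableEmbedding_addLeft t) (f := fun s => k (s - t) * φ s) (s := Ioi t)
  rw [preimage_const_add_Ioi, sub_self] at h2
  have h3 := h2.1 (by simpa [Function.comp_def] using h1)
  refine h3.congr_fun (fun s hs => ?_) measurableSet_Ioi
  beta_reduce
  rw [indicator_of_mem (show s ∈ Ici (0 : ℝ) from ht.trans (mem_Ioi.1 hs).le)]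

/-- `W` picks some preimage in 𝒟₊; injectivity forces it to agree with φ on [0, ∞). -/
lemma W_indicator {k φ : ℝ → ℂ} (hk : LInt k) (hk0 : ZeroMemSupp k) {n : ℕ}
    (hn : 1 ≤ n) {R : ℝ} (hφ : Tail φ R) :
    W (convPow k n) ((Ici 0).indicator (dc (convPow k n) φ)) = (Ici 0).indicator φ := by
  set f := (Ici (0 : ℝ)).indicator (dc (convPow k n) φ) with hf
  have hex : ∃ g ∈ (Dplus : Set (ℝ → ℂ)), dualConv (convPow k n) g = f :=
    ⟨(Ici 0).indicator φ, hφ.indicator_mem_Dplus, dualConv_indicator _ _⟩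
  have h1 : W (convPow k n) f ∈ Dplus := Function.invFunOn_mem hex
  have h2 : dualConv (convPow k n) (W (convPow k n) f) = f := Function.invFunOn_eq hex
  obtain ⟨ψ, R', -, hψ, hW⟩ := exists_tail_of_mem_Dplus h1
  rw [hW, dualConv_indicator, hf] at h2
  rw [hW]
  refine indicator_Ici_congr fun t ht => ?_
  have h3 := (hψ.mono (le_max_right R R')).sub (hφ.mono (le_max_left R R'))
  have h4 := eq_zero_of_dc_convPow_eq_zero hk hk0 hn (c := 0) h3 (fun s hs => ?_) t ht
  · exact sub_eq_zero.1 h4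
  · have h5 := eq_of_indicator_Ici_eq h2 hs
    have := integral_sub (dc_integrableOn (hk.convPow n) hψ s)
      (dc_integrableOn (hk.convPow n) hφ s)
    rw [dc]
    simp_rw [mul_sub]
    rw [this]
    exact sub_eq_zero.2 h5

lemma mem_Dinf_iff {k f : ℝ → ℂ} : f ∈ Dinf k ↔ ∀ n, 1 ≤ n → f ∈ Dk (convPow k n) := by
  simp [Dinf, Submodule.mem_iInf]

/-- An element of `𝒟_{k^{*∞}}` supported in `[0, a]` is `k^{*n} ∘ g` with `g` supported in
`[0, a]`. -/
lemma exists_tail_of_mem_Dinf {k f : ℝ → ℂ} (hk : LInt k) (hk0 : ZeroMemSupp k) (hf : f ∈ Dinf k)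
    {a : ℝ} (ha : 0 ≤ a) (hfa : ∀ t, a < t → f t = 0) {n : ℕ} (hn : 1 ≤ n) :
    ∃ g, Tail g a ∧ HasCompactSupport g ∧ f = (Ici 0).indicator (dc (convPow k n) g) ∧
      W (convPow k n) f = (Ici 0).indicator g := by
  obtain ⟨g, hg, -, hgf⟩ := mem_Dinf_iff.1 hf n hn
  obtain ⟨φ, R, -, hφ, rfl⟩ := exists_tail_of_mem_Dplus hg
  rw [dualConv_indicator] at hgf
  have hφa : Tail φ a := by
    refine ⟨hφ.smooth, ?_⟩
    -- The support version of injectivity, with c = a; the endpoint t = a itself is reached by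
    -- continuity.
    refine eq_zero_of_dc_convPow_eq_zero hk hk0 hn hφ fun t ht => ?_
    have hc : Continuous (dc (convPow k n) φ) := (hφ.dc (hk.convPow n)).continuous
    have h1 : ∀ s ∈ Ioi a, dc (convPow k n) φ s = 0 := fun s hs => by
      have := hfa s hs
      rwa [← hgf, indicator_of_mem (show s ∈ Ici (0 : ℝ) from ha.trans (mem_Ioi.1 hs).le)] at this
    have : t ∈ closure (Ioi a) := by rw [closure_Ioi]; exact ht
    exact (isClosed_singleton.preimage hc).closure_subset_iff.2 (fun s hs => h1 s hs) this
  obtain ⟨ψ, h1, h2, h3⟩ := hφa.exists_compactSupport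
  have e : (Ici (0 : ℝ)).indicator (dc (convPow k n) φ)
      = (Ici 0).indicator (dc (convPow k n) ψ) := by
    rw [← dualConv_indicator, ← dualConv_indicator, indicator_Ici_congr h3]
  refine ⟨ψ, h1, h2, by rw [← hgf, e], ?_⟩
  rw [← hgf, e, W_indicator hk hk0 hn h1]

lemma eq_zero_of_tsupport_subset {f : ℝ → ℂ} {a : ℝ} (h : tsupport f ⊆ Icc 0 a) {t : ℝ}
    (ht : a < t) : f t = 0 :=
  image_eq_zero_of_notMem_tsupport fun hm => ht.not_ge (h hm).2

lemma D1_indicator {φ : ℝ → ℂ} (h : ContDiff ℝ ∞ φ) :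
    D1 ((Ici 0).indicator φ) = (Ici 0).indicator (deriv φ) := by
  funext t
  rcases lt_or_ge t 0 with ht | ht
  · rw [indicator_of_notMem (show t ∉ Ici (0 : ℝ) from not_le.2 ht), D1]
    refine derivWithin_zero_of_notMem_closure ?_
    rw [closure_Ici]
    exact not_le.2 ht
  · rw [indicator_of_mem (show t ∈ Ici (0 : ℝ) from ht), D1]
    have h1 : HasDerivWithinAt ((Ici (0 : ℝ)).indicator φ) (deriv φ t) (Ici 0) t :=
      (hasDerivAt_of_smooth h t).hasDerivWithinAt.congr
        (fun s hs => indicator_of_mem hs _) (indicator_of_mem (show t ∈ Ici (0 : ℝ) from ht) _)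
    exact h1.derivWithin (uniqueDiffOn_Ici 0 t ht)

end TestFunctions

/-! ### Smoothness of convolutions, and the cosine convolution of smooth functions. -/

section SmoothConv

lemma cv_eq_primitive_of_nonneg {φ ψ : ℝ → ℂ} (hφ : ContDiff ℝ ∞ φ) (hψ : Continuous ψ) {t : ℝ}
    (ht : 0 ≤ t) : cv φ ψ t = ∫ s in (0 : ℝ)..t, (φ 0 * ψ s + cv (deriv φ) ψ s) := by
  have hd : Continuous (deriv φ) := (contDiff_deriv hφ).continuous
  have h := integral_smul_cv (κ := deriv φ) (G := fun _ => 1) (F := ψ) ht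
    (hd.intervalIntegrable _ _) (hψ.intervalIntegrable _ _) continuousOn_const
  rw [intervalIntegral.integral_add (Continuous.intervalIntegrable (by fun_prop) _ _)
    (Continuous.intervalIntegrable (by fun_prop) _ _)]
  simp only [one_smul, mul_one] at h
  rw [h, ← intervalIntegral.integral_add (Continuous.intervalIntegrable (by fun_prop) _ _)
    (Continuous.intervalIntegrable (by fun_prop) _ _)]
  refine intervalIntegral.integral_congr fun r _ => ?_
  have : ∫ u in (0 : ℝ)..(t - r), deriv φ u = φ (t - r) - φ 0 :=
      intervalIntegral.integral_eq_sub_of_hasDerivAt (fun t _ => hasDerivAt_of_smooth hφ t)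
        (hd.intervalIntegrable _ _)
  simp only [this, smul_eq_mul]
  ring

lemma cv_neg (φ ψ : ℝ → ℂ) (t : ℝ) :
    cv φ ψ (-t) = - cv (fun s => φ (-s)) (fun s => ψ (-s)) t := by
  have := intervalIntegral.integral_comp_neg (a := 0) (b := t) (fun s => φ (-t - s) • ψ s)
  rw [neg_zero] at this
  rw [cv, intervalIntegral.integral_symm, ← this, cv]
  congr 1
  refine intervalIntegral.integral_congr fun s _ => ?_
  congr 2
  ring

/-- Negative t are reached by reflection through `cv_neg`. This makes `cv φ ψ` differentiable on the
whole line, as `Tail` requires. -/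
lemma cv_eq_primitive {φ ψ : ℝ → ℂ} (hφ : ContDiff ℝ ∞ φ) (hψ : Continuous ψ) (t : ℝ) :
    cv φ ψ t = ∫ s in (0 : ℝ)..t, (φ 0 * ψ s + cv (deriv φ) ψ s) := by
  rcases le_total 0 t with ht | ht
  · exact cv_eq_primitive_of_nonneg hφ hψ ht
  · have h1 := cv_eq_primitive_of_nonneg (φ := fun s => φ (-s)) (ψ := fun s => ψ (-s))
      (hφ.comp contDiff_neg) (hψ.comp continuous_neg) (neg_nonneg.2 ht)
    have h2 := cv_neg φ ψ (-t)
    rw [neg_neg] at h2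
    rw [h2, h1]
    have h3 : deriv (fun s => φ (-s)) = fun s => - deriv φ (-s) := funext fun s => by
      rw [deriv_comp_neg]
    have := intervalIntegral.integral_comp_neg (a := 0) (b := -t)
      (fun s => φ 0 * ψ s + cv (deriv φ) ψ s)
    rw [neg_zero, neg_neg] at this
    rw [intervalIntegral.integral_symm t 0, ← this]
    congr 1
    refine intervalIntegral.integral_congr fun s _ => ?_
    simp only [neg_zero]
    rw [cv_neg, h3]
    congr 1
    simp [cv]

lemma cv_hasDerivAt {φ ψ : ℝ → ℂ} (hφ : ContDiff ℝ ∞ φ) (hψ : Continuous ψ) (t : ℝ) :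
    HasDerivAt (cv φ ψ) (φ 0 * ψ t + cv (deriv φ) ψ t) t := by
  have hd : Continuous (deriv φ) := (contDiff_deriv hφ).continuous
  rw [funext (cv_eq_primitive hφ hψ)]
  have hc : Continuous fun s => φ 0 * ψ s + cv (deriv φ) ψ s := by fun_prop
  exact intervalIntegral.integral_hasDerivAt_right (hc.intervalIntegrable _ _)
      (hc.stronglyMeasurableAtFilter _ _) hc.continuousAt

lemma deriv_cv {φ ψ : ℝ → ℂ} (hφ : ContDiff ℝ ∞ φ) (hψ : Continuous ψ) :
    deriv (cv φ ψ) = fun t => φ 0 * ψ t + cv (deriv φ) ψ t :=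
  funext fun t => (cv_hasDerivAt hφ hψ t).deriv

lemma contDiff_cv {φ ψ : ℝ → ℂ} (hφ : ContDiff ℝ ∞ φ) (hψ : ContDiff ℝ ∞ ψ) :
    ContDiff ℝ ∞ (cv φ ψ) := by
  refine contDiff_infty.2 fun n => ?_
  induction n generalizing φ with
  | zero => exact contDiff_zero.2 (continuous_cv hφ.continuous hψ.continuous)
  | succ n ih =>
    rw [Nat.cast_succ, contDiff_succ_iff_deriv]
    refine ⟨fun t => (cv_hasDerivAt hφ hψ.continuous t).differentiableAt, by simp, ?_⟩
    rw [deriv_cv hφ hψ.continuous]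
    exact (contDiff_const.mul (contDiff_infty.1 hψ n)).add (ih (contDiff_deriv hφ))

lemma Tail.cv {φ ψ : ℝ → ℂ} {a b : ℝ} (hφ : Tail φ a) (hψ : Tail ψ b) :
    Tail (ConvolutedCosine.cv φ ψ) (a + b) := by
  refine ⟨contDiff_cv hφ.smooth hψ.smooth, fun t ht => ?_⟩
  refine (intervalIntegral.integral_congr (g := fun _ => (0 : ℂ)) fun s hs => ?_).trans (by simp)
  rcases le_total b s with h | h
  · simp [hψ.zero s h]
  · simp [hφ.zero (t - s) (by linarith)]

lemma LInt.of_continuous {k : ℝ → ℂ} (hk : Continuous k) : LInt k :=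
  fun _ _ => hk.intervalIntegrable _ _

lemma Tail.lint {φ : ℝ → ℂ} {a : ℝ} (h : Tail φ a) : LInt φ := .of_continuous h.continuous

/-- The cosine convolution of smooth functions, on the real line. -/
noncomputable def cosC (φ ψ : ℝ → ℂ) (t : ℝ) : ℂ := (1 / 2) * (cv φ ψ t + dc φ ψ t + dc ψ φ t)

lemma dualConv_congr_left {k k' : ℝ → ℂ} (h : ∀ t, 0 ≤ t → k t = k' t) (g : ℝ → ℂ) :
    dualConv k g = dualConv k' g := by
  refine indicator_congr fun t ht => setIntegral_congr_fun measurableSet_Ioi fun s hs => ?_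
  rw [h _ (sub_nonneg.2 (le_of_lt hs))]

lemma indicator_Ici_of_nonneg (φ : ℝ → ℂ) {t : ℝ} (ht : 0 ≤ t) :
    (Ici (0 : ℝ)).indicator φ t = φ t := indicator_of_mem (show t ∈ Ici (0 : ℝ) from ht) φ

lemma cosConv_indicator (φ ψ : ℝ → ℂ) :
    cosConv ((Ici 0).indicator φ) ((Ici 0).indicator ψ) = (Ici 0).indicator (cosC φ ψ) := by
  have e1 : conv ((Ici 0).indicator φ) ((Ici 0).indicator ψ) = (Ici 0).indicator (cv φ ψ) := by
    refine indicator_congr fun t ht => ?_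
    exact cv_congr (κ := (Ici 0).indicator φ) (F := (Ici 0).indicator ψ) ht
      (fun s hs => indicator_Ici_of_nonneg φ hs.1) fun s hs => indicator_Ici_of_nonneg ψ hs.1
  rw [cosConv, e1, dualConv_congr_left (fun t => indicator_Ici_of_nonneg φ), dualConv_indicator,
    dualConv_congr_left (fun t => indicator_Ici_of_nonneg ψ), dualConv_indicator]
  funext t
  by_cases ht : t ∈ Ici (0 : ℝ)
  · simp [indicator_of_mem ht, cosC]
  · simp [indicator_of_notMem ht]

lemma Tail.cosC {φ ψ : ℝ → ℂ} {a b : ℝ} (hφ : Tail φ a) (hψ : Tail ψ b) (ha : 0 ≤ a)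
    (hb : 0 ≤ b) : Tail (ConvolutedCosine.cosC φ ψ) (a + b) :=
  (((hφ.cv hψ).add ((hψ.mono (by linarith)).dc hφ.lint)).add
    ((hφ.mono (by linarith)).dc hψ.lint)).const_mul (1 / 2)

/-- Integration by parts in `φ ∘ ψ'`. -/
lemma dc_deriv_right {φ ψ : ℝ → ℂ} (hφ : ContDiff ℝ ∞ φ) {b : ℝ} (hψ : Tail ψ b) (t : ℝ) :
    dc φ (deriv ψ) t = - φ 0 * ψ t - dc (deriv φ) ψ t := by
  have hM : 0 ≤ max 0 (b - t) := le_max_left _ _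
  have hM' : b - t ≤ max 0 (b - t) := le_max_right _ _
  rw [dc_eq hψ.deriv.zero hM hM', dc_eq hψ.zero hM hM']
  have := intervalIntegral.integral_mul_deriv_eq_deriv_mul (a := 0) (b := max 0 (b - t))
    (u := φ) (v := fun u => ψ (t + u)) (u' := deriv φ) (v' := fun u => deriv ψ (t + u))
    (fun u _ => hasDerivAt_of_smooth hφ u)
    (fun u _ => by
      simpa [add_comm] using (hasDerivAt_of_smooth hψ.smooth (u + t)).comp_add_const u t)
    ((contDiff_deriv hφ).continuous.intervalIntegrable _ _)
    ((hψ.deriv.continuous.comp (continuous_const.add continuous_id)).intervalIntegrable _ _)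
  rw [this, hψ.zero (t + max 0 (b - t)) (by linarith)]
  simp

lemma deriv_cosC {φ ψ : ℝ → ℂ} {a b : ℝ} (hφ : Tail φ a) (hψ : Tail ψ b) (t : ℝ) :
    HasDerivAt (cosC φ ψ)
      ((1 / 2) * (φ 0 * ψ t + cv (deriv φ) ψ t + dc φ (deriv ψ) t + dc ψ (deriv φ) t)) t :=
  (((cv_hasDerivAt hφ.smooth hψ.continuous t).add (dc_hasDerivAt hφ.lint hψ t)).add
    (dc_hasDerivAt hψ.lint hφ t)).const_mul (1 / 2)

/-- `(φ *_c ψ)'' = φ'' *_c ψ + φ'(0) ψ`. -/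
lemma deriv_deriv_cosC {φ ψ : ℝ → ℂ} {a b : ℝ} (hφ : Tail φ a) (hψ : Tail ψ b) (t : ℝ) :
    deriv (deriv (cosC φ ψ)) t = cosC (deriv (deriv φ)) ψ t + deriv φ 0 * ψ t := by
  rw [funext fun t => (deriv_cosC hφ hψ t).deriv]
  have h := (((((hasDerivAt_of_smooth hψ.smooth t).const_mul (φ 0)).add
    (cv_hasDerivAt hφ.deriv.smooth hψ.continuous t)).add
    (dc_hasDerivAt hφ.lint hψ.deriv t)).add (dc_hasDerivAt hψ.lint hφ.deriv t)).const_mul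
      (1 / 2 : ℂ)
  refine h.deriv.trans ?_
  rw [dc_deriv_right hφ.smooth hψ.deriv, dc_deriv_right hφ.deriv.smooth hψ, cosC]
  ring

/-- `(φ *_c ψ)'(0) = 0`. -/
lemma deriv_cosC_zero {φ ψ : ℝ → ℂ} {a b : ℝ} (hφ : Tail φ a) (hψ : Tail ψ b) :
    deriv (cosC φ ψ) 0 = 0 := by
  rw [(deriv_cosC hφ hψ 0).deriv, dc_deriv_right hφ.smooth hψ]
  have : dc (deriv φ) ψ 0 = dc ψ (deriv φ) 0 := by
    simp [dc, mul_comm]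
  rw [this]
  simp only [cv, intervalIntegral.integral_same]
  ring

end SmoothConv

/-! ### Continuity of integrals with an integrable kernel and a moving endpoint. -/

section ParametricPrimitive

variable {Y : Type*} [NormedAddCommGroup Y] [NormedSpace ℂ Y]

lemma continuous_parametric_primitive {κ : ℝ → ℂ} (hκ : ∀ a b, IntervalIntegrable κ volume a b)
    {F : ℝ → ℝ → Y} (hF : Continuous (Function.uncurry F)) :
    Continuous fun p : ℝ × ℝ => ∫ u in (0 : ℝ)..p.2, κ u • F p.1 u := by
  rw [continuous_iff_continuousAt]
  rintro ⟨c, t⟩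
  set a := min 0 t - 1
  set b := max 0 t + 1
  have ha0 : a < 0 := by have := min_le_left 0 t; linarith
  have hat : a < t := by have := min_le_right 0 t; linarith
  have hb0 : 0 < b := by have := le_max_left 0 t; linarith
  have hbt : t < b := by have := le_max_right 0 t; linarith
  have hab : a ≤ b := by linarith
  obtain ⟨B, hB⟩ := ((isCompact_Icc (a := c - 1) (b := c + 1)).prod
    (isCompact_Icc (a := a) (b := b))).exists_bound_of_continuousOn hF.continuousOn
  refine intervalIntegral.continuousAt_parametric_primitive_of_dominated
    (F := fun c u => κ u • F c u) (fun u => ‖κ u‖ * B) a b ?_ ?_ ((hκ a b).norm.mul_const B) ?_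
    ⟨ha0, hb0⟩ ⟨hat, hbt⟩ (by simp)
  · exact fun x => ((hκ a b).def'.1.smul
      (hF.comp (Continuous.prodMk_right x)).aestronglyMeasurable)
  · filter_upwards [Icc_mem_nhds (show c - 1 < c by linarith) (show c < c + 1 by linarith)] with x hx
    refine (ae_restrict_iff' measurableSet_uIoc).2 (Filter.Eventually.of_forall fun u hu => ?_)
    rw [uIoc_of_le hab] at hu
    rw [norm_smul]
    exact mul_le_mul_of_nonneg_left (hB (x, u) ⟨hx, hu.1.le, hu.2⟩) (norm_nonneg _)
  · refine Filter.Eventually.of_forall fun u => ?_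
    have : Continuous fun x => κ u • F x u := by
      have h1 : Continuous fun x => F x u := hF.comp (Continuous.prodMk_left u)
      exact h1.const_smul _
    exact this.continuousAt

end ParametricPrimitive

/-! ### Lifting the cosine convolution through K ∘ ·. -/

section CosineLift

lemma dc_add {K φ ψ : ℝ → ℂ} (hK : LInt K) {a b : ℝ} (hφ : Tail φ a) (hψ : Tail ψ b) (t : ℝ) :
    dc K (fun s => φ s + ψ s) t = dc K φ t + dc K ψ t := by
  have := integral_add (dc_integrableOn hK hφ t) (dc_integrableOn hK hψ t)
  simp only [dc, mul_add]
  exact this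

lemma dc_sub {K φ ψ : ℝ → ℂ} (hK : LInt K) {a b : ℝ} (hφ : Tail φ a) (hψ : Tail ψ b) (t : ℝ) :
    dc K (fun s => φ s - ψ s) t = dc K φ t - dc K ψ t := by
  have := integral_sub (dc_integrableOn hK hφ t) (dc_integrableOn hK hψ t)
  simp only [dc, mul_sub]
  exact this

lemma dc_const_mul (K φ : ℝ → ℂ) (c : ℂ) (t : ℝ) :
    dc K (fun s => c * φ s) t = c * dc K φ t := by
  simp only [dc, mul_left_comm _ c, integral_const_mul]

lemma dc_eq_of_left {g K : ℝ → ℂ} {a M : ℝ} (h : ∀ s, a ≤ s → g s = 0) (hM : 0 ≤ M) (haM : a ≤ M)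
    (q : ℝ) : dc g K q = ∫ v in (0 : ℝ)..M, g v * K (q + v) := by
  rw [dc, intervalIntegral.integral_of_le hM]
  refine (setIntegral_eq_of_subset_of_forall_sdiff_eq_zero measurableSet_Ioi
    Ioc_subset_Ioi_self fun u hu => ?_)
  rw [h u, zero_mul]
  by_contra hc
  exact hu.2 ⟨hu.1, by linarith⟩

/-- For q ≥ 0 the function equals the integral of K(u) g(u - q) over [q, q + a]. There the shift
falls on the smooth g and on the endpoints, so it is even continuous in q. -/
lemma LInt.dc_left {g K : ℝ → ℂ} (hK : LInt K) {a : ℝ} (hg : Tail g a) (ha : 0 ≤ a) :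
    LInt (dc g K) := by
  intro R hR
  have hc := continuous_parametric_primitive (hK.indicator_Ici) (F := fun c p => g (p - c))
    (hg.continuous.comp (by fun_prop : Continuous fun x : ℝ × ℝ => x.2 - x.1))
  have hc2 : Continuous fun q : ℝ => (∫ u in (0 : ℝ)..(q + a), (Ici 0).indicator K u • g (u - q))
      - ∫ u in (0 : ℝ)..q, (Ici 0).indicator K u • g (u - q) :=
    (hc.comp (by fun_prop : Continuous fun q : ℝ => (q, q + a))).sub
      (hc.comp (by fun_prop : Continuous fun q : ℝ => (q, q)))
  refine (hc2.intervalIntegrable 0 R).congr fun q hq => ?_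
  rw [uIoc_of_le hR] at hq
  have hi : ∀ x y, IntervalIntegrable (fun u => (Ici 0).indicator K u • g (u - q)) volume x y :=
    fun x y => (hK.indicator_Ici x y).mul_continuousOn
      (hg.continuous.comp (by fun_prop : Continuous fun u : ℝ => u - q)).continuousOn
  rw [intervalIntegral.integral_interval_sub_left (hi _ _) (hi _ _), dc_eq_of_left hg.zero ha le_rfl]
  have := intervalIntegral.integral_comp_add_left (a := 0) (b := a)
    (fun u => (Ici 0).indicator K u • g (u - q)) q
  rw [add_zero] at this
  rw [← this]
  refine intervalIntegral.integral_congr fun v hv => ?_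
  rw [uIcc_of_le ha] at hv
  rw [indicator_Ici_of_nonneg K (by linarith [hv.1, hq.1]), add_sub_cancel_left, smul_eq_mul,
    mul_comm]

/-- `(g ∘ K) ∘ h`, as an integral against `K`. -/
lemma dc_dc_left {g h K : ℝ → ℂ} (hK : LInt K) {a b : ℝ} (hg : Tail g a) (ha : 0 ≤ a)
    (hh : Tail h b) {r M : ℝ} (hM : 0 ≤ M) (hMr : a + b - r ≤ M) :
    dc (dc g K) h r = ∫ p in (0 : ℝ)..M, K p * cv g (fun q => h (r + q)) p := by
  have hhc : Continuous fun q => h (r + q) := (hh.comp_add r).continuous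
  have e1 : ∀ p, K p * cv g (fun q => h (r + q)) p
      = ∫ q in (0 : ℝ)..p, (K p * 1) • (g (p - q) * h (r + q)) := fun p => by
    simp only [mul_one, smul_eq_mul]
    rw [intervalIntegral.integral_const_mul]
    rfl
  simp_rw [e1]
  rw [integral_triangle_swap (H := fun p q => (K p * 1) • (g (p - q) * h (r + q))) hM
    ((integrableOn_rect_smul hM hM (hK M hM)
      (intervalIntegrable_const (c := (1 : ℂ))) (G := fun p : ℝ × ℝ => g (p.1 - p.2) * h (r + p.2))
      ((hg.continuous.comp (by fun_prop)).mul (hhc.comp (by fun_prop))).continuousOn).mono_set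
      (triangle_subset M)), dc_eq hh.zero hM (by linarith)]
  refine intervalIntegral.integral_congr fun q hq => ?_
  rw [uIcc_of_le hM] at hq
  rcases le_or_gt b (r + q) with hb | hb
  · simp [hh.zero _ hb]
  · simp only [mul_one, smul_eq_mul]
    simp_rw [← mul_assoc]
    rw [intervalIntegral.integral_mul_const, dc_eq_of_left hg.zero (M := M - q)
      (by linarith) (by linarith)]
    have := intervalIntegral.integral_comp_add_left (a := 0) (b := M - q)
      (fun p => K p * g (p - q)) q
    rw [add_zero, add_sub_cancel] at this
    rw [← this]
    simp only [add_sub_cancel_left, mul_comm (g _)]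

/-- `K ∘ (g * ψ) = (K ∘ g) * ψ + (g ∘ K) ∘ ψ`. -/
lemma dc_cv {g ψ K : ℝ → ℂ} (hK : LInt K) {a b : ℝ} (hg : Tail g a) (ha : 0 ≤ a)
    (hψ : Tail ψ b) (hb : 0 ≤ b) {t : ℝ} (ht : 0 ≤ t) :
    dc K (cv g ψ) t = cv (dc K g) ψ t + dc (dc g K) ψ t := by
  have hM : 0 ≤ a + b := by linarith
  have hgc := hg.continuous
  have hψc := hψ.continuous
  rw [dc_dc_left hK hg ha hψ hM (by linarith), dc_eq (hg.cv hψ).zero hM (by linarith)]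
  -- The convolution integral over [0, t + u] is cut at t. The part over [0, t] produces (K ∘ g) *
  -- ψ, the part over [t, t + u] produces (g ∘ K) ∘ ψ.
  have e1 : ∀ u, cv g ψ (t + u)
      = (∫ s in (0 : ℝ)..t, g (t + u - s) * ψ s) + cv g (fun q => ψ (t + q)) u := fun u => by
    have h1 := intervalIntegral.integral_comp_add_left (a := 0) (b := u)
      (fun s => g (t + u - s) * ψ s) t
    rw [add_zero] at h1
    have hi : ∀ x y, IntervalIntegrable (fun s => g (t + u - s) * ψ s) volume x y :=
      fun x y => Continuous.intervalIntegrable (by fun_prop) _ _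
    have h2 : cv g (fun q => ψ (t + q)) u = ∫ s in t..(t + u), g (t + u - s) * ψ s := by
      rw [← h1]
      refine intervalIntegral.integral_congr fun q _ => ?_
      simp only [smul_eq_mul]
      congr 2
      ring
    rw [h2, intervalIntegral.integral_add_adjacent_intervals (hi _ _) (hi _ _)]
    rfl
  simp_rw [e1, mul_add]
  have hc1 : Continuous fun u => ∫ s in (0 : ℝ)..t, g (t + u - s) * ψ s := by fun_prop
  have hc2 : Continuous (cv g fun q => ψ (t + q)) := by fun_prop
  rw [intervalIntegral.integral_add (hK.intervalIntegrable_mul hM hc1)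
    (hK.intervalIntegrable_mul hM hc2)]
  congr 1
  have h3 := swap_rect_smul hM ht (hK _ hM) (intervalIntegrable_const (c := (1 : ℂ)))
    (G := fun p : ℝ × ℝ => g (t + p.1 - p.2) * ψ p.2) (by fun_prop)
  simp only [mul_one, smul_eq_mul, intervalIntegral.integral_const_mul] at h3
  rw [h3]
  refine intervalIntegral.integral_congr fun s hs => ?_
  rw [uIcc_of_le ht] at hs
  simp only [smul_eq_mul]
  rw [dc_eq hg.zero hM (by linarith [hs.2]), ← intervalIntegral.integral_mul_const]
  refine intervalIntegral.integral_congr fun u _ => ?_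
  rw [mul_assoc, add_sub_right_comm]

/-- The function `w` with `K ∘ w = (K ∘ g) *_c (K ∘ h)`. -/
noncomputable def cosLift (K g h : ℝ → ℂ) (t : ℝ) : ℂ :=
  (1 / 2) * (cv g (dc K h) t - dc (dc g K) h t + dc (dc K g) h t + dc (dc K h) g t)

lemma Tail.cosLift {K g h : ℝ → ℂ} (hK : LInt K) {a b : ℝ} (hg : Tail g a) (hh : Tail h b)
    (ha : 0 ≤ a) (hb : 0 ≤ b) : Tail (ConvolutedCosine.cosLift K g h) (a + b) :=
  ((((hg.cv (hh.dc hK)).sub ((hh.mono (by linarith)).dc (hK.dc_left hg ha))).add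
    ((hh.mono (by linarith)).dc (hg.dc hK).lint)).add
    ((hg.mono (by linarith)).dc (hh.dc hK).lint)).const_mul (1 / 2)

/-- By `dc_cv` with ψ = K ∘ h, applying K to g * (K ∘ h) gives (K ∘ g) * (K ∘ h) plus (g ∘ K) ∘ (K ∘
h). Commutativity rewrites the extra term as K ∘ ((g ∘ K) ∘ h), which the negative term of `cosLift`
removes. -/
lemma dc_cosLift {K g h : ℝ → ℂ} (hK : LInt K) {a b : ℝ} (hg : Tail g a) (hh : Tail h b)
    (ha : 0 ≤ a) (hb : 0 ≤ b) {t : ℝ} (ht : 0 ≤ t) :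
    dc K (cosLift K g h) t = cosC (dc K g) (dc K h) t := by
  have t1 := hg.cv (hh.dc hK)
  have t2 := (hh.mono (show b ≤ a + b by linarith)).dc (hK.dc_left hg ha)
  have t3 := (hh.mono (show b ≤ a + b by linarith)).dc (hg.dc hK).lint
  have t4 := (hg.mono (show a ≤ a + b by linarith)).dc (hh.dc hK).lint
  unfold cosLift cosC
  rw [dc_const_mul, dc_add hK ((t1.sub t2).add t3) t4, dc_add hK (t1.sub t2) t3, dc_sub hK t1 t2,
    dc_cv hK hg ha (hh.dc hK) hb ht, dc_comm hK (hK.dc_left hg ha) hh,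
    dc_comm hK (hg.dc hK).lint hh, dc_comm hK (hh.dc hK).lint hg]
  ring

/-- The kernel `θ` with `w(r) = ∫ g(t) θ(t, r) dt`. -/
noncomputable def liftKernel (K h : ℝ → ℂ) (t r : ℝ) : ℂ :=
  (1 / 2) * (dc K h |r - t| - dc K h (r - t)
    + (∫ p in (0 : ℝ)..t, (Ici 0).indicator K p • h (r - t + p))
    + ∫ p in (0 : ℝ)..t, (Ici 0).indicator K p • h (r + t - p))

/-- Although K is only locally integrable, the parameters enter through the smooth h and the
integration limits alone, which gives joint continuity. -/
lemma continuous_liftKernel {K h : ℝ → ℂ} (hK : LInt K) {b : ℝ} (hh : Tail h b) :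
    Continuous fun p : ℝ × ℝ => liftKernel K h p.1 p.2 := by
  have hc := hh.continuous
  have hψ : Continuous (dc K h) := (hh.dc hK).continuous
  have h1 := (continuous_parametric_primitive (hK.indicator_Ici) (F := fun c p => h (c + p))
    (hc.comp (by fun_prop : Continuous fun x : ℝ × ℝ => x.1 + x.2))).comp
    (by fun_prop : Continuous fun p : ℝ × ℝ => (p.2 - p.1, p.1))
  have h2 := (continuous_parametric_primitive (hK.indicator_Ici) (F := fun c p => h (c - p))
    (hc.comp (by fun_prop : Continuous fun x : ℝ × ℝ => x.1 - x.2))).comp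
    (by fun_prop : Continuous fun p : ℝ × ℝ => (p.2 + p.1, p.1))
  have h3 : Continuous fun p : ℝ × ℝ => dc K h |p.2 - p.1| - dc K h (p.2 - p.1) := by fun_prop
  exact ((h3.add h1).add h2).const_mul (1 / 2)

/-- The convolution covers t ≤ r and the dual convolution t ≥ r; together they form one integral
against the even extension of ψ. -/
lemma cv_add_dc_eq {g ψ : ℝ → ℂ} {a : ℝ} (hg : Tail g a) (hψ : Continuous ψ) {r M : ℝ}
    (hr : 0 ≤ r) (hM : 0 ≤ M) (haM : a ≤ M) :
    cv g ψ r + dc ψ g r = ∫ t in (0 : ℝ)..M, g t * ψ |r - t| := by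
  have hgc := hg.continuous
  have hi : ∀ x y, IntervalIntegrable (fun t => g t * ψ |r - t|) volume x y :=
    fun x y => Continuous.intervalIntegrable (by fun_prop) _ _
  have h1 : cv g ψ r = ∫ t in (0 : ℝ)..r, g t * ψ |r - t| := by
    rw [cv_comm]
    refine intervalIntegral.integral_congr fun t ht => ?_
    rw [uIcc_of_le hr] at ht
    simp only [smul_eq_mul]
    rw [abs_of_nonneg (by linarith [ht.2]), mul_comm]
  have h2 : dc ψ g r = ∫ t in r..(r + M), g t * ψ |r - t| := by
    rw [dc_eq hg.zero hM (by linarith)]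
    have := intervalIntegral.integral_comp_add_left (a := 0) (b := M)
      (fun t => g t * ψ |r - t|) r
    rw [add_zero] at this
    rw [← this]
    refine intervalIntegral.integral_congr fun u hu => ?_
    rw [uIcc_of_le hM] at hu
    simp only [sub_add_cancel_left, abs_neg, abs_of_nonneg hu.1]
    rw [mul_comm]
  have h3 : ∫ t in M..(r + M), g t * ψ |r - t| = 0 := by
    refine (intervalIntegral.integral_congr (g := fun _ => (0 : ℂ)) fun t ht => ?_).trans (by simp)
    rw [uIcc_of_le (by linarith)] at ht
    simp [hg.zero t (by linarith [ht.1])]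
  rw [h1, h2, intervalIntegral.integral_add_adjacent_intervals (hi _ _) (hi _ _),
    ← intervalIntegral.integral_add_adjacent_intervals (hi 0 M) (hi M (r + M)), h3, add_zero]

/-- Exchanging the integrals leaves an inner integral over p ≥ t, which is (K ∘ h)(r - t) without
its part over [0, t]. -/
lemma dc_dc_left_eq {K g h : ℝ → ℂ} (hK : LInt K) {a b : ℝ} (hg : Tail g a) (hh : Tail h b)
    (ha : 0 ≤ a) {r M : ℝ} (hr : 0 ≤ r) (hM0 : 0 ≤ M) (hM : a + b ≤ M) :
    dc (dc g K) h r = ∫ t in (0 : ℝ)..M, g t * (dc K h (r - t)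
      - ∫ p in (0 : ℝ)..t, (Ici 0).indicator K p • h (r - t + p)) := by
  have hgc := hg.continuous
  have hhc := hh.continuous
  rw [dc_dc_left hK hg ha hh hM0 (by linarith)]
  have e1 : ∀ p, K p * cv g (fun q => h (r + q)) p
      = ∫ t in (0 : ℝ)..p, (K p * 1) • (h (r + (p - t)) * g t) := fun p => by
    simp only [mul_one, smul_eq_mul]
    rw [intervalIntegral.integral_const_mul, cv_comm]
    rfl
  simp_rw [e1]
  rw [integral_triangle_swap (H := fun p t => (K p * 1) • (h (r + (p - t)) * g t)) hM0
    ((integrableOn_rect_smul hM0 hM0 (hK M hM0)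
      (intervalIntegrable_const (c := (1 : ℂ))) (G := fun p : ℝ × ℝ => h (r + (p.1 - p.2)) * g p.2)
      (by fun_prop)).mono_set (triangle_subset M))]
  refine intervalIntegral.integral_congr fun t ht => ?_
  rw [uIcc_of_le hM0] at ht
  rcases le_or_gt a t with hat | hat
  · simp [hg.zero t hat]
  · have hi : ∀ x y, IntervalIntegrable (fun p => (Ici 0).indicator K p • h (r - t + p)) volume x y :=
      fun x y => (hK.indicator_Ici x y).mul_continuousOn
        (by fun_prop : Continuous fun p => h (r - t + p)).continuousOn
    have h1 : dc K h (r - t) = ∫ p in (0 : ℝ)..M, (Ici 0).indicator K p • h (r - t + p) := by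
      rw [dc_eq hh.zero hM0 (by linarith)]
      refine intervalIntegral.integral_congr fun p hp => ?_
      rw [uIcc_of_le hM0] at hp
      rw [indicator_Ici_of_nonneg K hp.1, smul_eq_mul]
    rw [h1, intervalIntegral.integral_interval_sub_left (hi _ _) (hi _ _),
      ← intervalIntegral.integral_const_mul]
    refine intervalIntegral.integral_congr fun p hp => ?_
    rw [uIcc_of_le ht.2] at hp
    simp only [smul_eq_mul, mul_one]
    rw [indicator_Ici_of_nonneg K (ht.1.trans hp.1), show r + (p - t) = r - t + p by ring]
    ring

lemma dc_dc_right_eq {K g h : ℝ → ℂ} (hK : LInt K) {a b : ℝ} (hg : Tail g a) (hh : Tail h b)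
    {r M : ℝ} (hr : 0 ≤ r) (hM0 : 0 ≤ M) (haM : a ≤ M) (hbM : b ≤ M) :
    dc (dc K g) h r = ∫ t in (0 : ℝ)..M, g t *
      ∫ p in (0 : ℝ)..t, (Ici 0).indicator K p • h (r + t - p) := by
  have hhc := hh.continuous
  have h1 := integral_smul_cv_eq_dc hM0 (hK M hM0) (F := fun q => h (r + q))
    (Continuous.intervalIntegrable (by fun_prop) _ _) hg.continuous
    (fun t ht => hg.zero t (haM.trans ht))
  rw [dc_eq hh.zero hM0 (by linarith)]
  simp only [smul_eq_mul] at h1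
  rw [← h1]
  refine intervalIntegral.integral_congr fun t ht => ?_
  rw [uIcc_of_le hM0] at ht
  rw [cv_eq_flip]
  congr 1
  refine intervalIntegral.integral_congr fun p hp => ?_
  rw [uIcc_of_le ht.1] at hp
  rw [indicator_Ici_of_nonneg K hp.1, add_sub_assoc]

/-- This shows w as an integral of g against a kernel that does not involve g. Hence ∫ w E x is ∫
g(t) times a continuous vector function of t, to which the uniqueness theorem can be applied. -/
lemma cosLift_eq_integral {K g h : ℝ → ℂ} (hK : LInt K) {a b : ℝ} (hg : Tail g a) (hh : Tail h b)
    (ha : 0 ≤ a) (hb : 0 ≤ b) {r M : ℝ} (hr : 0 ≤ r) (hM : a + b ≤ M) :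
    cosLift K g h r = ∫ t in (0 : ℝ)..M, g t * liftKernel K h t r := by
  have hM0 : 0 ≤ M := by linarith
  have hgc := hg.continuous
  have hc := hh.continuous
  have hψ : Continuous (dc K h) := (hh.dc hK).continuous
  have c1 := (continuous_parametric_primitive (hK.indicator_Ici) (F := fun c p => h (c + p))
    (hc.comp (by fun_prop : Continuous fun x : ℝ × ℝ => x.1 + x.2))).comp
    (by fun_prop : Continuous fun t : ℝ => (r - t, t))
  have c2 := (continuous_parametric_primitive (hK.indicator_Ici) (F := fun c p => h (c - p))
    (hc.comp (by fun_prop : Continuous fun x : ℝ × ℝ => x.1 - x.2))).comp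
    (by fun_prop : Continuous fun t : ℝ => (r + t, t))
  simp only [Function.comp_def] at c1 c2
  have h1 := cv_add_dc_eq hg hψ hr hM0 (by linarith)
  have h2 := dc_dc_left_eq hK hg hh ha hr hM0 hM
  have h3 := dc_dc_right_eq hK hg hh hr hM0 (show a ≤ M by linarith) (by linarith)
  have e : cosLift K g h r = (1 / 2) * ((cv g (dc K h) r + dc (dc K h) g r) - dc (dc g K) h r
      + dc (dc K g) h r) := by
    rw [cosLift]
    ring
  rw [e, h1, h2, h3, ← intervalIntegral.integral_sub
    (Continuous.intervalIntegrable (by fun_prop) _ _)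
    (Continuous.intervalIntegrable (by fun_prop) _ _), ← intervalIntegral.integral_add
    (Continuous.intervalIntegrable (by fun_prop) _ _)
    (Continuous.intervalIntegrable (by fun_prop) _ _), ← intervalIntegral.integral_const_mul]
  refine intervalIntegral.integral_congr fun t _ => ?_
  simp only [liftKernel]
  ring

end CosineLift

/-! ### Convoluted cosine families and the weak form of the Duhamel equation. -/

section Families

variable {X Z : Type*} [NormedAddCommGroup X] [NormedSpace ℂ X]
  [NormedAddCommGroup Z] [NormedSpace ℂ Z]

/-- A local convoluted cosine function on `[0, T]`. The generator enters through two bounded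
operators `a`, `b`: a pair `(u, v)` belongs to its graph if and only if `a u = b v`. -/
structure IsFamily (a b : X →L[ℂ] Z) (K : ℝ → ℂ) (T : ℝ) (E : ℝ → X →L[ℂ] X) : Prop where
  cont : ∀ x, ContinuousOn (fun t => E t x) (Icc 0 T)
  comm : ∀ t ∈ Icc 0 T, ∀ u v, a u = b v → a (E t u) = b (E t v)
  duhamel : ∀ t ∈ Icc 0 T, ∀ x, a (cv (fun u : ℝ => (u : ℂ)) (fun s => E s x) t)
    = b (E t x - primitive K t • x)

lemma intervalIntegrable_smul_left {κ : ℝ → ℂ} {V : ℝ → X} {c d : ℝ} (hcd : c ≤ d)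
    (hκ : IntervalIntegrable κ volume c d) (hV : ContinuousOn V (Icc c d)) :
    IntervalIntegrable (fun t => κ t • V t) volume c d :=
  hκ.smul_continuousOn (by rwa [uIcc_of_le hcd])

variable {a b : X →L[ℂ] Z} {K : ℝ → ℂ} {T : ℝ} {E : ℝ → X →L[ℂ] X}

lemma IsFamily.apply_zero (h : IsFamily a b K T E) (hT : 0 ≤ T) (hb : Function.Injective b)
    (x : X) : E 0 x = 0 := by
  have := h.duhamel 0 ⟨le_rfl, hT⟩ x
  rw [primitive_zero, zero_smul, sub_zero] at this
  simp only [cv, intervalIntegral.integral_same, map_zero] at this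
  exact hb (by rw [← this, map_zero])

lemma exists_norm_le_of_continuousOn [CompleteSpace X] {c d : ℝ}
    (hE : ∀ x, ContinuousOn (fun t => E t x) (Icc c d)) :
    ∃ M, 0 ≤ M ∧ ∀ t ∈ Icc c d, ‖E t‖ ≤ M := by
  obtain ⟨M, hM⟩ := banach_steinhaus (g := fun t : Icc c d => E t) fun x => by
    obtain ⟨B, hB⟩ := isCompact_Icc.exists_bound_of_continuousOn (hE x)
    exact ⟨B, fun t => hB t t.2⟩
  exact ⟨max M 0, le_max_right _ _, fun t ht => (hM ⟨t, ht⟩).trans (le_max_left _ _)⟩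

variable [CompleteSpace X]

/-- Integration by parts, twice. -/
lemma integral_deriv_deriv_smul {α : ℝ → ℂ} (hα : ContDiff ℝ ∞ α) {V : ℝ → X} {T : ℝ} (hT : 0 ≤ T)
    (hV : IntervalIntegrable V volume 0 T) :
    ∫ t in (0 : ℝ)..T, deriv (deriv α) t • cv (fun u : ℝ => (u : ℂ)) V t
      = deriv α T • cv (fun u : ℝ => (u : ℂ)) V T - α T • (∫ t in (0 : ℝ)..T, V t)
        + ∫ t in (0 : ℝ)..T, α t • V t := by
  have hα1 := contDiff_deriv hα
  have hc := hα.continuous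
  have hc1 := hα1.continuous
  have hc2 : Continuous (deriv (deriv α)) := (contDiff_deriv hα1).continuous
  rw [integral_smul_cv hT (Continuous.intervalIntegrable (by fun_prop) _ _) hV hc2.continuousOn]
  have e1 : ∀ r, ∫ u in (0 : ℝ)..(T - r), (u : ℂ) * deriv (deriv α) (r + u)
      = deriv α T * ((T - r : ℝ) : ℂ) - α T + α r := by
    intro r
    have := intervalIntegral.integral_mul_deriv_eq_deriv_mul (a := 0) (b := T - r)
      (u := fun u : ℝ => (u : ℂ)) (v := fun u => deriv α (r + u)) (u' := fun _ => 1)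
      (v' := fun u => deriv (deriv α) (r + u))
      (fun u _ => by simpa using (hasDerivAt_id u).ofReal_comp)
      (fun u _ => by
        simpa [add_comm] using (hasDerivAt_of_smooth hα1 (u + r)).comp_add_const u r)
      intervalIntegrable_const (Continuous.intervalIntegrable (by fun_prop) _ _)
    rw [this]
    simp only [one_mul, add_sub_cancel, Complex.ofReal_zero, zero_mul, sub_zero]
    rw [intervalIntegral.integral_comp_add_left (fun u => deriv α u) r, add_zero, add_sub_cancel,
      intervalIntegral.integral_eq_sub_of_hasDerivAt (fun t _ => hasDerivAt_of_smooth hα t)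
        (hc1.intervalIntegrable _ _)]
    ring
  simp_rw [e1, add_smul, sub_smul, mul_smul]
  have i1 : IntervalIntegrable (fun r : ℝ => ((T - r : ℝ) : ℂ) • V r) volume 0 T :=
    hV.continuousOn_smul (Continuous.continuousOn (by fun_prop))
  have i2 : IntervalIntegrable (fun r : ℝ => α r • V r) volume 0 T :=
    hV.continuousOn_smul hc.continuousOn
  have i3 : IntervalIntegrable (fun r : ℝ => deriv α T • ((T - r : ℝ) : ℂ) • V r) volume 0 T :=
    i1.smul _
  have i4 : IntervalIntegrable (fun r : ℝ => α T • V r) volume 0 T := hV.smul _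
  rw [intervalIntegral.integral_add (i3.sub i4) i2, intervalIntegral.integral_sub i3 i4,
    intervalIntegral.integral_smul, intervalIntegral.integral_smul]
  rfl

variable [CompleteSpace Z]

/-- The weak form of the Duhamel formula, for test functions vanishing at `T`. -/
lemma IsFamily.weak (h : IsFamily a b K T E) (hK : LInt K) (hT : 0 ≤ T) {α : ℝ → ℂ}
    (hα : ContDiff ℝ ∞ α) (hαT : α T = 0) (x : X) :
    a (∫ t in (0 : ℝ)..T, α t • E t x) = b (- deriv α T • E T x
      + (∫ t in (0 : ℝ)..T, deriv (deriv α) t • E t x)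
      + (∫ t in (0 : ℝ)..T, deriv α t * K t) • x) := by
  have hα1 := contDiff_deriv hα
  have hc2 : Continuous (deriv (deriv α)) := (contDiff_deriv hα1).continuous
  have hV : IntervalIntegrable (fun t => E t x) volume 0 T := (h.cont x).intervalIntegrable_of_Icc hT
  have hP := continuous_primitive hK
  have h1 := integral_deriv_deriv_smul hα hT hV
  rw [hαT, zero_smul, sub_zero] at h1
  have hcvi : IntervalIntegrable (fun t => deriv (deriv α) t •
      cv (fun u : ℝ => (u : ℂ)) (fun s => E s x) t) volume 0 T :=
    (intervalIntegrable_cv hT (Continuous.intervalIntegrable (by fun_prop) _ _)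
      hV).continuousOn_smul hc2.continuousOn
  have h2 : a (∫ t in (0 : ℝ)..T, deriv (deriv α) t • cv (fun u : ℝ => (u : ℂ)) (fun s => E s x) t)
      = b (∫ t in (0 : ℝ)..T, deriv (deriv α) t • (E t x - primitive K t • x)) := by
    have hi : IntervalIntegrable (fun t => deriv (deriv α) t • (E t x - primitive K t • x))
        volume 0 T :=
      (hV.sub (Continuous.intervalIntegrable (by fun_prop) _ _)).continuousOn_smul hc2.continuousOn
    rw [← ContinuousLinearMap.intervalIntegral_comp_comm a hcvi,
      ← ContinuousLinearMap.intervalIntegral_comp_comm b hi]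
    refine intervalIntegral.integral_congr fun t ht => ?_
    rw [uIcc_of_le hT] at ht
    simp only [map_smul]
    rw [h.duhamel t ht x]
  have h3 : ∫ t in (0 : ℝ)..T, deriv (deriv α) t • (E t x - primitive K t • x)
      = (∫ t in (0 : ℝ)..T, deriv (deriv α) t • E t x)
        - (∫ t in (0 : ℝ)..T, deriv (deriv α) t * primitive K t) • x := by
    simp_rw [smul_sub, smul_smul]
    rw [intervalIntegral.integral_sub (hV.continuousOn_smul hc2.continuousOn)
      (Continuous.intervalIntegrable (by fun_prop) _ _), intervalIntegral.integral_smul_const]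
  have h4 : ∫ t in (0 : ℝ)..T, α t • E t x
      = (∫ t in (0 : ℝ)..T, deriv (deriv α) t • cv (fun u : ℝ => (u : ℂ)) (fun s => E s x) t)
        - deriv α T • cv (fun u : ℝ => (u : ℂ)) (fun s => E s x) T := by
    rw [h1]
    abel
  -- The boundary term α'(T) (t * E)(T) x is handled by the Duhamel formula at T itself; the scalar
  -- terms combine to ∫ α' K by parts.
  rw [h4, map_sub, h2, map_smul, h.duhamel T ⟨hT, le_rfl⟩ x, ← map_smul, ← map_sub, h3,
    integral_mul_eq_sub_primitive hK hα1 hT]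
  congr 1
  module

/-- The weak form for test functions that vanish on `[T, ∞)`. -/
lemma IsFamily.weak_tail (h : IsFamily a b K T E) (hK : LInt K) (hT : 0 ≤ T) {φ : ℝ → ℂ}
    (hφ : Tail φ T) (x : X) :
    a (∫ t in (0 : ℝ)..T, φ t • E t x) = b ((∫ t in (0 : ℝ)..T, deriv (deriv φ) t • E t x)
      + dc K (deriv φ) 0 • x) := by
  rw [h.weak hK hT hφ.smooth (hφ.zero T le_rfl), hφ.deriv.zero T le_rfl,
    dc_eq hφ.deriv.zero hT (by linarith)]
  simp [mul_comm]

/-- The weak form implies the strong form. -/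
lemma duhamel_of_weak (hK : LInt K) (hT : 0 < T) {V : ℝ → X} {x : X}
    (hV : ContinuousOn V (Icc 0 T))
    (h : ∀ φ, Tail φ T → a (∫ t in (0 : ℝ)..T, φ t • V t)
      = b ((∫ t in (0 : ℝ)..T, deriv (deriv φ) t • V t) + dc K (deriv φ) 0 • x)) :
    ∀ t ∈ Icc 0 T, a (cv (fun u : ℝ => (u : ℂ)) V t) = b (V t - primitive K t • x) := by
  set Vc : ℝ → X := IccExtend hT.le ((Icc 0 T).domRestrict V) with hVc
  have hVcc : Continuous Vc := hV.domRestrict.Icc_extend'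
  have hVe : ∀ t ∈ Icc 0 T, Vc t = V t := fun t ht => by
    rw [hVc, IccExtend_of_mem hT.le _ ht]
    rfl
  have hP := continuous_primitive hK
  have hJ : Continuous (cv (fun u : ℝ => (u : ℂ)) Vc) := continuous_cv (by fun_prop) hVcc
  set Φ : ℝ → Z := fun t => a (cv (fun u : ℝ => (u : ℂ)) Vc t) - b (Vc t - primitive K t • x)
    with hΦ
  have hΦc : Continuous Φ := by fun_prop
  have hae : ∀ᵐ t : ℝ, t ∈ Ioo 0 T → Φ t = 0 := by
    refine isOpen_Ioo.ae_eq_zero_of_integral_contDiff_smul_eq_zero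
      (hΦc.locallyIntegrable.locallyIntegrableOn _) fun ρ hρ _ hρs => ?_
    have hρT : Tail (fun t => (ρ t : ℂ)) T := by
      refine ⟨Complex.ofRealCLM.contDiff.comp hρ, fun t ht => ?_⟩
      have h0 : ρ t = 0 := image_eq_zero_of_notMem_tsupport fun hm => ht.not_gt (hρs hm).2
      rw [h0, Complex.ofReal_zero]
    -- Two antiderivatives vanishing beyond T give φ with φ'' = ρ, so the weak form becomes ∫ ρ Φ =
    -- 0 for the defect Φ of the strong form. Such φ need not vanish near 0, which is why test
    -- functions are restricted only on the right.
    obtain ⟨φ₁, hφ₁, hd₁⟩ := hρT.exists_antideriv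
    obtain ⟨φ, hφ, hd⟩ := hφ₁.exists_antideriv
    have hdd : deriv (deriv φ) = fun t => (ρ t : ℂ) := by rw [hd, hd₁]
    have hρc : Continuous fun t => (ρ t : ℂ) := hρT.continuous
    have e1 : ∫ t, ρ t • Φ t = ∫ t in (0 : ℝ)..T, (ρ t : ℂ) • Φ t := by
      rw [intervalIntegral.integral_of_le hT.le]
      refine (setIntegral_eq_integral_of_forall_compl_eq_zero fun s hs => ?_).symm
      rw [image_eq_zero_of_notMem_tsupport (fun h => hs (Ioo_subset_Ioc_self (hρs h)))]
      simp
    have h1 := integral_deriv_deriv_smul hφ.smooth hT.le (hVcc.intervalIntegrable 0 T)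
    rw [hφ.zero T le_rfl, hφ.deriv.zero T le_rfl, zero_smul, zero_smul, sub_zero, zero_add, hdd]
      at h1
    have h2 := h φ hφ
    have e2 : ∀ ψ : ℝ → ℂ, ∫ t in (0 : ℝ)..T, ψ t • V t = ∫ t in (0 : ℝ)..T, ψ t • Vc t := fun ψ => by
      refine intervalIntegral.integral_congr fun t ht => ?_
      rw [uIcc_of_le hT.le] at ht
      simp only [hVe t ht]
    rw [e2, e2, ← h1, hdd, dc_eq hφ.deriv.zero hT.le (by linarith)] at h2
    simp_rw [zero_add, mul_comm (K _)] at h2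
    rw [integral_mul_eq_sub_primitive hK hφ.deriv.smooth hT.le, hφ.deriv.zero T le_rfl, hdd] at h2
    have e3 : ∀ t, (ρ t : ℂ) • Φ t = a ((ρ t : ℂ) • cv (fun u : ℝ => (u : ℂ)) Vc t)
        - b ((ρ t : ℂ) • Vc t - ((ρ t : ℂ) * primitive K t) • x) := fun t => by
      simp only [hΦ, map_sub, map_smul, smul_sub, smul_smul]
    rw [e1]
    simp_rw [e3]
    rw [intervalIntegral.integral_sub (Continuous.intervalIntegrable (by fun_prop) _ _)
      (Continuous.intervalIntegrable (by fun_prop) _ _),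
      ContinuousLinearMap.intervalIntegral_comp_comm a
        (Continuous.intervalIntegrable (by fun_prop) _ _),
      ContinuousLinearMap.intervalIntegral_comp_comm b
        (Continuous.intervalIntegrable (by fun_prop) _ _), h2, ← map_sub,
      intervalIntegral.integral_sub (Continuous.intervalIntegrable (by fun_prop) _ _)
      (Continuous.intervalIntegrable (by fun_prop) _ _), intervalIntegral.integral_smul_const]
    rw [← map_zero b]
    congr 1
    module
  have h0 : EqOn Φ (fun _ => 0) (Ioo 0 T) := Measure.eqOn_open_of_ae_eq
    ((ae_restrict_iff' measurableSet_Ioo).2 hae) isOpen_Ioo hΦc.continuousOn continuousOn_const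
  intro t ht
  have h3 : t ∈ closure (Ioo 0 T) := by rw [closure_Ioo hT.ne]; exact ht
  have h4 : Φ t = 0 :=
    (isClosed_singleton.preimage hΦc).closure_subset_iff.2 (fun s hs => h0 hs) h3
  have h5 : cv (fun u : ℝ => (u : ℂ)) Vc t = cv (fun u : ℝ => (u : ℂ)) V t :=
    cv_congr ht.1 (fun _ _ => rfl) fun s hs => hVe s ⟨hs.1, hs.2.trans ht.2⟩
  simp only [hΦ, h5, hVe t ht] at h4
  exact sub_eq_zero.1 h4

lemma exists_integral_operator {κ : ℝ → ℂ} {c d : ℝ} (hcd : c ≤ d)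
    (hκ : IntervalIntegrable κ volume c d) (hE : ∀ x, ContinuousOn (fun t => E t x) (Icc c d)) :
    ∃ L : X →L[ℂ] X, ∀ x, L x = ∫ t in c..d, κ t • E t x := by
  obtain ⟨M, hM0, hM⟩ := exists_norm_le_of_continuousOn hE
  have hi := fun x => intervalIntegrable_smul_left hcd hκ (hE x)
  refine ⟨LinearMap.mkContinuous
    { toFun := fun x => ∫ t in c..d, κ t • E t x
      map_add' := fun x y => by
        simp only [map_add, smul_add]
        exact intervalIntegral.integral_add (hi x) (hi y)
      map_smul' := fun r x => by
        simp only [map_smul, smul_comm _ r, RingHom.id_apply]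
        exact intervalIntegral.integral_smul _ _ }
    ((∫ t in c..d, ‖κ t‖) * M) fun x => ?_, fun x => rfl⟩
  simp only [LinearMap.coe_mk, AddHom.coe_mk]
  have h1 : ‖∫ t in c..d, κ t • E t x‖ ≤ ∫ t in c..d, ‖κ t‖ * (M * ‖x‖) := by
    refine intervalIntegral.norm_integral_le_of_norm_le hcd ?_ (hκ.norm.mul_const _)
    refine Filter.Eventually.of_forall fun t ht => ?_
    rw [norm_smul]
    refine mul_le_mul_of_nonneg_left ?_ (norm_nonneg _)
    exact ((E t).le_opNorm x).trans (mul_le_mul_of_nonneg_right (hM t ⟨ht.1.le, ht.2⟩)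
      (norm_nonneg _))
  rwa [intervalIntegral.integral_mul_const, ← mul_assoc] at h1

/-- The graph relation passes through integrals. -/
lemma map_integral_eq_of_comm {κ : ℝ → ℂ} {c d : ℝ} (hcd : c ≤ d)
    (hκ : IntervalIntegrable κ volume c d) (hE : ∀ x, ContinuousOn (fun t => E t x) (Icc c d))
    {u v : X} (h : ∀ t ∈ Icc c d, a (E t u) = b (E t v)) :
    a (∫ t in c..d, κ t • E t u) = b (∫ t in c..d, κ t • E t v) := by
  rw [← ContinuousLinearMap.intervalIntegral_comp_comm a
      (intervalIntegrable_smul_left hcd hκ (hE u)),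
    ← ContinuousLinearMap.intervalIntegral_comp_comm b
      (intervalIntegrable_smul_left hcd hκ (hE v))]
  refine intervalIntegral.integral_congr fun t ht => ?_
  rw [uIcc_of_le hcd] at ht
  simp only [map_smul, h t ht]

end Families

/-! ### The extension formula: continuity and rewriting as convolutions. -/

section Extension

lemma LInt.comp_sub {k : ℝ → ℂ} (hk : LInt k) {c x y : ℝ} (hxy : x ≤ y) (hy : y ≤ c) :
    IntervalIntegrable (fun r => k (c - r)) volume x y := by
  have h := (hk.indicator_Ici (c - x) (c - y)).comp_sub_left c
  simp only [sub_sub_cancel] at h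
  refine h.congr fun r hr => ?_
  rw [uIoc_of_le hxy] at hr
  exact indicator_Ici_of_nonneg k (by linarith [hr.2])

lemma LInt.comp_add {k : ℝ → ℂ} (hk : LInt k) {c x y : ℝ} (hxy : x ≤ y) (hx : 0 ≤ x + c) :
    IntervalIntegrable (fun r => k (r + c)) volume x y := by
  have h := (hk.indicator_Ici (x + c) (y + c)).comp_add_right c
  simp only [add_sub_cancel_right] at h
  refine h.congr fun r hr => ?_
  rw [uIoc_of_le hxy] at hr
  exact indicator_Ici_of_nonneg k (by linarith [hr.1])

/-- A continuous extension to the real line. -/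
lemma exists_continuous_extension {X : Type*} [NormedAddCommGroup X] {V : ℝ → X} {T : ℝ} (hT : 0 ≤ T)
    (hV : ContinuousOn V (Icc 0 T)) : ∃ Vc : ℝ → X, Continuous Vc ∧ ∀ t ∈ Icc 0 T, Vc t = V t := by
  refine ⟨IccExtend hT ((Icc 0 T).domRestrict V), hV.domRestrict.Icc_extend', fun t ht => ?_⟩
  rw [IccExtend_of_mem hT _ ht]
  rfl

variable {X Z : Type*} [NormedAddCommGroup X] [NormedSpace ℂ X]
  [NormedAddCommGroup Z] [NormedSpace ℂ Z]

/-- The extension formula on `[T, T + τ]`, at the point `T + s`. -/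
noncomputable def extFormula (k K : ℝ → ℂ) (T : ℝ) (V U : ℝ → X) (P : ℝ → X) (s : ℝ) : X :=
  (2 : ℂ) • P s + (∫ r in (0 : ℝ)..T, k (T + s - r) • V r)
    + (∫ r in (0 : ℝ)..s, K (T + s - r) • U r)
    - (∫ r in (T - s)..T, k (r + (s - T)) • V r)
    - ∫ r in (0 : ℝ)..s, K (r + (T - s)) • U r

lemma integral_indicator_smul_congr {K : ℝ → ℂ} {x y : ℝ} (hx : 0 ≤ x) (hxy : x ≤ y) (F : ℝ → X) :
    ∫ u in x..y, (Ici 0).indicator K u • F u = ∫ u in x..y, K u • F u := by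
  refine intervalIntegral.integral_congr fun u hu => ?_
  rw [uIcc_of_le hxy] at hu
  simp only [indicator_Ici_of_nonneg K (hx.trans hu.1)]

lemma continuous_parametric_integral {κ : ℝ → ℂ} (hκ : LInt κ) {V : ℝ → X} (hV : Continuous V)
    (ε : ℝ) {c x y : ℝ → ℝ} (hc : Continuous c) (hx : Continuous x) (hy : Continuous y) :
    Continuous fun s => ∫ u in (x s)..(y s), (Ici 0).indicator κ u • V (c s + ε * u) := by
  have h := continuous_parametric_primitive hκ.indicator_Ici (F := fun c u => V (c + ε * u))
    (hV.comp (by fun_prop : Continuous fun p : ℝ × ℝ => p.1 + ε * p.2))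
  have h1 : ∀ s, ∫ u in (x s)..(y s), (Ici 0).indicator κ u • V (c s + ε * u)
      = (∫ u in (0 : ℝ)..(y s), (Ici 0).indicator κ u • V (c s + ε * u))
        - ∫ u in (0 : ℝ)..(x s), (Ici 0).indicator κ u • V (c s + ε * u) := fun s => by
    have hi : ∀ a b, IntervalIntegrable (fun u => (Ici 0).indicator κ u • V (c s + ε * u))
        volume a b := fun a b => (hκ.indicator_Ici a b).smul_continuousOn
      (hV.comp (by fun_prop : Continuous fun u : ℝ => c s + ε * u)).continuousOn
    rw [intervalIntegral.integral_interval_sub_left (hi _ _) (hi _ _)]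
  simp_rw [h1]
  exact (h.comp (hc.prodMk hy)).sub (h.comp (hc.prodMk hx))

lemma continuousOn_cv {k : ℝ → ℂ} (hk : LInt k) {V : ℝ → X} {T : ℝ} (hT : 0 ≤ T)
    (hV : ContinuousOn V (Icc 0 T)) : ContinuousOn (cv k V) (Icc 0 T) := by
  obtain ⟨Vc, hVc, hVe⟩ := exists_continuous_extension hT hV
  refine (continuous_parametric_integral hk hVc (-1) continuous_id continuous_const
    continuous_id (x := fun _ => 0)).continuousOn.congr fun t ht => ?_
  simp only [id]
  rw [integral_indicator_smul_congr le_rfl ht.1, cv_eq_flip]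
  refine intervalIntegral.integral_congr fun u hu => ?_
  rw [uIcc_of_le ht.1] at hu
  simp only [neg_mul, one_mul, ← sub_eq_add_neg]
  rw [hVe _ ⟨by linarith [hu.2], by linarith [hu.1, ht.2]⟩]

/-- In each integral a substitution frees the integrable kernel of the parameter s, which then
appears only in V or U and in the limits. The condition τ ≤ T keeps the arguments of the kernels
nonnegative. -/
lemma continuousOn_extFormula {k K : ℝ → ℂ} (hk : LInt k) (hK : LInt K) {T τ : ℝ} (hτ : 0 ≤ τ)
    (hτT : τ ≤ T) {V U P : ℝ → X} (hV : ContinuousOn V (Icc 0 T)) (hU : ContinuousOn U (Icc 0 τ))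
    (hP : ContinuousOn P (Icc 0 τ)) : ContinuousOn (extFormula k K T V U P) (Icc 0 τ) := by
  have hT : 0 ≤ T := hτ.trans hτT
  obtain ⟨Vc, hVc, hVe⟩ := exists_continuous_extension hT hV
  obtain ⟨Uc, hUc, hUe⟩ := exists_continuous_extension hτ hU
  have c1 := continuous_parametric_integral hk hVc (-1) (c := fun s => T + s)
    (x := fun s => s) (y := fun s => T + s) (by fun_prop) (by fun_prop) (by fun_prop)
  have c2 := continuous_parametric_integral hK hUc (-1) (c := fun s => T + s)
    (x := fun _ => T) (y := fun s => T + s) (by fun_prop) (by fun_prop) (by fun_prop)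
  have c3 := continuous_parametric_integral hk hVc 1 (c := fun s => T - s)
    (x := fun _ => 0) (y := fun s => s) (by fun_prop) (by fun_prop) (by fun_prop)
  have c4 := continuous_parametric_integral hK hUc 1 (c := fun s => s - T)
    (x := fun s => T - s) (y := fun _ => T) (by fun_prop) (by fun_prop) (by fun_prop)
  refine ((((hP.const_smul (2 : ℂ)).add c1.continuousOn).add c2.continuousOn).sub
    c3.continuousOn |>.sub c4.continuousOn).congr fun s hs => ?_
  have hsT : s ≤ T := hs.2.trans hτT
  simp only [extFormula, Pi.add_apply, Pi.sub_apply, Pi.smul_apply]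
  rw [integral_indicator_smul_congr hs.1 (by linarith), integral_indicator_smul_congr hT
    (by linarith [hs.1]), integral_indicator_smul_congr le_rfl hs.1,
    integral_indicator_smul_congr (by linarith) (by linarith [hs.1])]
  have e1 : ∫ r in (0 : ℝ)..T, k (T + s - r) • V r
      = ∫ u in s..(T + s), k u • Vc (T + s + -1 * u) := by
    have := intervalIntegral.integral_comp_sub_left (a := 0) (b := T)
      (fun u => k u • Vc (T + s + -1 * u)) (T + s)
    rw [sub_zero, add_sub_cancel_left] at this
    rw [← this]
    refine intervalIntegral.integral_congr fun r hr => ?_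
    rw [uIcc_of_le hT] at hr
    rw [show T + s + -1 * (T + s - r) = r by ring, hVe r hr]
  have e2 : ∫ r in (0 : ℝ)..s, K (T + s - r) • U r
      = ∫ u in T..(T + s), K u • Uc (T + s + -1 * u) := by
    have := intervalIntegral.integral_comp_sub_left (a := 0) (b := s)
      (fun u => K u • Uc (T + s + -1 * u)) (T + s)
    rw [sub_zero, add_sub_cancel_right] at this
    rw [← this]
    refine intervalIntegral.integral_congr fun r hr => ?_
    rw [uIcc_of_le hs.1] at hr
    rw [show T + s + -1 * (T + s - r) = r by ring, hUe r ⟨hr.1, hr.2.trans hs.2⟩]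
  have e3 : ∫ r in (T - s)..T, k (r + (s - T)) • V r
      = ∫ u in (0 : ℝ)..s, k u • Vc (T - s + 1 * u) := by
    have := intervalIntegral.integral_comp_add_right (a := T - s) (b := T)
      (fun u => k u • Vc (T - s + 1 * u)) (s - T)
    rw [show T - s + (s - T) = 0 by ring, show T + (s - T) = s by ring] at this
    rw [← this]
    refine intervalIntegral.integral_congr fun r hr => ?_
    rw [uIcc_of_le (by linarith [hs.1])] at hr
    rw [show T - s + 1 * (r + (s - T)) = r by ring, hVe r ⟨by linarith [hr.1], hr.2⟩]
  have e4 : ∫ r in (0 : ℝ)..s, K (r + (T - s)) • U r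
      = ∫ u in (T - s)..T, K u • Uc (s - T + 1 * u) := by
    have := intervalIntegral.integral_comp_add_right (a := 0) (b := s)
      (fun u => K u • Uc (s - T + 1 * u)) (T - s)
    rw [zero_add, add_sub_cancel] at this
    rw [← this]
    refine intervalIntegral.integral_congr fun r hr => ?_
    rw [uIcc_of_le hs.1] at hr
    rw [show s - T + 1 * (r + (T - s)) = r by ring, hUe r ⟨hr.1, hr.2.trans hs.2⟩]
  rw [e1, e2, e3, e4]

/-- The kernel of the odd part of the extension formula. -/
noncomputable def oddKernel (K : ℝ → ℂ) (T : ℝ) (q : ℝ) : ℂ :=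
  (Ici 0).indicator K (T + q) - (Ici 0).indicator K (T - q)

lemma LInt.oddKernel {K : ℝ → ℂ} (hK : LInt K) (T : ℝ) :
    LInt (ConvolutedCosine.oddKernel K T) := by
  intro R _
  have h1 := (hK.indicator_Ici T (T + R)).comp_add_left T
  have h2 := (hK.indicator_Ici T (T - R)).comp_sub_left T
  simp only [sub_self, add_sub_cancel_left, sub_sub_cancel] at h1 h2
  exact h1.sub h2

/-- In this form every term except the product P is a convolution to which duality applies: V cut
off at T, V reflected at T, and the two integrals of U merged by `oddKernel`. -/
lemma extFormula_eq {k K : ℝ → ℂ} (hK : LInt K) {T : ℝ} {V U P : ℝ → X}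
    {s : ℝ} (hs : 0 ≤ s) (hsT : s ≤ T) (hU : ContinuousOn U (Icc 0 s)) :
    extFormula k K T V U P s = (2 : ℂ) • P s + cv k ((Iic T).indicator V) (T + s)
      + cv (oddKernel K T) U s - cv k (fun r => V (T - r)) s := by
  have hT : 0 ≤ T := hs.trans hsT
  have e1 : cv k ((Iic T).indicator V) (T + s) = ∫ r in (0 : ℝ)..T, k (T + s - r) • V r := by
    rw [cv, intervalIntegral.integral_of_le (by linarith), intervalIntegral.integral_of_le hT]
    rw [setIntegral_eq_of_subset_of_forall_sdiff_eq_zero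
      (f := fun r => k (T + s - r) • (Iic T).indicator V r) measurableSet_Ioc
      (Ioc_subset_Ioc_right (show T ≤ T + s by linarith)) fun u hu => ?_]
    · refine setIntegral_congr_fun measurableSet_Ioc fun r hr => ?_
      rw [indicator_of_mem (show r ∈ Iic T from hr.2)]
    · have : u ∉ Iic T := fun h => hu.2 ⟨hu.1.1, h⟩
      rw [indicator_of_notMem this, smul_zero]
  have e2 : cv (oddKernel K T) U s = (∫ r in (0 : ℝ)..s, K (T + s - r) • U r)
      - ∫ r in (0 : ℝ)..s, K (r + (T - s)) • U r := by
    rw [← intervalIntegral.integral_sub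
      (intervalIntegrable_smul_left hs (hK.comp_sub hs (by linarith)) hU)
      (intervalIntegrable_smul_left hs (hK.comp_add hs (by linarith)) hU), cv]
    refine intervalIntegral.integral_congr fun r hr => ?_
    rw [uIcc_of_le hs] at hr
    simp only [oddKernel]
    rw [indicator_Ici_of_nonneg K (by linarith [hr.2]), indicator_Ici_of_nonneg K
      (by linarith [hr.1]), sub_smul, show T + (s - r) = T + s - r by ring,
      show T - (s - r) = r + (T - s) by ring]
  have e3 : cv k (fun r => V (T - r)) s = ∫ r in (T - s)..T, k (r + (s - T)) • V r := by
    have := intervalIntegral.integral_comp_sub_left (a := 0) (b := s)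
      (fun r => k (r + (s - T)) • V r) T
    rw [sub_zero] at this
    rw [← this, cv]
    refine intervalIntegral.integral_congr fun r _ => ?_
    rw [show T - r + (s - T) = s - r by ring]
  rw [extFormula, e1, e2, e3]
  abel

end Extension

/-! ### The extension tested against smooth functions. -/

section ExtensionStep

variable {X Z : Type*} [NormedAddCommGroup X] [NormedSpace ℂ X] [CompleteSpace X]
  [NormedAddCommGroup Z] [NormedSpace ℂ Z] [CompleteSpace Z]
  {a b : X →L[ℂ] Z} {k K : ℝ → ℂ} {T τ : ℝ} {C E : ℝ → X →L[ℂ] X}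

/-- The extended function on `[0, T + τ]`. -/
noncomputable def extFun (k K : ℝ → ℂ) (T : ℝ) (E C : ℝ → X →L[ℂ] X) (t : ℝ) (x : X) : X :=
  if t ≤ T then cv k (fun s => E s x) t
  else extFormula k K T (fun s => E s x) (fun s => C s x) (fun s => E T (C s x)) (t - T)

omit [CompleteSpace X] in
lemma extFormula_zero {V U P : ℝ → X} (hP : P 0 = 0) :
    extFormula k K T V U P 0 = cv k V T := by
  simp [extFormula, hP, cv]

omit [CompleteSpace X] in
-- The second formula is valid also at T, since C(0) = 0 makes the two agree there. Continuity
-- across T depends on this.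
lemma extFun_add (hC0 : ∀ x, C 0 x = 0) {s : ℝ} (hs : 0 ≤ s) (x : X) :
    extFun k K T E C (T + s) x
      = extFormula k K T (fun s => E s x) (fun s => C s x) (fun s => E T (C s x)) s := by
  rcases hs.eq_or_lt with rfl | hs
  · rw [extFormula_zero (by simp [hC0]), extFun, add_zero, if_pos le_rfl]
  · rw [extFun, if_neg (by linarith), add_sub_cancel_left]

/-- The difference of `f` and its reflection at `T`. -/
noncomputable def reflectDiff (f : ℝ → ℂ) (T r : ℝ) : ℂ := f r - f (2 * T - r)

omit [CompleteSpace X] in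
lemma continuousOn_extFun (hk : LInt k) (hK : LInt K) (hτ : 0 ≤ τ) (hτT : τ ≤ T)
    (hC0 : ∀ x, C 0 x = 0) (hE : ∀ x, ContinuousOn (fun t => E t x) (Icc 0 T))
    (hC : ∀ x, ContinuousOn (fun t => C t x) (Icc 0 τ)) (x : X) :
    ContinuousOn (fun t => extFun k K T E C t x) (Icc 0 (T + τ)) := by
  have hT : 0 ≤ T := hτ.trans hτT
  have h1 : ContinuousOn (fun t => extFun k K T E C t x) (Icc 0 T) :=
    (continuousOn_cv hk hT (hE x)).congr fun t ht => if_pos ht.2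
  have h2 : ContinuousOn (fun t => extFun k K T E C t x) (Icc T (T + τ)) := by
    have h3 := continuousOn_extFormula hk hK hτ hτT (hE x) (hC x)
      (P := fun s => E T (C s x)) ((E T).continuous.comp_continuousOn (hC x))
    refine (h3.comp (f := fun t => t - T) (by fun_prop)
      fun t ht => ⟨by linarith [ht.1], by linarith [ht.2]⟩).congr fun t ht => ?_
    have := extFun_add (k := k) (K := K) (T := T) (E := E) hC0 (sub_nonneg.2 ht.1) x
    rw [add_sub_cancel] at this
    exact this
  rw [← Icc_union_Icc_eq_Icc hT (by linarith : T ≤ T + τ)]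
  exact h1.union_of_isClosed h2 isClosed_Icc isClosed_Icc

/-- Duality term by term. The cut-off convolution contributes f = k ∘ g on [0, T], the reflected one
contributes f(2T - t), and the U-integrals contribute the dual convolution by the odd kernel of g
shifted by T. -/
lemma integral_smul_extFun (hk : LInt k) (hK : LInt K) (hτ : 0 ≤ τ) (hτT : τ ≤ T)
    (hC0 : ∀ x, C 0 x = 0) (hE : ∀ x, ContinuousOn (fun t => E t x) (Icc 0 T))
    (hC : ∀ x, ContinuousOn (fun t => C t x) (Icc 0 τ)) (x : X) {g : ℝ → ℂ}
    (hg : Tail g (T + τ)) :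
    ∫ t in (0 : ℝ)..(T + τ), g t • extFun k K T E C t x
      = (∫ t in (0 : ℝ)..T, reflectDiff (dc k g) T t • E t x)
        + (∫ t in (0 : ℝ)..τ, dc (oddKernel K T) (fun s => g (T + s)) t • C t x)
        + (2 : ℂ) • E T (∫ t in (0 : ℝ)..τ, g (T + t) • C t x) := by
  have hT : 0 ≤ T := hτ.trans hτT
  have hS : 0 ≤ T + τ := by linarith
  have hgc := hg.continuous
  set gT : ℝ → ℂ := fun s => g (T + s) with hgT
  have hgTt : Tail gT τ := by simpa using hg.comp_add T
  have hf : Tail (dc k g) (T + τ) := hg.dc hk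
  have hfc := hf.continuous
  set V : ℝ → X := fun t => E t x with hV
  set U : ℝ → X := fun t => C t x with hU
  have hVi : IntervalIntegrable V volume 0 T := (hE x).intervalIntegrable_of_Icc hT
  have hUi : IntervalIntegrable U volume 0 τ := (hC x).intervalIntegrable_of_Icc hτ
  have hPi : IntervalIntegrable (fun s => E T (U s)) volume 0 τ :=
    ((E T).continuous.comp_continuousOn (hC x)).intervalIntegrable_of_Icc hτ
  have hV0i : IntervalIntegrable ((Iic T).indicator V) volume 0 (T + τ) := by
    rw [intervalIntegrable_iff_integrableOn_Ioc_of_le hS, ← integrable_indicator_iff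
      measurableSet_Ioc, indicator_indicator, Ioc_inter_Iic, min_eq_right (by linarith),
      integrable_indicator_iff measurableSet_Ioc]
    exact (intervalIntegrable_iff_integrableOn_Ioc_of_le hT).1 hVi
  have hVri : IntervalIntegrable (fun r => V (T - r)) volume 0 τ := by
    have h1 : ContinuousOn (fun r => V (T - r)) (Icc 0 τ) :=
      (hE x).comp (f := fun r => T - r) (by fun_prop)
        fun r hr => ⟨by linarith [hr.2], by linarith [hr.1]⟩
    exact h1.intervalIntegrable_of_Icc hτ
  have hcvV0 : IntervalIntegrable (cv k ((Iic T).indicator V)) volume 0 (T + τ) :=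
    intervalIntegrable_cv hS (hk _ hS) hV0i
  have hsplit : ∫ t in (0 : ℝ)..(T + τ), g t • extFun k K T E C t x
      = (∫ t in (0 : ℝ)..T, g t • cv k ((Iic T).indicator V) t)
        + ∫ s in (0 : ℝ)..τ, gT s • extFormula k K T V U (fun s => E T (U s)) s := by
    have hi : IntervalIntegrable (fun t => g t • extFun k K T E C t x) volume 0 (T + τ) :=
      ((continuousOn_extFun hk hK hτ hτT hC0 hE hC x).intervalIntegrable_of_Icc
        hS).continuousOn_smul hgc.continuousOn
    have hTm : T ∈ uIcc 0 (T + τ) := by rw [uIcc_of_le hS]; exact ⟨hT, by linarith⟩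
    rw [← intervalIntegral.integral_add_adjacent_intervals
      (hi.mono_set (uIcc_subset_uIcc left_mem_uIcc hTm))
      (hi.mono_set (uIcc_subset_uIcc hTm right_mem_uIcc))]
    congr 1
    · refine intervalIntegral.integral_congr fun t ht => ?_
      rw [uIcc_of_le hT] at ht
      simp only [extFun, if_pos ht.2]
      congr 1
      refine cv_congr ht.1 (fun _ _ => rfl) fun s hs => ?_
      rw [indicator_of_mem (show s ∈ Iic T from hs.2.trans ht.2)]
    · have := intervalIntegral.integral_comp_add_left (a := 0) (b := τ)
        (fun t => g t • extFun k K T E C t x) T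
      rw [add_zero] at this
      rw [← this]
      refine intervalIntegral.integral_congr fun s hs => ?_
      rw [uIcc_of_le hτ] at hs
      rw [extFun_add hC0 hs.1]
  have hA : (∫ t in (0 : ℝ)..T, g t • cv k ((Iic T).indicator V) t)
      + (∫ s in (0 : ℝ)..τ, gT s • cv k ((Iic T).indicator V) (T + s))
      = ∫ t in (0 : ℝ)..T, dc k g t • V t := by
    have h1 := intervalIntegral.integral_comp_add_left (a := 0) (b := τ)
      (fun t => g t • cv k ((Iic T).indicator V) t) T
    rw [add_zero] at h1
    have hi : IntervalIntegrable (fun t => g t • cv k ((Iic T).indicator V) t) volume 0 (T + τ) :=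
      hcvV0.continuousOn_smul hgc.continuousOn
    have hTm : T ∈ uIcc 0 (T + τ) := by rw [uIcc_of_le hS]; exact ⟨hT, by linarith⟩
    simp only [hgT]
    rw [h1, intervalIntegral.integral_add_adjacent_intervals
      (hi.mono_set (uIcc_subset_uIcc left_mem_uIcc hTm))
      (hi.mono_set (uIcc_subset_uIcc hTm right_mem_uIcc)),
      integral_smul_cv_eq_dc hS (hk _ hS) hV0i hgc hg.zero,
      intervalIntegral.integral_of_le hS, intervalIntegral.integral_of_le hT]
    rw [setIntegral_eq_of_subset_of_forall_sdiff_eq_zero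
      (f := fun r => dc k g r • (Iic T).indicator V r) measurableSet_Ioc
      (Ioc_subset_Ioc_right (show T ≤ T + τ by linarith)) fun u hu => ?_]
    · refine setIntegral_congr_fun measurableSet_Ioc fun r hr => ?_
      rw [indicator_of_mem (show r ∈ Iic T from hr.2)]
    · have : u ∉ Iic T := fun h => hu.2 ⟨hu.1.1, h⟩
      rw [indicator_of_notMem this, smul_zero]
  have hB : ∫ s in (0 : ℝ)..τ, gT s • cv k (fun r => V (T - r)) s
      = ∫ t in (0 : ℝ)..T, dc k g (2 * T - t) • V t := by
    rw [integral_smul_cv_eq_dc hτ (hk _ hτ) hVri hgTt.continuous hgTt.zero]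
    have h1 := intervalIntegral.integral_comp_sub_left (a := 0) (b := τ)
      (fun t => dc k g (2 * T - t) • V t) T
    rw [sub_zero] at h1
    have h2 : ∫ r in (0 : ℝ)..τ, dc k gT r • V (T - r)
        = ∫ t in (T - τ)..T, dc k g (2 * T - t) • V t := by
      rw [← h1]
      refine intervalIntegral.integral_congr fun r _ => ?_
      rw [hgT, dc_comp_add]
      simp only
      rw [show 2 * T - (T - r) = T + r by ring]
    rw [h2, intervalIntegral.integral_of_le (by linarith), intervalIntegral.integral_of_le hT]
    refine (setIntegral_eq_of_subset_of_forall_sdiff_eq_zero measurableSet_Ioc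
      (Ioc_subset_Ioc_left (show 0 ≤ T - τ by linarith)) fun u hu => ?_).symm
    rw [hf.zero, zero_smul]
    by_contra hc
    exact hu.2 ⟨by linarith, hu.1.2⟩
  have hm := hK.oddKernel T
  have hC' : ∫ s in (0 : ℝ)..τ, gT s • cv (oddKernel K T) U s
      = ∫ t in (0 : ℝ)..τ, dc (oddKernel K T) gT t • U t :=
    integral_smul_cv_eq_dc hτ (hm _ hτ) hUi hgTt.continuous hgTt.zero
  have hD : ∫ s in (0 : ℝ)..τ, gT s • (2 : ℂ) • E T (U s)
      = (2 : ℂ) • E T (∫ t in (0 : ℝ)..τ, gT t • U t) := by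
    rw [← ContinuousLinearMap.intervalIntegral_comp_comm (E T)
      (hUi.continuousOn_smul hgTt.continuous.continuousOn), ← intervalIntegral.integral_smul]
    refine intervalIntegral.integral_congr fun s _ => ?_
    simp only [map_smul]
    rw [smul_comm]
  have hform : ∫ s in (0 : ℝ)..τ, gT s • extFormula k K T V U (fun s => E T (U s)) s
      = (∫ s in (0 : ℝ)..τ, gT s • (2 : ℂ) • E T (U s))
        + (∫ s in (0 : ℝ)..τ, gT s • cv k ((Iic T).indicator V) (T + s))
        + (∫ s in (0 : ℝ)..τ, gT s • cv (oddKernel K T) U s)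
        - ∫ s in (0 : ℝ)..τ, gT s • cv k (fun r => V (T - r)) s := by
    have hgo := hgTt.continuous.continuousOn (s := uIcc 0 τ)
    have i1 : IntervalIntegrable (fun s => gT s • (2 : ℂ) • E T (U s)) volume 0 τ :=
      IntervalIntegrable.continuousOn_smul (hPi.smul (2 : ℂ)) hgo
    have i2 : IntervalIntegrable (fun s => gT s • cv k ((Iic T).indicator V) (T + s))
        volume 0 τ := by
      have h1 := (hcvV0.mono_set (show uIcc T (T + τ) ⊆ uIcc 0 (T + τ) from
        uIcc_subset_uIcc (by rw [uIcc_of_le hS]; exact ⟨hT, by linarith⟩)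
          right_mem_uIcc)).comp_add_left T
      rw [sub_self, add_sub_cancel_left] at h1
      exact h1.continuousOn_smul hgo
    have i3 : IntervalIntegrable (fun s => gT s • cv (oddKernel K T) U s) volume 0 τ :=
      (intervalIntegrable_cv hτ (hm _ hτ) hUi).continuousOn_smul hgo
    have i4 : IntervalIntegrable (fun s => gT s • cv k (fun r => V (T - r)) s) volume 0 τ :=
      (intervalIntegrable_cv hτ (hk _ hτ) hVri).continuousOn_smul hgo
    rw [← intervalIntegral.integral_add i1 i2, ← intervalIntegral.integral_add (i1.add i2) i3,
      ← intervalIntegral.integral_sub ((i1.add i2).add i3) i4]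
    refine intervalIntegral.integral_congr fun s hs => ?_
    rw [uIcc_of_le hτ] at hs
    rw [extFormula_eq hK hs.1 (hs.2.trans hτT) ((hC x).mono (Icc_subset_Icc_right hs.2)),
      smul_sub, smul_add, smul_add]
  have hr : ∫ t in (0 : ℝ)..T, reflectDiff (dc k g) T t • V t
      = (∫ t in (0 : ℝ)..T, dc k g t • V t) - ∫ t in (0 : ℝ)..T, dc k g (2 * T - t) • V t := by
    simp only [reflectDiff, sub_smul]
    exact intervalIntegral.integral_sub (hVi.continuousOn_smul hfc.continuousOn)
      (hVi.continuousOn_smul (by fun_prop))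
  rw [hsplit, hform, hr, hB, hC', hD, ← hA]
  abel

/-- The scalar identity behind the extension step. -/
lemma integral_reflectDiff_add (hk : LInt k) (hK : LInt K) (hτ : 0 ≤ τ) (hτT : τ ≤ T)
    {g : ℝ → ℂ} (hg : Tail g (T + τ)) :
    (∫ r in (0 : ℝ)..T, (dc k g r + dc k g (2 * T - r)) * K r)
      + dc k (dc (oddKernel K T) fun s => g (T + s)) 0 = dc (conv k K) g 0 := by
  have hT : 0 ≤ T := hτ.trans hτT
  have hS : 0 ≤ T + τ := by linarith
  set f := dc k g with hf
  have hft : Tail f (T + τ) := hg.dc hk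
  have hfc := hft.continuous
  have hgTt : Tail (fun s => g (T + s)) τ := by simpa using hg.comp_add T
  have hm := hK.oddKernel T
  have e0 : dc (conv k K) g 0 = ∫ r in (0 : ℝ)..(T + τ), f r * K r := by
    rw [dc_conv hk hK hg, dc_comm hk hK hg, dc_eq hft.zero hS (by linarith)]
    simp only [zero_add, hf, mul_comm (K _)]
  have hfT : Tail (fun s => f (T + s)) τ := by simpa using hft.comp_add T
  have e1 : dc k (dc (oddKernel K T) fun s => g (T + s)) 0
      = ∫ q in (0 : ℝ)..τ, (oddKernel K T q) * f (T + q) := by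
    rw [dc_comm hk hm hgTt, dc_comp_add, dc_eq hfT.zero hτ (by linarith)]
    simp only [zero_add, hf]
  have iK : ∀ x y, IntervalIntegrable (fun r => (Ici 0).indicator K r * f r) volume x y :=
    fun x y => (hK.indicator_Ici x y).mul_continuousOn hfc.continuousOn
  have iK2 : ∀ x y, IntervalIntegrable (fun r => (Ici 0).indicator K r * f (2 * T - r)) volume x y :=
    fun x y => (hK.indicator_Ici x y).mul_continuousOn
      (by fun_prop : Continuous fun r => f (2 * T - r)).continuousOn
  have e2 : ∫ q in (0 : ℝ)..τ, (oddKernel K T q) * f (T + q)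
      = (∫ r in T..(T + τ), (Ici 0).indicator K r * f r)
        - ∫ r in (T - τ)..T, (Ici 0).indicator K r * f (2 * T - r) := by
    have h1 := intervalIntegral.integral_comp_add_left (a := 0) (b := τ)
      (fun r => (Ici 0).indicator K r * f r) T
    have h2 := intervalIntegral.integral_comp_sub_left (a := 0) (b := τ)
      (fun r => (Ici 0).indicator K r * f (2 * T - r)) T
    rw [add_zero] at h1
    rw [sub_zero] at h2
    have j1 := (iK T (T + τ)).comp_add_left T
    have j2 := (iK2 T (T - τ)).comp_sub_left T
    simp only [sub_self, add_sub_cancel_left, sub_sub_cancel] at j1 j2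
    rw [← h1, ← h2, ← intervalIntegral.integral_sub j1 j2]
    refine intervalIntegral.integral_congr fun q _ => ?_
    simp only [oddKernel]
    rw [show 2 * T - (T - q) = T + q by ring]
    ring
  have e3 : ∫ r in (T - τ)..T, (Ici 0).indicator K r * f (2 * T - r)
      = ∫ r in (0 : ℝ)..T, (Ici 0).indicator K r * f (2 * T - r) := by
    rw [intervalIntegral.integral_of_le (by linarith), intervalIntegral.integral_of_le hT]
    refine (setIntegral_eq_of_subset_of_forall_sdiff_eq_zero measurableSet_Ioc
      (Ioc_subset_Ioc_left (show 0 ≤ T - τ by linarith)) fun u hu => ?_).symm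
    rw [hft.zero, mul_zero]
    by_contra hc
    exact hu.2 ⟨by linarith, hu.1.2⟩
  have e4 : ∫ r in (0 : ℝ)..T, (f r + f (2 * T - r)) * K r
      = (∫ r in (0 : ℝ)..T, (Ici 0).indicator K r * f r)
        + ∫ r in (0 : ℝ)..T, (Ici 0).indicator K r * f (2 * T - r) := by
    rw [← intervalIntegral.integral_add (iK _ _) (iK2 _ _)]
    refine intervalIntegral.integral_congr fun r hr => ?_
    rw [uIcc_of_le hT] at hr
    simp only [indicator_Ici_of_nonneg K hr.1]
    ring
  have e5 : ∫ r in (0 : ℝ)..(T + τ), f r * K r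
      = ∫ r in (0 : ℝ)..(T + τ), (Ici 0).indicator K r * f r := by
    refine intervalIntegral.integral_congr fun r hr => ?_
    rw [uIcc_of_le hS] at hr
    simp only [indicator_Ici_of_nonneg K hr.1]
    ring
  -- The two integrals of K(r) f(2T - r) cancel, and the rest glues to the integral of K f over [0,
  -- T + τ], that is (K ∘ f)(0).
  rw [e4, e1, e2, e3, e0, e5, ← intervalIntegral.integral_add_adjacent_intervals (iK 0 T)
    (iK T (T + τ))]
  ring

end ExtensionStep

/-! ### The extension is a family for the next convolution power. -/

section ExtensionStep

variable {X Z : Type*} [NormedAddCommGroup X] [NormedSpace ℂ X] [CompleteSpace X]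
  [NormedAddCommGroup Z] [NormedSpace ℂ Z] [CompleteSpace Z]
  {a b : X →L[ℂ] Z} {k K : ℝ → ℂ} {T τ : ℝ} {C E : ℝ → X →L[ℂ] X}

lemma hasDerivAt_reflect {f : ℝ → ℂ} (hf : ContDiff ℝ ∞ f) (T r : ℝ) :
    HasDerivAt (fun r => f (2 * T - r)) (- deriv f (2 * T - r)) r := by
  have h := (hasDerivAt_of_smooth hf (2 * T - r)).scomp r ((hasDerivAt_id r).const_sub (2 * T))
  rwa [neg_one_smul] at h

lemma deriv_reflectDiff {f : ℝ → ℂ} (hf : ContDiff ℝ ∞ f) (T : ℝ) :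
    deriv (reflectDiff f T) = fun r => deriv f r + deriv f (2 * T - r) := by
  funext r
  have h := (hasDerivAt_of_smooth hf r).sub (hasDerivAt_reflect hf T r)
  rw [sub_neg_eq_add] at h
  exact h.deriv

lemma deriv_deriv_reflectDiff {f : ℝ → ℂ} (hf : ContDiff ℝ ∞ f) (T : ℝ) :
    deriv (deriv (reflectDiff f T)) = reflectDiff (deriv (deriv f)) T := by
  rw [deriv_reflectDiff hf]
  funext r
  have hf1 := contDiff_deriv hf
  exact ((hasDerivAt_of_smooth hf1 r).add (hasDerivAt_reflect hf1 T r)).deriv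

/-- Each of the three pieces of `integral_smul_extFun` obeys the weak form of its own family. The
coefficients of x add up by `integral_reflectDiff_add`, applied to g'. -/
lemma duhamel_extFun_weak (hk : LInt k) (hK : LInt K) (hτ : 0 ≤ τ) (hτT : τ ≤ T)
    (hb : Function.Injective b) (hE : IsFamily a b K T E) (hC : IsFamily a b k τ C) (x : X)
    {g : ℝ → ℂ} (hg : Tail g (T + τ)) :
    a (∫ t in (0 : ℝ)..(T + τ), g t • extFun k K T E C t x)
      = b ((∫ t in (0 : ℝ)..(T + τ), deriv (deriv g) t • extFun k K T E C t x)
        + dc (conv k K) (deriv g) 0 • x) := by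
  have hT : 0 ≤ T := hτ.trans hτT
  have hm := hK.oddKernel T
  have hC0 := hC.apply_zero hτ hb
  have hgT : Tail (fun s => g (T + s)) τ := by simpa using hg.comp_add T
  have hdT : ∀ f : ℝ → ℂ, deriv (fun s => f (T + s)) = fun s => deriv f (T + s) := fun f => by
    funext s
    exact deriv_comp_const_add f T s
  have hf : Tail (dc k g) (T + τ) := hg.dc hk
  have hα : ContDiff ℝ ∞ (reflectDiff (dc k g) T) :=
    hf.smooth.sub (hf.smooth.comp (contDiff_const.sub contDiff_id))
  -- The reflected difference of f = k ∘ g vanishes at T, but its derivative there is 2f'(T),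
  -- leaving -2f'(T) E(T)x. The source (k ∘ g')(T) = f'(T) in `h3`, doubled, cancels it; this
  -- accounts for the coefficient 2 in the extension formula.
  have h1 := hE.weak hK hT hα (by simp [reflectDiff, two_mul]) x
  have h2 := hC.weak_tail hk hτ (hgT.dc hm) x
  have h3 := hE.comm T ⟨hT, le_rfl⟩ _ _ (hC.weak_tail hk hτ hgT x)
  have hs := integral_reflectDiff_add hk hK hτ hτT hg.deriv
  rw [integral_smul_extFun hk hK hτ hτT hC0 hE.cont hC.cont x hg,
    integral_smul_extFun hk hK hτ hτT hC0 hE.cont hC.cont x hg.deriv.deriv,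
    map_add, map_add, map_smul, h1, h2, h3, ← hs,
    deriv_deriv_reflectDiff hf.smooth, deriv_reflectDiff hf.smooth, deriv_dc hk hg,
    deriv_dc hk hg.deriv, deriv_dc hm hgT, hdT, deriv_dc hm (by simpa using hg.deriv.comp_add T),
    hdT, dc_comp_add (k := k) (φ := deriv g)]
  simp only [map_add, map_smul, show 2 * T - T = T by ring, add_zero]
  module

lemma exists_family_extFun (hk : LInt k) (hK : LInt K) (hτ : 0 < τ) (hτT : τ ≤ T)
    (hb : Function.Injective b) (hE : IsFamily a b K T E) (hC : IsFamily a b k τ C) :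
    ∃ E' : ℝ → X →L[ℂ] X, (∀ t ∈ Icc 0 (T + τ), ∀ x, E' t x = extFun k K T E C t x) ∧
      IsFamily a b (conv k K) (T + τ) E' := by
  have hT : 0 ≤ T := hτ.le.trans hτT
  have hC0 := hC.apply_zero hτ.le hb
  have hop : ∀ t ∈ Icc 0 (T + τ), ∃ L : X →L[ℂ] X, (∀ x, L x = extFun k K T E C t x) ∧
      ∀ u v, a u = b v → a (L u) = b (L v) := by
    intro t ht
    rcases le_or_gt t T with htT | htT
    · have hκ : IntervalIntegrable (fun r => k (t - r)) volume 0 t := hk.comp_sub ht.1 le_rfl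
      have hc : ∀ x, ContinuousOn (fun r => E r x) (Icc 0 t) :=
        fun x => (hE.cont x).mono (Icc_subset_Icc_right htT)
      obtain ⟨L, hL⟩ := exists_integral_operator ht.1 hκ hc
      refine ⟨L, fun x => ?_, fun u v huv => ?_⟩
      · rw [hL, extFun, if_pos htT, cv]
      · rw [hL, hL]
        exact map_integral_eq_of_comm ht.1 hκ hc
          fun r hr => hE.comm r ⟨hr.1, hr.2.trans htT⟩ u v huv
    · set s := t - T with hs
      have hs0 : 0 ≤ s := by linarith
      have hsτ : s ≤ τ := by linarith [ht.2]
      have hsC : s ∈ Icc 0 τ := ⟨hs0, hsτ⟩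
      have κ1 : IntervalIntegrable (fun r => k (T + s - r)) volume 0 T :=
        hk.comp_sub hT (by linarith)
      have κ2 : IntervalIntegrable (fun r => K (T + s - r)) volume 0 s :=
        hK.comp_sub hs0 (by linarith)
      have κ3 : IntervalIntegrable (fun r => k (r + (s - T))) volume (T - s) T :=
        hk.comp_add (by linarith) (by linarith)
      have κ4 : IntervalIntegrable (fun r => K (r + (T - s))) volume 0 s :=
        hK.comp_add hs0 (by linarith)
      have c3 : ∀ x, ContinuousOn (fun r => E r x) (Icc (T - s) T) :=
        fun x => (hE.cont x).mono (Icc_subset_Icc_left (by linarith))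
      have c2 : ∀ x, ContinuousOn (fun r => C r x) (Icc 0 s) :=
        fun x => (hC.cont x).mono (Icc_subset_Icc_right hsτ)
      obtain ⟨L1, h1⟩ := exists_integral_operator hT κ1 hE.cont
      obtain ⟨L2, h2⟩ := exists_integral_operator hs0 κ2 c2
      obtain ⟨L3, h3⟩ := exists_integral_operator (by linarith) κ3 c3
      obtain ⟨L4, h4⟩ := exists_integral_operator hs0 κ4 c2
      refine ⟨(2 : ℂ) • (E T).comp (C s) + L1 + L2 - L3 - L4, fun x => ?_, fun u v huv => ?_⟩
      · rw [extFun, if_neg htT.not_ge, extFormula, ← h1, ← h2, ← h3, ← h4]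
        rfl
      · have e0 := hE.comm T ⟨hT, le_rfl⟩ _ _ (hC.comm s hsC u v huv)
        have e1 : a (L1 u) = b (L1 v) := by
          rw [h1, h1]
          exact map_integral_eq_of_comm hT κ1 hE.cont fun r hr => hE.comm r hr u v huv
        have e2 : a (L2 u) = b (L2 v) := by
          rw [h2, h2]
          exact map_integral_eq_of_comm hs0 κ2 c2
            fun r hr => hC.comm r ⟨hr.1, hr.2.trans hsτ⟩ u v huv
        have e3 : a (L3 u) = b (L3 v) := by
          rw [h3, h3]
          exact map_integral_eq_of_comm (by linarith) κ3 c3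
            fun r hr => hE.comm r ⟨by linarith [hr.1], hr.2⟩ u v huv
        have e4 : a (L4 u) = b (L4 v) := by
          rw [h4, h4]
          exact map_integral_eq_of_comm hs0 κ4 c2
            fun r hr => hC.comm r ⟨hr.1, hr.2.trans hsτ⟩ u v huv
        simp only [_root_.sub_apply, _root_.add_apply,
          _root_.smul_apply, ContinuousLinearMap.comp_apply, map_sub, map_add,
          map_smul, e0, e1, e2, e3, e4]
  choose! E' hE' hcomm using hop
  have hcont := continuousOn_extFun hk hK hτ.le hτT hC0 hE.cont hC.cont
  have hS : 0 < T + τ := by linarith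
  have hcont' : ∀ x, ContinuousOn (fun t => E' t x) (Icc 0 (T + τ)) :=
    fun x => (hcont x).congr fun t ht => hE' t ht x
  refine ⟨E', hE', hcont', hcomm, fun t ht x => ?_⟩
  refine duhamel_of_weak (hk.conv hK) hS (hcont' x) (fun g hg => ?_) t ht
  have hc : ∀ f : ℝ → ℂ, ∫ t in (0 : ℝ)..(T + τ), f t • E' t x
      = ∫ t in (0 : ℝ)..(T + τ), f t • extFun k K T E C t x := fun f => by
    refine intervalIntegral.integral_congr fun t ht => ?_
    rw [uIcc_of_le hS.le] at ht
    simp only [hE' t ht x]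
  rw [hc, hc]
  exact duhamel_extFun_weak hk hK hτ.le hτT hb hE hC x hg

/-- The extended families are convoluted cosine functions for the convolution powers. -/
lemma exists_family_extFamily (hk : LInt k) (hτ : 0 < τ) (hb : Function.Injective b)
    (hC : IsFamily a b k τ C) (n : ℕ) :
    ∃ E : ℝ → X →L[ℂ] X, (∀ t ∈ Icc 0 (((n + 1 : ℕ) : ℝ) * τ), ∀ x,
      extFamily k τ C (n + 1) t x = E t x) ∧
      IsFamily a b (convPow k (n + 1)) (((n + 1 : ℕ) : ℝ) * τ) E := by
  induction n with
  | zero => exact ⟨C, fun _ _ _ => rfl, by simpa [convPow] using hC⟩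
  | succ n ih =>
    obtain ⟨E, hEe, hE⟩ := ih
    set T : ℝ := ((n + 1 : ℕ) : ℝ) * τ with hTdef
    have hτT : τ ≤ T := by
      rw [hTdef]
      refine le_mul_of_one_le_left hτ.le ?_
      exact_mod_cast Nat.le_add_left 1 n
    have hT : 0 ≤ T := hτ.le.trans hτT
    have hTS : (((n + 1 + 1 : ℕ) : ℝ) * τ) = T + τ := by
      rw [hTdef]
      push_cast
      ring
    obtain ⟨E', hE'e, hE'⟩ := exists_family_extFun hk (hk.convPow (n + 1)) hτ hτT hb hE hC
    rw [hTS]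
    refine ⟨E', fun t ht x => ?_, hE'⟩
    rw [hE'e t ht x]
    change extStep k τ C (n + 1) (extFamily k τ C (n + 1)) t x = _
    have hcongr : ∀ (κ : ℝ → ℂ) (c d : ℝ), 0 ≤ c → c ≤ d → d ≤ T →
        ∫ r in c..d, κ r • extFamily k τ C (n + 1) r x = ∫ r in c..d, κ r • E r x := by
      intro κ c d hc hcd hd
      refine intervalIntegral.integral_congr fun r hr => ?_
      rw [uIcc_of_le hcd] at hr
      simp only [hEe r ⟨hc.trans hr.1, hr.2.trans hd⟩ x]
    rw [extStep, extFun, ← hTdef]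
    split_ifs with htT
    · exact hcongr (fun r => k (t - r)) 0 t le_rfl ht.1 htT
    · have hs : 0 ≤ t - T := by linarith [not_le.1 htT]
      have e2 : 2 * ((n + 1 : ℕ) : ℝ) * τ = 2 * T := by rw [hTdef]; ring
      rw [e2, hEe T ⟨hT, le_rfl⟩, hcongr (fun r => k (t - r)) 0 T le_rfl hT le_rfl,
        hcongr (fun r => k (r + t - 2 * T)) (2 * T - t) T (by linarith [ht.2]) (by linarith) le_rfl,
        extFormula]
      have f1 : T + (t - T) = t := by ring
      have f2 : T - (t - T) = 2 * T - t := by ring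
      have f3 : ∀ r, r + (t - T - T) = r + t - 2 * T := fun r => by ring
      have f4 : ∀ r, r + (2 * T - t) = r - t + 2 * T := fun r => by ring
      simp only [f1, f2, f3, f4]

end ExtensionStep

/-! ### Uniqueness for the wave equation and multiplicativity. -/

section Homomorphism

variable {X Z : Type*} [NormedAddCommGroup X] [NormedSpace ℂ X] [CompleteSpace X]
  [NormedAddCommGroup Z] [NormedSpace ℂ Z] [CompleteSpace Z]
  {a b : X →L[ℂ] Z} {K : ℝ → ℂ} {T : ℝ} {E : ℝ → X →L[ℂ] X}

omit [CompleteSpace Z] in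
/-- A family can be replaced by one that is jointly continuous on the whole real line. -/
lemma IsFamily.exists_continuous (hE : IsFamily a b K T E) (hT : 0 ≤ T) :
    ∃ E' : ℝ → X →L[ℂ] X, (∀ t ∈ Icc 0 T, E' t = E t) ∧ IsFamily a b K T E' ∧
      Continuous fun p : ℝ × X => E' p.1 p.2 := by
  obtain ⟨M, hM0, hM⟩ := exists_norm_le_of_continuousOn hE.cont
  have he : ∀ t ∈ Icc 0 T, E (projIcc 0 T hT t) = E t := fun t ht => by
    rw [projIcc_of_mem hT ht]
  have hc : ∀ x, Continuous fun t => E (projIcc 0 T hT t) x := fun x =>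
    (hE.cont x).domRestrict.comp continuous_projIcc
  refine ⟨fun t => E (projIcc 0 T hT t), he, ⟨fun x => (hc x).continuousOn, fun t ht u v => ?_,
    fun t ht x => ?_⟩, ?_⟩
  · rw [he t ht]
    exact hE.comm t ht u v
  · rw [he t ht, ← hE.duhamel t ht x]
    congr 1
    exact cv_congr ht.1 (fun _ _ => rfl) fun s hs => by rw [he s ⟨hs.1, hs.2.trans ht.2⟩]
  · refine continuous_prod_of_continuous_lipschitzWith' _ ⟨M, hM0⟩ (fun t => ?_) hc
    exact (E (projIcc 0 T hT t)).lipschitz.weaken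
      (NNReal.coe_le_coe.1 (hM _ (projIcc 0 T hT t).2))

/-- Uniqueness for the wave equation with vanishing initial data, tested on a dual convolution. -/
lemma IsFamily.integral_dc_smul_eq_zero (hE : IsFamily a b K T E) (hK : LInt K) (hT : 0 ≤ T)
    (hEc : Continuous fun p : ℝ × X => E p.1 p.2) (hb : Function.Injective b) {p : ℝ} (hpT : p ≤ T)
    {z : ℝ → X} (hz : Continuous z)
    (h : ∀ g, Tail g p → a (∫ t in (0 : ℝ)..T, g t • z t)
      = b (∫ t in (0 : ℝ)..T, deriv (deriv g) t • z t))
    {m : ℝ → ℂ} (hm : Tail m p) : ∫ t in (0 : ℝ)..T, dc K m t • z t = 0 := by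
  -- From here on m denotes an antiderivative of the given function, because the weak form for E
  -- produces K ∘ m'.
  obtain ⟨m, hm', rfl⟩ := hm.exists_antideriv
  clear hm
  rename Tail m p => hm
  have hdT : ∀ (f : ℝ → ℂ) (c : ℝ), deriv (fun s => f (c + s)) = fun s => deriv f (c + s) :=
    fun f c => by
      funext s
      exact deriv_comp_const_add f c s
  have hG : ∀ f : ℝ → ℂ, Continuous f →
      Continuous fun q : ℝ × ℝ => f (q.1 + q.2) • E q.2 (z q.1) := fun f hf =>
    (hf.comp (by fun_prop : Continuous fun q : ℝ × ℝ => q.1 + q.2)).smul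
      (hEc.comp (by fun_prop : Continuous fun q : ℝ × ℝ => (q.2, z q.1)))
  have hin : ∀ f : ℝ → ℂ, Continuous f →
      Continuous fun s => ∫ t in (0 : ℝ)..T, f (s + t) • E t (z s) := fun f hf =>
    intervalIntegral.continuous_parametric_intervalIntegral_of_continuous' (hG f hf) _ _
  have hin' : ∀ f : ℝ → ℂ, Continuous f →
      Continuous fun t => ∫ s in (0 : ℝ)..T, f (s + t) • E t (z s) := fun f hf =>
    intervalIntegral.continuous_parametric_intervalIntegral_of_continuous'
      (f := fun t s => f (s + t) • E t (z s)) ((hG f hf).comp continuous_swap) _ _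
  have hswap : ∀ f : ℝ → ℂ, Continuous f →
      ∫ s in (0 : ℝ)..T, ∫ t in (0 : ℝ)..T, f (s + t) • E t (z s)
        = ∫ t in (0 : ℝ)..T, ∫ s in (0 : ℝ)..T, f (s + t) • E t (z s) := fun f hf => by
    have := swap_rect_smul hT hT (a := fun _ => 1) (b := fun _ => 1) intervalIntegrable_const
      intervalIntegrable_const (hG f hf).continuousOn
    simpa only [one_mul, one_smul] using this
  have hmc := hm.continuous
  have hmc2 := hm.deriv.deriv.continuous
  have hdc : Continuous (dc K (deriv m)) := (hm.deriv.dc hK).continuous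
  -- A is applied to the double integral of m(s + t) E(t) z(s) through the variable t; the weak form
  -- for E leaves the source ∫ (K ∘ m') z.
  have h1 : a (∫ s in (0 : ℝ)..T, ∫ t in (0 : ℝ)..T, m (s + t) • E t (z s))
      = b ((∫ s in (0 : ℝ)..T, ∫ t in (0 : ℝ)..T, deriv (deriv m) (s + t) • E t (z s))
        + ∫ s in (0 : ℝ)..T, dc K (deriv m) s • z s) := by
    have i1 := (hin _ hmc).intervalIntegrable (μ := volume) 0 T
    have i2 := (hin _ hmc2).intervalIntegrable (μ := volume) 0 T
    have i3 : IntervalIntegrable (fun s => dc K (deriv m) s • z s) volume 0 T :=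
      (hdc.smul hz).intervalIntegrable _ _
    rw [← intervalIntegral.integral_add i2 i3,
      ← ContinuousLinearMap.intervalIntegral_comp_comm a i1,
      ← ContinuousLinearMap.intervalIntegral_comp_comm b (i2.add i3)]
    refine intervalIntegral.integral_congr fun s hs => ?_
    rw [uIcc_of_le hT] at hs
    have ht : Tail (fun t => m (s + t)) T := (hm.comp_add s).mono (by linarith [hs.1])
    have := hE.weak_tail hK hT ht (z s)
    rw [hdT, hdT, dc_comp_add] at this
    simpa only [add_zero] using this
  -- Through the variable s there is no source: z satisfies the homogeneous equation and E(t)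
  -- respects the graph. Comparing with `h1`, injectivity of b kills the source.
  have h2 : a (∫ t in (0 : ℝ)..T, ∫ s in (0 : ℝ)..T, m (s + t) • E t (z s))
      = b (∫ t in (0 : ℝ)..T, ∫ s in (0 : ℝ)..T, deriv (deriv m) (s + t) • E t (z s)) := by
    rw [← ContinuousLinearMap.intervalIntegral_comp_comm a ((hin' _ hmc).intervalIntegrable _ _),
      ← ContinuousLinearMap.intervalIntegral_comp_comm b ((hin' _ hmc2).intervalIntegrable _ _)]
    refine intervalIntegral.integral_congr fun t ht => ?_
    rw [uIcc_of_le hT] at ht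
    have hc : ∀ f : ℝ → ℂ, Continuous f → ∫ s in (0 : ℝ)..T, f (s + t) • E t (z s)
        = E t (∫ s in (0 : ℝ)..T, f (t + s) • z s) := fun f hf => by
      rw [← ContinuousLinearMap.intervalIntegral_comp_comm (E t)
        (Continuous.intervalIntegrable (by fun_prop) _ _)]
      simp only [map_smul, add_comm]
    have htl : Tail (fun s => m (t + s)) p := (hm.comp_add t).mono (by linarith [ht.1])
    have := h _ htl
    rw [hdT, hdT] at this
    rw [hc _ hmc, hc _ hmc2]
    exact hE.comm t ht _ _ this
  rw [hswap _ hmc, h2, hswap _ hmc2] at h1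
  exact left_eq_add.1 (hb h1)

lemma deriv_eq_of_eqOn_Ici {f g : ℝ → ℂ} (hf : ContDiff ℝ ∞ f) (hg : ContDiff ℝ ∞ g)
    (h : EqOn f g (Ici 0)) : EqOn (deriv f) (deriv g) (Ici 0) := fun t ht => by
  have h1 := (hasDerivAt_of_smooth hf t).hasDerivWithinAt (s := Ici 0)
  have h2 := ((hasDerivAt_of_smooth hg t).hasDerivWithinAt (s := Ici 0)).congr h (h ht)
  exact (uniqueDiffOn_Ici 0 t ht).eq_deriv _ h1 h2

/-- Applying K ∘ · reduces this to the formula for (φ *_c ψ)'', with φ = K ∘ g and ψ = K ∘ h;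
injectivity of K ∘ · on [0, ∞) brings it back. -/
lemma deriv_deriv_cosLift {g h : ℝ → ℂ} (hK : LInt K)
    (hinj : ∀ φ R, Tail φ R → (∀ t, 0 ≤ t → dc K φ t = 0) → ∀ t, 0 ≤ t → φ t = 0)
    {p q : ℝ} (hp : 0 ≤ p) (hq : 0 ≤ q) (hg : Tail g p) (hh : Tail h q) {t : ℝ} (ht : 0 ≤ t) :
    deriv (deriv (cosLift K g h)) t
      = cosLift K (deriv (deriv g)) h t + dc K (deriv g) 0 * h t := by
  have hw := hg.cosLift hK hh hp hq
  have hw2 := hg.deriv.deriv.cosLift hK hh hp hq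
  have hh' := (hh.mono (show q ≤ p + q by linarith)).const_mul (dc K (deriv g) 0)
  have hφ := hg.dc hK
  have hψ := hh.dc hK
  have e : EqOn (dc K (cosLift K g h)) (cosC (dc K g) (dc K h)) (Ici 0) :=
    fun t ht => dc_cosLift hK hg hh hp hq ht
  have e2 := deriv_eq_of_eqOn_Ici (contDiff_deriv (hw.dc hK).smooth)
    (contDiff_deriv (hφ.cosC hψ hp hq).smooth)
    (deriv_eq_of_eqOn_Ici (hw.dc hK).smooth (hφ.cosC hψ hp hq).smooth e)
  have := hinj _ _ (hw.deriv.deriv.sub (hw2.add hh')) (fun t ht => by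
    rw [dc_sub hK hw.deriv.deriv (hw2.add hh'), dc_add hK hw2 hh', dc_const_mul,
      dc_cosLift hK hg.deriv.deriv hh hp hq ht, ← deriv_dc hK hw.deriv, ← deriv_dc hK hw, e2 ht,
      deriv_deriv_cosC hφ hψ, deriv_dc hK hg, deriv_dc hK hg.deriv, sub_self]) t ht
  exact sub_eq_zero.1 this

lemma dc_deriv_cosLift_zero {g h : ℝ → ℂ} (hK : LInt K)
    {p q : ℝ} (hp : 0 ≤ p) (hq : 0 ≤ q) (hg : Tail g p) (hh : Tail h q) :
    dc K (deriv (cosLift K g h)) 0 = 0 := by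
  have hw := hg.cosLift hK hh hp hq
  have hφ := hg.dc hK
  have hψ := hh.dc hK
  have e : EqOn (dc K (cosLift K g h)) (cosC (dc K g) (dc K h)) (Ici 0) :=
    fun t ht => dc_cosLift hK hg hh hp hq ht
  rw [← deriv_dc hK hw, deriv_eq_of_eqOn_Ici (hw.dc hK).smooth (hφ.cosC hψ hp hq).smooth e
    self_mem_Ici, deriv_cosC_zero hφ hψ]

/-- Multiplicativity of the smoothed families. -/
lemma IsFamily.integral_cosLift (hE : IsFamily a b K T E) (hK : LInt K) (hT : 0 ≤ T)
    (hb : Function.Injective b)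
    (hinj : ∀ φ R, Tail φ R → (∀ t, 0 ≤ t → dc K φ t = 0) → ∀ t, 0 ≤ t → φ t = 0)
    {p q : ℝ} (hp : 0 ≤ p) (hq : 0 ≤ q) (hpq : p + q ≤ T) {m h : ℝ → ℂ} (hm : Tail m p)
    (hh : Tail h q) (x : X) :
    ∫ t in (0 : ℝ)..T, cosLift K (dc K m) h t • E t x
      = ∫ t in (0 : ℝ)..T, dc K m t • E t (∫ s in (0 : ℝ)..T, h s • E s x) := by
  wlog hEc : Continuous fun p : ℝ × X => E p.1 p.2 generalizing E
  · obtain ⟨E', he, hE', hc⟩ := hE.exists_continuous hT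
    have hcg : ∀ (f : ℝ → ℂ) (x : X),
        ∫ t in (0 : ℝ)..T, f t • E' t x = ∫ t in (0 : ℝ)..T, f t • E t x := fun f x => by
      refine intervalIntegral.integral_congr fun t ht => ?_
      rw [uIcc_of_le hT] at ht
      simp only [he t ht]
    have := this hE' hc
    rwa [hcg, hcg, hcg] at this
  have hEx : ∀ x, Continuous fun t => E t x := fun x =>
    hEc.comp (by fun_prop : Continuous fun t : ℝ => (t, x))
  set y := ∫ s in (0 : ℝ)..T, h s • E s x with hy
  have hθ : Continuous fun p : ℝ × ℝ => liftKernel K h p.1 p.2 • E p.2 x :=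
    (continuous_liftKernel hK hh).smul ((hEx x).comp continuous_snd)
  -- The defect of multiplicativity as a function of t: integrated against g it gives ∫ w E x - ∫ g
  -- E y, with w = `cosLift K g h`.
  set z : ℝ → X := fun t => (∫ r in (0 : ℝ)..T, liftKernel K h t r • E r x) - E t y with hzdef
  have hθi : Continuous fun t => ∫ r in (0 : ℝ)..T, liftKernel K h t r • E r x :=
    intervalIntegral.continuous_parametric_intervalIntegral_of_continuous' hθ _ _
  have hz : Continuous z := hθi.sub (hEx y)
  have hG : ∀ g, Tail g p → ∫ t in (0 : ℝ)..T, g t • z t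
      = (∫ t in (0 : ℝ)..T, cosLift K g h t • E t x) - ∫ t in (0 : ℝ)..T, g t • E t y := by
    intro g hg
    have hgc := hg.continuous
    simp only [hzdef, smul_sub]
    have i1 : IntervalIntegrable
        (fun t => g t • ∫ r in (0 : ℝ)..T, liftKernel K h t r • E r x) volume 0 T :=
      (hgc.smul hθi).intervalIntegrable _ _
    have i2 : IntervalIntegrable (fun t => g t • E t y) volume 0 T :=
      (hgc.smul (hEx y)).intervalIntegrable _ _
    rw [intervalIntegral.integral_sub i1 i2]
    congr 1
    have hsw := swap_rect_smul hT hT (hgc.intervalIntegrable 0 T) (b := fun _ => 1)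
      intervalIntegrable_const hθ.continuousOn
    simp only [mul_one] at hsw
    simp_rw [← intervalIntegral.integral_smul]
    rw [hsw]
    refine intervalIntegral.integral_congr fun r hr => ?_
    rw [uIcc_of_le hT] at hr
    simp only [smul_smul]
    rw [intervalIntegral.integral_smul_const, cosLift_eq_integral hK hg hh hp hq hr.1 hpq]
  -- The two parts of z have the same source (K ∘ g')(0) y, one from w'', the other from the weak
  -- form at y. The source of w itself is (K ∘ w')(0) x = 0.
  have hzw : ∀ g, Tail g p → a (∫ t in (0 : ℝ)..T, g t • z t)
      = b (∫ t in (0 : ℝ)..T, deriv (deriv g) t • z t) := by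
    intro g hg
    have hw := (hg.cosLift hK hh hp hq).mono hpq
    have e1 := hE.weak_tail hK hT hw x
    have e2 := hE.weak_tail hK hT (hg.mono (by linarith)) y
    have hc2 := (hg.deriv.deriv.cosLift hK hh hp hq).continuous
    have e3 : ∫ t in (0 : ℝ)..T, deriv (deriv (cosLift K g h)) t • E t x
        = (∫ t in (0 : ℝ)..T, cosLift K (deriv (deriv g)) h t • E t x)
          + dc K (deriv g) 0 • y := by
      have i1 : IntervalIntegrable (fun t => cosLift K (deriv (deriv g)) h t • E t x) volume 0 T :=
        (hc2.smul (hEx x)).intervalIntegrable _ _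
      have i2 : IntervalIntegrable (fun t => dc K (deriv g) 0 • h t • E t x) volume 0 T :=
        ((hh.continuous.smul (hEx x)).const_smul _).intervalIntegrable _ _
      rw [hy, ← intervalIntegral.integral_smul, ← intervalIntegral.integral_add i1 i2]
      refine intervalIntegral.integral_congr fun t ht => ?_
      rw [uIcc_of_le hT] at ht
      simp only [deriv_deriv_cosLift hK hinj hp hq hg hh ht.1, add_smul, mul_smul]
    rw [hG g hg, hG _ hg.deriv.deriv, map_sub, e1, e2, e3, dc_deriv_cosLift_zero hK hp hq hg hh,
      ← map_sub]
    congr 1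
    module
  -- Uniqueness only tests z against functions K ∘ m, hence the special form of the left factor.
  have := hE.integral_dc_smul_eq_zero hK hT hEc hb (by linarith) hz hzw hm
  rw [hG _ (hm.dc hK)] at this
  exact sub_eq_zero.1 this

end Homomorphism

/-! ### Encoding a closed operator by bounded operators. -/

section Graph

/-- A closed operator is described by two bounded operators into a Banach space. -/
lemma exists_graph_operators {X : Type*} [NormedAddCommGroup X] [NormedSpace ℂ X] [CompleteSpace X]
    {A : X →ₗ.[ℂ] X} (hA : A.IsClosed) :
    ∃ (S : Submodule ℂ (X × X)) (_ : IsClosed (S : Set (X × X))) (a b : X →L[ℂ] (X × X) ⧸ S),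
      Function.Injective b ∧ ∀ u v, a u = b v ↔ ∃ h : u ∈ A.domain, A ⟨u, h⟩ = v := by
  have h : ∀ u v, A.graph.mkQL (u, 0) = -A.graph.mkQL (0, v)
      ↔ ∃ h : u ∈ A.domain, A ⟨u, h⟩ = v := fun u v => by
    rw [eq_neg_iff_add_eq_zero, ← map_add, Prod.mk_add_mk, add_zero, zero_add]
    change Submodule.Quotient.mk _ = _ ↔ _
    rw [Submodule.Quotient.mk_eq_zero, LinearPMap.mem_graph_iff]
    constructor
    · rintro ⟨⟨w, hw⟩, rfl, h2⟩
      exact ⟨hw, h2⟩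
    · rintro ⟨hu, h2⟩
      exact ⟨⟨u, hu⟩, rfl, h2⟩
  refine ⟨A.graph, hA, A.graph.mkQL.comp (ContinuousLinearMap.inl ℂ X X),
    -(A.graph.mkQL.comp (ContinuousLinearMap.inr ℂ X X)), ?_, fun u v => h u v⟩
  refine (injective_iff_map_eq_zero _).2 fun v hv => ?_
  -- Injectivity of b is single-valuedness: if (0, v) lies in the graph then v = A 0 = 0.
  obtain ⟨h0, h1⟩ := (h 0 v).1 (by
    rw [show ((0 : X), (0 : X)) = 0 from rfl, map_zero]
    exact hv.symm)
  rw [← h1]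
  exact map_zero A.toFun

end Graph

/-! ### Supports and uniqueness of representations. -/

section Representation

variable {k : ℝ → ℂ}

lemma exists_support_bound {f : ℝ → ℂ} (hk : LInt k) (hf : f ∈ Dinf k) :
    ∃ R, 0 ≤ R ∧ ∀ t, R < t → f t = 0 := by
  obtain ⟨g, hg, -, hgf⟩ := mem_Dinf_iff.1 hf 1 le_rfl
  obtain ⟨φ, R, hR, hφ, rfl⟩ := exists_tail_of_mem_Dplus hg
  refine ⟨R, hR, fun t ht => ?_⟩
  rw [← hgf, dualConv_indicator,
    indicator_of_mem (show t ∈ Ici (0 : ℝ) from hR.trans ht.le)]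
  exact (hφ.dc (hk.convPow 1)).zero t ht.le

lemma dc_convPow_succ (hk : LInt k) {n : ℕ} (hn : 1 ≤ n) {R : ℝ} {h : ℝ → ℂ} (hh : Tail h R) :
    dc (convPow k (n + 1)) h = dc (convPow k n) (dc k h) := by
  obtain ⟨n, rfl⟩ := Nat.exists_eq_add_of_le' hn
  exact dc_convPow_add hk hh n 0

/-- The support of `dc k h` controls that of `h`. -/
lemma Tail.of_dc (hk : LInt k) (hk0 : ZeroMemSupp k) {n : ℕ} (hn : 1 ≤ n) {R c : ℝ} {h : ℝ → ℂ}
    (hh : Tail h R) (h0 : ∀ t, c ≤ t → ConvolutedCosine.dc (convPow k n) h t = 0) : Tail h c :=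
  ⟨hh.smooth, eq_zero_of_dc_convPow_eq_zero hk hk0 hn hh h0⟩

lemma eq_of_dc_convPow_eq (hk : LInt k) (hk0 : ZeroMemSupp k) {n : ℕ} (hn : 1 ≤ n) {R R' : ℝ}
    {g h : ℝ → ℂ} (hg : Tail g R) (hh : Tail h R')
    (he : ∀ t, 0 ≤ t → dc (convPow k n) g t = dc (convPow k n) h t) :
    ∀ t, 0 ≤ t → g t = h t := fun t ht => by
  have hg' := hg.mono (le_max_left R R')
  have hh' := hh.mono (le_max_right R R')
  refine sub_eq_zero.1 (eq_zero_of_dc_convPow_eq_zero hk hk0 hn (c := 0) (hg'.sub hh')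
    (fun s hs => ?_) t ht)
  rw [dc_sub (hk.convPow n) hg' hh', he s hs, sub_self]

end Representation

/-! ### Independence of n and the linear map 𝒞. -/

section Calculus

variable {X Z : Type*} [NormedAddCommGroup X] [NormedSpace ℂ X] [CompleteSpace X]
  [NormedAddCommGroup Z] [NormedSpace ℂ Z] [CompleteSpace Z]
  {a b : X →L[ℂ] Z} {k : ℝ → ℂ} {τ : ℝ} {E : ℕ → ℝ → X →L[ℂ] X}

/-- A sequence of families belonging to the convolution powers of `k`. -/
structure IsTower (a b : X →L[ℂ] Z) (k : ℝ → ℂ) (τ : ℝ) (E : ℕ → ℝ → X →L[ℂ] X) : Prop where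
  family : ∀ n : ℕ, 1 ≤ n → IsFamily a b (convPow k n) (n * τ) (E n)
  succ : ∀ n : ℕ, 1 ≤ n → ∀ t ∈ Icc 0 (n * τ), ∀ x, E (n + 1) t x = cv k (fun s => E n s x) t

omit [CompleteSpace Z] in
-- As h vanishes beyond nτ, only the range where E_{n+1} = k * E_n matters, and duality moves k onto
-- h.
lemma IsTower.integral_succ (hE : IsTower a b k τ E) (hk : LInt k) (hτ : 0 < τ) {n : ℕ}
    (hn : 1 ≤ n) {h : ℝ → ℂ} (hh : Tail h (n * τ)) (x : X) :
    ∫ t in (0 : ℝ)..(((n + 1 : ℕ) : ℝ) * τ), h t • E (n + 1) t x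
      = ∫ t in (0 : ℝ)..(n * τ), dc k h t • E n t x := by
  have hT : 0 ≤ (n : ℝ) * τ := by positivity
  have hle : (n : ℝ) * τ ≤ ((n + 1 : ℕ) : ℝ) * τ := by
    push_cast
    linarith
  have hi := ((hE.family n hn).cont x).intervalIntegrable_of_Icc hT (μ := volume)
  rw [← integral_smul_cv_eq_dc hT (hk _ hT) hi hh.continuous hh.zero,
    intervalIntegral.integral_of_le hT, intervalIntegral.integral_of_le (hT.trans hle)]
  rw [setIntegral_eq_of_subset_of_forall_sdiff_eq_zero measurableSet_Ioc
      (Ioc_subset_Ioc_right hle) fun u hu => ?_]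
  · exact setIntegral_congr_fun measurableSet_Ioc fun t ht => by
      simp only [hE.succ n hn t ⟨ht.1.le, ht.2⟩ x]
  · rw [hh.zero, zero_smul]
    by_contra hc
    exact hu.2 ⟨hu.1.1, (not_le.1 hc).le⟩

omit [CompleteSpace Z] in
-- Induction lowers n to m, replacing h by k ∘ h each time; at n = m injectivity identifies the two
-- representing functions.
lemma IsTower.integral_eq_of_le (hE : IsTower a b k τ E) (hk : LInt k) (hk0 : ZeroMemSupp k)
    (hτ : 0 < τ) {m : ℕ} (hm : 1 ≤ m) {n : ℕ} (hmn : m ≤ n) {g h : ℝ → ℂ}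
    (hg : Tail g (m * τ)) (hh : Tail h (m * τ))
    (he : ∀ t, 0 ≤ t → dc (convPow k n) h t = dc (convPow k m) g t) (x : X) :
    ∫ t in (0 : ℝ)..(n * τ), h t • E n t x = ∫ t in (0 : ℝ)..(m * τ), g t • E m t x := by
  have hT : 0 ≤ (m : ℝ) * τ := by positivity
  induction n, hmn using Nat.le_induction generalizing h with
  | base =>
    refine intervalIntegral.integral_congr fun t ht => ?_
    rw [uIcc_of_le hT] at ht
    simp only [eq_of_dc_convPow_eq hk hk0 hm hh hg he t ht.1]
  | succ n hmn ih =>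
    have hn : 1 ≤ n := hm.trans hmn
    have hle : (m : ℝ) * τ ≤ n * τ := by
      have : (m : ℝ) ≤ n := by exact_mod_cast hmn
      gcongr
    rw [hE.integral_succ hk hτ hn (hh.mono hle)]
    refine ih (hh.dc hk) fun t ht => ?_
    rw [← he t ht, dc_convPow_succ hk hn hh]

omit [CompleteSpace Z] in
/-- The value of the smoothed family does not depend on the representation of the test function. -/
lemma IsTower.integral_eq (hE : IsTower a b k τ E) (hk : LInt k) (hk0 : ZeroMemSupp k)
    (hτ : 0 < τ) {m n : ℕ} (hm : 1 ≤ m) (hn : 1 ≤ n) {g h : ℝ → ℂ}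
    (hg : Tail g (m * τ)) (hh : Tail h (n * τ))
    (he : ∀ t, 0 ≤ t → dc (convPow k n) h t = dc (convPow k m) g t) (x : X) :
    ∫ t in (0 : ℝ)..(n * τ), h t • E n t x = ∫ t in (0 : ℝ)..(m * τ), g t • E m t x := by
  have key : ∀ {m n : ℕ} {g h : ℝ → ℂ}, 1 ≤ m → m ≤ n → Tail g (m * τ) → Tail h (n * τ) →
      (∀ t, 0 ≤ t → dc (convPow k n) h t = dc (convPow k m) g t) →
      ∫ t in (0 : ℝ)..(n * τ), h t • E n t x = ∫ t in (0 : ℝ)..(m * τ), g t • E m t x := by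
    intro m n g h hm hmn hg hh he
    have hT : 0 ≤ (m : ℝ) * τ := by positivity
    refine hE.integral_eq_of_le hk hk0 hτ hm hmn hg ?_ he x
    -- A priori h reaches as far as nτ. Its image equals k^{*m} ∘ g, which vanishes beyond mτ, so
    -- the support version of injectivity confines h to the shorter interval.
    refine hh.of_dc hk hk0 (hm.trans hmn) fun t ht => ?_
    rw [he t (hT.trans ht)]
    exact (hg.dc (hk.convPow m)).zero t ht
  rcases le_total m n with h1 | h1
  · exact key hm h1 hg hh he
  · exact (key hn h1 hh hg fun t ht => (he t ht).symm).symm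

lemma exists_representation (hk : LInt k) (hk0 : ZeroMemSupp k) (hτ : 0 < τ) (f : Dinf k) :
    ∃ n : ℕ, 1 ≤ n ∧ ∃ g, Tail g (n * τ) ∧
      (f : ℝ → ℂ) = (Ici 0).indicator (dc (convPow k n) g) := by
  obtain ⟨R, hR, h0⟩ := exists_support_bound hk f.2
  obtain ⟨n, hn⟩ := exists_nat_ge (R / τ)
  have hn' : R ≤ ((n + 1 : ℕ) : ℝ) * τ := by
    rw [div_le_iff₀ hτ] at hn
    push_cast
    linarith
  obtain ⟨g, hg, -, hgf, -⟩ := exists_tail_of_mem_Dinf hk hk0 f.2 (hR.trans hn')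
    (fun t ht => h0 t (hn'.trans_lt ht)) (Nat.le_add_left 1 n)
  exact ⟨n + 1, Nat.le_add_left 1 n, g, hg, hgf⟩

omit [CompleteSpace Z] in
/-- The smoothed family, as a linear map on the test space. -/
lemma IsTower.exists_calculus (hE : IsTower a b k τ E) (hk : LInt k) (hk0 : ZeroMemSupp k)
    (hτ : 0 < τ) :
    ∃ 𝒞 : Dinf k →ₗ[ℂ] (X →L[ℂ] X), ∀ (f : Dinf k) (n : ℕ), 1 ≤ n → ∀ g, Tail g (n * τ) →
      (f : ℝ → ℂ) = (Ici 0).indicator (dc (convPow k n) g) →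
      ∀ x, 𝒞 f x = ∫ t in (0 : ℝ)..(n * τ), g t • E n t x := by
  have hT : ∀ n : ℕ, 0 ≤ (n : ℝ) * τ := fun n => by positivity
  have hop : ∀ f : Dinf k, ∃ L : X →L[ℂ] X, ∀ n : ℕ, 1 ≤ n → ∀ g, Tail g (n * τ) →
      (f : ℝ → ℂ) = (Ici 0).indicator (dc (convPow k n) g) →
      ∀ x, L x = ∫ t in (0 : ℝ)..(n * τ), g t • E n t x := by
    intro f
    obtain ⟨m, hm, g₀, hg₀, hf₀⟩ := exists_representation hk hk0 hτ f
    obtain ⟨L, hL⟩ := exists_integral_operator (hT m) (hg₀.continuous.intervalIntegrable _ _)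
      (hE.family m hm).cont
    refine ⟨L, fun n hn g hg hf x => ?_⟩
    rw [hL]
    exact hE.integral_eq hk hk0 hτ hn hm hg hg₀
      (fun t ht => eq_of_indicator_Ici_eq (hf₀.symm.trans hf) ht) x
  choose L hL using hop
  have hi : ∀ (n : ℕ), 1 ≤ n → ∀ g, Tail g (n * τ) → ∀ x,
      IntervalIntegrable (fun t => g t • E n t x) volume 0 (n * τ) := fun n hn g hg x =>
    intervalIntegrable_smul_left (hT n) (hg.continuous.intervalIntegrable _ _)
      ((hE.family n hn).cont x)
  refine ⟨{ toFun := L, map_add' := fun f₁ f₂ => ?_, map_smul' := fun c f => ?_ }, hL⟩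
  -- Additivity requires one n that serves both supports.
  · obtain ⟨R₁, hR₁, h₁⟩ := exists_support_bound hk f₁.2
    obtain ⟨R₂, hR₂, h₂⟩ := exists_support_bound hk f₂.2
    obtain ⟨n, hn⟩ := exists_nat_ge (max R₁ R₂ / τ)
    have hn' : max R₁ R₂ ≤ ((n + 1 : ℕ) : ℝ) * τ := by
      rw [div_le_iff₀ hτ] at hn
      push_cast
      linarith
    have hn1 : 1 ≤ n + 1 := Nat.le_add_left 1 n
    obtain ⟨g₁, hg₁, -, hf₁, -⟩ := exists_tail_of_mem_Dinf hk hk0 f₁.2 (hT (n + 1))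
      (fun t ht => h₁ t (((le_max_left _ _).trans hn').trans_lt ht)) hn1
    obtain ⟨g₂, hg₂, -, hf₂, -⟩ := exists_tail_of_mem_Dinf hk hk0 f₂.2 (hT (n + 1))
      (fun t ht => h₂ t (((le_max_right _ _).trans hn').trans_lt ht)) hn1
    have hf : ((f₁ + f₂ : Dinf k) : ℝ → ℂ)
        = (Ici 0).indicator (dc (convPow k (n + 1)) fun s => g₁ s + g₂ s) := by
      rw [Submodule.coe_add, hf₁, hf₂, ← indicator_add']
      exact indicator_Ici_congr fun t _ => (dc_add (hk.convPow _) hg₁ hg₂ t).symm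
    ext x
    rw [_root_.add_apply, hL _ _ hn1 _ hg₁ hf₁, hL _ _ hn1 _ hg₂ hf₂, hL _ _ hn1 _ (hg₁.add hg₂) hf,
      ← intervalIntegral.integral_add (hi _ hn1 _ hg₁ x) (hi _ hn1 _ hg₂ x)]
    simp only [add_smul]
  · obtain ⟨n, hn, g, hg, hf⟩ := exists_representation hk hk0 hτ f
    have hcf : ((c • f : Dinf k) : ℝ → ℂ)
        = (Ici 0).indicator (dc (convPow k n) fun s => c * g s) := by
      rw [Submodule.coe_smul, hf]
      refine (indicator_const_smul _ c _).symm.trans ?_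
      exact indicator_Ici_congr fun t _ => (dc_const_mul _ g c t).symm
    ext x
    rw [RingHom.id_apply, _root_.smul_apply, hL _ _ hn _ hg hf, hL _ _ hn _ (hg.const_mul c) hcf,
      ← intervalIntegral.integral_smul]
    simp only [mul_smul]

end Calculus

/-! ### The three assertions for the tower of extended families. -/

section Tower

variable {X Z : Type*} [NormedAddCommGroup X] [NormedSpace ℂ X] [CompleteSpace X]
  [NormedAddCommGroup Z] [NormedSpace ℂ Z] [CompleteSpace Z]
  {a b : X →L[ℂ] Z} {k : ℝ → ℂ} {τ : ℝ} {C : ℝ → X →L[ℂ] X} {E : ℕ → ℝ → X →L[ℂ] X}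

lemma exists_tower (hk : LInt k) (hτ : 0 < τ) (hb : Function.Injective b)
    (hC : IsFamily a b k τ C) :
    ∃ E : ℕ → ℝ → X →L[ℂ] X, IsTower a b k τ E ∧
      ∀ n : ℕ, 1 ≤ n → ∀ t ∈ Icc 0 (n * τ), ∀ x, extFamily k τ C n t x = E n t x := by
  have h : ∀ n : ℕ, ∃ F : ℝ → X →L[ℂ] X, 1 ≤ n →
      (∀ t ∈ Icc 0 (n * τ), ∀ x, extFamily k τ C n t x = F t x) ∧
      IsFamily a b (convPow k n) (n * τ) F := fun n => by
    cases n with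
    | zero => exact ⟨0, fun h => absurd h (by simp)⟩
    | succ n =>
      obtain ⟨F, h1, h2⟩ := exists_family_extFamily hk hτ hb hC n
      exact ⟨F, fun _ => ⟨h1, h2⟩⟩
  choose E hE using h
  refine ⟨E, ⟨fun n hn => (hE n hn).2, fun n hn t ht x => ?_⟩, fun n hn => (hE n hn).1⟩
  have ht' : t ∈ Icc 0 (((n + 1 : ℕ) : ℝ) * τ) := ⟨ht.1, ht.2.trans (by push_cast; linarith)⟩
  rw [← (hE (n + 1) (by linarith)).1 t ht' x]
  obtain ⟨n, rfl⟩ := Nat.exists_eq_add_of_le' hn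
  change extStep k τ C (n + 1) (extFamily k τ C (n + 1)) t x = _
  rw [extStep, if_pos ht.2]
  exact cv_congr ht.1 (fun _ _ => rfl) fun s hs => (hE (n + 1) hn).1 s ⟨hs.1, hs.2.trans ht.2⟩ x

/-- `𝒞` is given by the smoothed families. -/
def IsCalculus (k : ℝ → ℂ) (τ : ℝ) (E : ℕ → ℝ → X →L[ℂ] X)
    (𝒞 : Dinf k →ₗ[ℂ] (X →L[ℂ] X)) : Prop :=
  ∀ (f : Dinf k) (n : ℕ), 1 ≤ n → ∀ g, Tail g (n * τ) →
    (f : ℝ → ℂ) = (Ici 0).indicator (dc (convPow k n) g) →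
    ∀ x, 𝒞 f x = ∫ t in (0 : ℝ)..(n * τ), g t • E n t x

variable {𝒞 : Dinf k →ₗ[ℂ] (X →L[ℂ] X)}

omit [CompleteSpace X] in
lemma IsCalculus.norm_sub_le (h𝒞 : IsCalculus k τ E 𝒞) (hk : LInt k) (hk0 : ZeroMemSupp k)
    (hτ : 0 < τ) {n : ℕ} (hn : 1 ≤ n) {M : ℝ} (hM0 : 0 ≤ M)
    (hM : ∀ t ∈ Icc 0 (n * τ), ‖E n t‖ ≤ M)
    (hc : ∀ x, ContinuousOn (fun t => E n t x) (Icc 0 (n * τ))) {f₁ f₂ : Dinf k}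
    (h₁ : ∀ t, n * τ < t → (f₁ : ℝ → ℂ) t = 0) (h₂ : ∀ t, n * τ < t → (f₂ : ℝ → ℂ) t = 0) {δ : ℝ}
    (hδ : 0 ≤ δ) (h : ∀ t, dist (W (convPow k n) f₁ t) (W (convPow k n) f₂ t) ≤ δ) :
    ‖𝒞 f₁ - 𝒞 f₂‖ ≤ δ * M * (n * τ) := by
  have hT : 0 ≤ (n : ℝ) * τ := by positivity
  obtain ⟨g₁, hg₁, -, hf₁, hW₁⟩ := exists_tail_of_mem_Dinf hk hk0 f₁.2 hT h₁ hn
  obtain ⟨g₂, hg₂, -, hf₂, hW₂⟩ := exists_tail_of_mem_Dinf hk hk0 f₂.2 hT h₂ hn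
  have hi : ∀ {g x}, Tail g (n * τ) →
      IntervalIntegrable (fun t => g t • E n t x) volume 0 (n * τ) := fun hg =>
    intervalIntegrable_smul_left hT (hg.continuous.intervalIntegrable _ _) (hc _)
  refine ContinuousLinearMap.opNorm_le_bound _ (by positivity) fun x => ?_
  rw [_root_.sub_apply, h𝒞 _ n hn g₁ hg₁ hf₁, h𝒞 _ n hn g₂ hg₂ hf₂,
    ← intervalIntegral.integral_sub (hi hg₁) (hi hg₂)]
  have := intervalIntegral.norm_integral_le_of_norm_le_const (a := 0) (b := n * τ)
    (f := fun t => g₁ t • E n t x - g₂ t • E n t x) (C := δ * (M * ‖x‖)) fun t ht => by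
      rw [uIoc_of_le hT] at ht
      have h3 := h t
      rw [hW₁, hW₂, indicator_Ici_of_nonneg _ ht.1.le, indicator_Ici_of_nonneg _ ht.1.le,
        dist_eq_norm] at h3
      rw [← sub_smul, norm_smul]
      refine mul_le_mul h3 ?_ (norm_nonneg _) hδ
      exact ((E n t).le_opNorm x).trans
        (mul_le_mul_of_nonneg_right (hM t ⟨ht.1.le, ht.2⟩) (norm_nonneg _))
  rw [sub_zero, abs_of_nonneg hT] at this
  refine this.trans_eq ?_
  ring

omit [CompleteSpace X] in
-- Only the derivative of order m = 0 in `smoothTopology` is used.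
lemma continuous_step {n : ℕ} (hn : 1 ≤ n) (α : ℝ) :
    Continuous[stepTopology k α, inferInstance]
      (fun f : DinfStep k α => UniformFun.ofFun (W (convPow k n) (f : Dinf k))) := by
  refine continuous_iff_le_induced.2 ?_
  refine (iInf₂_le n hn).trans ?_
  refine (induced_mono (iInf_le _ 0)).trans ?_
  rw [induced_compose]
  refine le_of_eq ?_
  congr 1

omit [CompleteSpace Z] in
-- The topology induced by 𝒞 is itself a locally convex vector space topology. Once the inclusions
-- of the steps are continuous for it, it is coarser than the inductive limit topology, and 𝒞 is
-- continuous.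
lemma IsTower.continuous_calculus (hE : IsTower a b k τ E) (hk : LInt k) (hk0 : ZeroMemSupp k)
    (hτ : 0 < τ) (h𝒞 : IsCalculus k τ E 𝒞) : Continuous[testTopology k, inferInstance] 𝒞 := by
  refine continuous_sInf_dom (t₁ := {t | @IsTopologicalAddGroup (Dinf k) t _ ∧
    @ContinuousSMul ℂ (Dinf k) _ _ t ∧ @LocallyConvexSpace ℝ (Dinf k) _ _ _ _ t ∧
    ∀ a : ℝ, Continuous[stepTopology k a, t] (Subtype.val : DinfStep k a → Dinf k)})
    (t := TopologicalSpace.induced 𝒞 inferInstance) ⟨?_, ?_, ?_, fun α => ?_⟩ continuous_induced_dom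
  · exact topologicalAddGroup_induced 𝒞
  · exact continuousSMul_induced 𝒞
  · exact LocallyConvexSpace.induced (𝒞.restrictScalars ℝ)
  · refine continuous_induced_rng.2 ?_
    obtain ⟨n, hn⟩ := exists_nat_ge (α / τ)
    have hn' : α ≤ ((n + 1 : ℕ) : ℝ) * τ := by
      rw [div_le_iff₀ hτ] at hn
      push_cast
      linarith
    have hn1 : 1 ≤ n + 1 := Nat.le_add_left 1 n
    have hF := hE.family (n + 1) hn1
    obtain ⟨M, hM0, hM⟩ := exists_norm_le_of_continuousOn hF.cont
    have hz : ∀ f : DinfStep k α, ∀ t, ((n + 1 : ℕ) : ℝ) * τ < t → ((f : Dinf k) : ℝ → ℂ) t = 0 :=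
      fun f t ht => eq_zero_of_tsupport_subset f.2 (hn'.trans_lt ht)
    let := stepTopology k α
    have hW := continuous_step (k := k) hn1 α
    rw [continuous_iff_continuousAt] at hW ⊢
    intro f₀
    have h1 := Metric.tendstoUniformly_iff.1 (UniformFun.tendsto_iff_tendstoUniformly.1 (hW f₀))
    refine Metric.tendsto_nhds.2 fun ε hε => ?_
    set B := M * (((n + 1 : ℕ) : ℝ) * τ) with hB
    have hB0 : 0 ≤ B := by positivity
    filter_upwards [h1 (ε / (B + 1)) (by positivity)] with f hf
    have h2 := h𝒞.norm_sub_le hk hk0 hτ hn1 hM0 hM hF.cont (hz f₀) (hz f)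
      (by positivity : 0 ≤ ε / (B + 1)) fun t => (hf t).le
    rw [dist_comm, dist_eq_norm]
    refine h2.trans_lt ?_
    rw [mul_assoc, ← hB, div_mul_eq_mul_div, div_lt_iff₀ (by positivity)]
    nlinarith

lemma cosConv_mem_Dinf (hk : LInt k) (hk0 : ZeroMemSupp k) (φ ψ : Dinf k) :
    cosConv φ ψ ∈ Dinf k := by
  obtain ⟨R₁, hR₁, h₁⟩ := exists_support_bound hk φ.2
  obtain ⟨R₂, hR₂, h₂⟩ := exists_support_bound hk ψ.2
  refine mem_Dinf_iff.2 fun n hn => ?_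
  obtain ⟨g, hg, -, hφ, -⟩ := exists_tail_of_mem_Dinf hk hk0 φ.2 hR₁ h₁ hn
  obtain ⟨h, hh, -, hψ, -⟩ := exists_tail_of_mem_Dinf hk hk0 ψ.2 hR₂ h₂ hn
  rw [hφ, hψ, cosConv_indicator,
    indicator_Ici_congr fun t ht => (dc_cosLift (hk.convPow n) hg hh hR₁ hR₂ ht).symm]
  exact (hg.cosLift (hk.convPow n) hh hR₁ hR₂).indicator_mem_Dk (hk.convPow n)

lemma IsTower.calculus_mul (hE : IsTower a b k τ E) (hk : LInt k) (hk0 : ZeroMemSupp k)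
    (hτ : 0 < τ) (hb : Function.Injective b) (h𝒞 : IsCalculus k τ E 𝒞) (φ ψ : Dinf k)
    (hφψ : cosConv φ ψ ∈ Dinf k) : 𝒞 ⟨cosConv φ ψ, hφψ⟩ = 𝒞 φ ∘L 𝒞 ψ := by
  obtain ⟨R₁, hR₁, h₁⟩ := exists_support_bound hk φ.2
  obtain ⟨R₂, hR₂, h₂⟩ := exists_support_bound hk ψ.2
  obtain ⟨n, hn⟩ := exists_nat_ge ((R₁ + R₂) / τ)
  have hn' : R₁ + R₂ ≤ ((n + 1 : ℕ) : ℝ) * τ := by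
    rw [div_le_iff₀ hτ] at hn
    push_cast
    linarith
  have hT : 0 ≤ ((n + 1 : ℕ) : ℝ) * τ := by positivity
  have hn1 : 1 ≤ n + 1 := Nat.le_add_left 1 n
  have hK := hk.convPow (n + 1)
  -- The power 2(n + 1) is chosen to write φ = K ∘ (K ∘ m) with K = k^{*(n+1)}, so that the
  -- representing function of φ at level n + 1 has the form K ∘ m.
  obtain ⟨m, hm, -, hφ, -⟩ := exists_tail_of_mem_Dinf hk hk0 φ.2 hR₁ h₁
    (show 1 ≤ n + 1 + (n + 1) by omega)
  obtain ⟨h, hh, -, hψ, -⟩ := exists_tail_of_mem_Dinf hk hk0 ψ.2 hR₂ h₂ hn1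
  rw [dc_convPow_add hk hm] at hφ
  have hg := hm.dc hK
  have hφψ' : cosConv φ ψ
      = (Ici 0).indicator (dc (convPow k (n + 1))
        (cosLift (convPow k (n + 1)) (dc (convPow k (n + 1)) m) h)) := by
    rw [hφ, hψ, cosConv_indicator]
    exact indicator_Ici_congr fun t ht => (dc_cosLift hK hg hh hR₁ hR₂ ht).symm
  ext x
  rw [ContinuousLinearMap.comp_apply,
    h𝒞 ⟨cosConv φ ψ, hφψ⟩ (n + 1) hn1 _ ((hg.cosLift hK hh hR₁ hR₂).mono hn') hφψ',
    h𝒞 φ (n + 1) hn1 _ (hg.mono (by linarith)) hφ, h𝒞 ψ (n + 1) hn1 h (hh.mono (by linarith)) hψ]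
  exact (hE.family (n + 1) hn1).integral_cosLift hK hT hb
    (fun φ R hφ h0 => eq_zero_of_dc_convPow_eq_zero hk hk0 hn1 hφ h0) hR₁ hR₂ hn' hm hh x

lemma D1_D1_mem (hk : LInt k) (hk0 : ZeroMemSupp k) (f : Dinf k) : D1 (D1 f) ∈ Dinf k := by
  obtain ⟨R, hR, h⟩ := exists_support_bound hk f.2
  refine mem_Dinf_iff.2 fun n hn => ?_
  obtain ⟨g, hg, -, hf, -⟩ := exists_tail_of_mem_Dinf hk hk0 f.2 hR h hn
  have hK := hk.convPow n
  rw [hf, D1_indicator (hg.dc hK).smooth, D1_indicator (contDiff_deriv (hg.dc hK).smooth),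
    deriv_dc hK hg, deriv_dc hK hg.deriv]
  exact hg.deriv.deriv.indicator_mem_Dk hK

lemma IsTower.map_calculus (hE : IsTower a b k τ E) (hk : LInt k) (hk0 : ZeroMemSupp k)
    (hτ : 0 < τ) (h𝒞 : IsCalculus k τ E 𝒞) (f : Dinf k) (hf'' : D1 (D1 f) ∈ Dinf k) (x : X) :
    a (𝒞 f x) = b (𝒞 ⟨D1 (D1 f), hf''⟩ x + D1 f 0 • x) := by
  obtain ⟨n, hn, g, hg, hf⟩ := exists_representation hk hk0 hτ f
  have hK := hk.convPow n
  have hf1 : D1 f = (Ici 0).indicator (dc (convPow k n) (deriv g)) := by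
    rw [hf, D1_indicator (hg.dc hK).smooth, deriv_dc hK hg]
  have hf2 : D1 (D1 f) = (Ici 0).indicator (dc (convPow k n) (deriv (deriv g))) := by
    rw [hf1, D1_indicator (hg.deriv.dc hK).smooth, deriv_dc hK hg.deriv]
  rw [h𝒞 f n hn g hg hf, h𝒞 ⟨D1 (D1 f), hf''⟩ n hn _ hg.deriv.deriv hf2, hf1,
    indicator_Ici_of_nonneg _ le_rfl]
  exact (hE.family n hn).weak_tail hK (by positivity) hg x

end Tower

lemma IsLocalConvolutedCosine.isFamily {X Z : Type*} [NormedAddCommGroup X] [NormedSpace ℂ X]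
    [NormedAddCommGroup Z] [NormedSpace ℂ Z] {A : X →ₗ.[ℂ] X} {k : ℝ → ℂ} {τ : ℝ}
    {C : ℝ → X →L[ℂ] X} (hC : IsLocalConvolutedCosine A k τ C) {a b : X →L[ℂ] Z}
    (hab : ∀ u v, a u = b v ↔ ∃ h : u ∈ A.domain, A ⟨u, h⟩ = v) : IsFamily a b k τ C where
  cont := hC.continuousOn
  comm t ht u v huv := by
    obtain ⟨hu, rfl⟩ := (hab u v).1 huv
    exact (hab _ _).2 (hC.commutes t ht ⟨u, hu⟩)
  duhamel t ht x := by
    obtain ⟨h, he⟩ := hC.duhamel t ht x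
    rw [primitive_eq ht.1]
    exact (hab _ _).2 ⟨h, he⟩

end ConvolutedCosine

open ConvolutedCosine
theorem mainTheorem2 {X : Type*} [NormedAddCommGroup X] [NormedSpace ℂ X] [CompleteSpace X]
    (k : ℝ → ℂ) (hk : LocallyIntegrableOn k (Ici 0)) (hk0 : ZeroMemSupp k)
    (τ : ℝ) (hτ : 0 < τ) (A : X →ₗ.[ℂ] X) (C : ℝ → X →L[ℂ] X)
    (hC : IsLocalConvolutedCosine A k τ C) (hnd : NonDegenerate τ C) :
    ∃ 𝒞 : Dinf k →ₗ[ℂ] (X →L[ℂ] X),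
      (∀ (f : Dinf k) (n : ℕ), 1 ≤ n → tsupport (f : ℝ → ℂ) ⊆ Icc 0 (n * τ) → ∀ x : X,
        IntervalIntegrable (fun t => W (convPow k n) f t • extFamily k τ C n t x)
          volume 0 (n * τ) ∧
        𝒞 f x = ∫ t in (0 : ℝ)..(n * τ), W (convPow k n) f t • extFamily k τ C n t x) ∧
      Continuous[testTopology k, inferInstance] 𝒞 ∧
      (∀ φ ψ : Dinf k, ∃ h : cosConv φ ψ ∈ Dinf k, 𝒞 ⟨cosConv φ ψ, h⟩ = 𝒞 φ ∘L 𝒞 ψ) ∧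
      (∀ f : Dinf k, ∃ h : D1 (D1 f) ∈ Dinf k, ∀ x : X, ∃ hx : 𝒞 f x ∈ A.domain,
        A ⟨𝒞 f x, hx⟩ = 𝒞 ⟨D1 (D1 f), h⟩ x + D1 f 0 • x) := by
  have hki := LInt.of_locallyIntegrableOn hk
  obtain ⟨S, hS, a, b, hb, hab⟩ := exists_graph_operators hC.isClosed
  -- Closedness of the graph makes the quotient a normed space, so that the results on families
  -- apply with it as Z.
  have := hS
  obtain ⟨E, hE, hEe⟩ := exists_tower hki hτ hb (hC.isFamily hab)
  obtain ⟨𝒞, h𝒞⟩ := hE.exists_calculus hki hk0 hτ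
  refine ⟨𝒞, fun f n hn hf x => ?_, hE.continuous_calculus hki hk0 hτ h𝒞, fun φ ψ => ?_,
    fun f => ?_⟩
  · have hT : 0 ≤ (n : ℝ) * τ := by positivity
    obtain ⟨g, hg, -, hfg, hW⟩ := exists_tail_of_mem_Dinf hki hk0 f.2 hT
      (fun t ht => eq_zero_of_tsupport_subset hf ht) hn
    have he : EqOn (fun t => g t • E n t x) (fun t => W (convPow k n) f t • extFamily k τ C n t x)
        (Icc 0 (n * τ)) := fun t ht => by
      simp only [hW, indicator_Ici_of_nonneg _ ht.1, hEe n hn t ht x]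
    refine ⟨?_, ?_⟩
    · refine (intervalIntegrable_smul_left hT (hg.continuous.intervalIntegrable _ _)
        ((hE.family n hn).cont x)).congr ?_
      rw [uIoc_of_le hT]
      exact he.mono Ioc_subset_Icc_self
    · rw [h𝒞 f n hn g hg hfg x]
      exact intervalIntegral.integral_congr (by rwa [uIcc_of_le hT])
  · have h := cosConv_mem_Dinf hki hk0 φ ψ
    exact ⟨h, hE.calculus_mul hki hk0 hτ hb h𝒞 φ ψ h⟩
  · have h := D1_D1_mem hki hk0 f
    exact ⟨h, fun x => (hab _ _).1 (hE.map_calculus hki hk0 hτ h𝒞 f h x)⟩
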